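/- **Setting.** Let $L,M,\sigma>0$, let $U\subset\mathbb R$ be compact, and write $\mathcal P_{T,L}$ for the set of probability measures on $\mathcal C([0,T]:[0,L])$ (uniform metric), $\nu(t)$ for the time-$t$ marginal of $\nu\in\mathcal P_{T,L}$, and $W_1$ for the Wasserstein distance of order one. Let $b,f:[0,M]\times\mathcal P([0,L])\times[0,L]\times U\to\mathbb R$, $g:\mathcal P([0,L])\times[0,L]\to\mathbb R$ and $y,r:[0,M]\to\mathbb R$ satisfy, for some $c_L>0$ and all arguments, $$|f(t,\eta,x,u)-f(t',\eta',x',u')|+|g(\eta,x)-g(\eta',x')|+|b(t,\eta,x,u)-b(t',\eta',x',u')|+|y(t)-y(t')|+|r(t)-r(t')|\le c_L\big(|t-t'|+W_1(\eta,\eta')+|x-x'|+|u-u'|\big).$$ Assume that for all $(t,\eta,x,p)\in[0,M]\times\mathcal P([0,L])\times[0,L]\times\mathbb R$ the function $u\mapsto f(t,\eta,x,u)+b(t,\eta,x,u)p$ has a unique minimizer $\hat\alpha(t,\eta,x,p)$ over $U$, and that for some $c_\alpha>0$ $$|\hat\alpha(t,\eta,x,p)-\hat\alpha(t,\eta',x',p')|\le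 c_\alpha\big(W_1(\eta,\eta')+|x-x'|+|p-p'|\big).$$ **The scheme.** Let $0<T\le M$. A mesh $h>0$ is *admissible* if $L/h$ and $I(h)=T/\Delta^h$ are integers, where $\Delta^h=h^2/\sigma^2$, and $h\sup_{t\le T}|b|<\sigma^2$. Let $\mathbb S^h=\{-h,0,h,\dots,L,L+h\}$. For $\nu\in\mathcal P_{T,L}$ consider the controlled chain on $\mathbb S^h$ with a clock: from a position $x\notin\{-h,L+h\}$ at clock time $t<T$, under the control $u\in U$, it moves to $x\pm h$ with probabilities $\frac{\pm h\,b(t,\nu(t),x,u)+\sigma^2}{2\sigma^2}$ and the clock advances by $\Delta^h$; from $-h$ (resp. $L+h$) it moves to $0$ (resp. $L$) and the clock does not advance; it stops at clock time $T$, after a possible reflection. Controls are $U$-valued and depend on the past and present of the chain. Let $X^{h,\nu}(j\Delta^h)$ be the last position at clock time $j\Delta^h$. Let $V^h_\nu(t,x)$, for $t\in\{0,\Delta^h,\dots,T\}$ and $x\in\{0,h,\dots,L\}$, be the infimum over all such controls of the expected cost of the chain started from $x$ at clock time $t$: each step at clock time $s$ from $x\notin\{-h,L+h\}$ with control $u$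 costs $f(s,\nu(s),x,u)\Delta^h$, each step from $-h$ costs $y(s)h$, each step from $L+h$ costs $r(s)h$, and there is a terminal cost $g(\nu(T),X^{h,\nu}(T))$. Extend $V^h_\nu(t,-h)=y(t)h+V^h_\nu(t,0)$, $V^h_\nu(t,L+h)=r(t)h+V^h_\nu(t,L)$, and put $\mathcal D^h_xV^h_\nu(t,x)=\frac1{2h}\big(V^h_\nu(t+\Delta^h,x+h)-V^h_\nu(t+\Delta^h,x-h)\big)$. Given a starting point $x^h_0\in\mathbb S^h$, let $\Phi^h(\nu)\in\mathcal P_{T,L}$ be the law of the piecewise linear interpolation of the values $X^{h,\nu}(j\Delta^h)$, $0\le j\le I(h)$, for the chain started from $x_0^h$ at time $0$ under the feedback control $(t,x)\mapsto\hat\alpha\big(t,\nu(t),x,\mathcal D^h_xV^h_\nu(t,x)\big)$. **Proposition.** There exist $\hat T\in(0,M]$, $\hat h>0$ and $q\in(0,1)$ such that the following hold for every $T\in(0,\hat T]$. 1. For every admissible $h<\hat h\wedge\hat T$, every $x_0^h\in\mathbb S^h$ and all $\nu,\nu'\in\mathcal P_{T,L}$, $$W_1^2(\Phi^h(\nu),\Phi^h(\nu'))\le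 q\big(h^2+W_1^2(\nu,\nu')\big).$$ 2. For all choices of starting points $x^h_0\in\mathbb S^h$ and initial measures $\nu^1=\nu^1_h\in\mathcal P_{T,L}$ ($h$ admissible), put $\nu^{k+1}=\Phi^h(\nu^k)$ for $k\ge1$. For every admissible $h<\hat h\wedge\hat T$ there is a $k\ge1$ with $W_1^2(\Phi^h(\nu^k),\nu^k)\le\frac{2q}{1-q}h^2$. With $k_h$ the least such $k$ and $\nu_h=\nu^{k_h}$, $$\lim_{h\to0}W_1^2(\Phi^h(\nu_h),\nu_h)=0,$$ where $h\to0$ through admissible meshes. -/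

import Mathlib

noncomputable section

namespace MFG

open MeasureTheory

/-! ### Wasserstein distance and path space -/

/-- The Wasserstein distance of order one: the infimum of the transport costs
`∫ dist x y dπ(x, y)` over all couplings `π` of `μ` and `ν`. -/
def W1 {S : Type*} [PseudoMetricSpace S] [MeasurableSpace S] (μ ν : ProbabilityMeasure S) : ℝ :=
  sInf {c : ℝ | ∃ π : ProbabilityMeasure (S × S),
    (π : Measure (S × S)).map Prod.fst = (μ : Measure S) ∧
    (π : Measure (S × S)).map Prod.snd = (ν : Measure S) ∧
    c = ∫ z, dist z.1 z.2 ∂(π : Measure (S × S))}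

/-- The path space `C([0,T] : [0,L])`, with the uniform metric of Mathlib. -/
abbrev PathSpace (T L : ℝ) : Type := C(Set.Icc (0 : ℝ) T, Set.Icc (0 : ℝ) L)

instance pathMeasurableSpace (T L : ℝ) : MeasurableSpace (PathSpace T L) := borel _

instance pathBorelSpace (T L : ℝ) : BorelSpace (PathSpace T L) := ⟨rfl⟩

/-- The marginal `ν(t)` of a law `ν` on the path space (for `t ∈ [0,T]`, where the projection
onto `[0,T]` does nothing). -/
def marginal {T L : ℝ} (hT : 0 ≤ T) (ν : ProbabilityMeasure (PathSpace T L)) (t : ℝ) :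
    ProbabilityMeasure (Set.Icc (0 : ℝ) L) :=
  ν.map (f := fun φ : PathSpace T L => φ (Set.projIcc 0 T hT t))
    (continuous_eval_const (Set.projIcc 0 T hT t)).measurable.aemeasurable

/-! ### The data of the mean field game -/

/-- The data: state space `[0,L]`, maximal time horizon `[0,M]`, diffusion coefficient `σ`,
control set `U`, drift `b`, running cost `f`, terminal cost `g`, and the boundary costs `y`
(at `0`) and `r` (at `L`), which do not depend on the measure argument.  The functions matter only
for times in `[0,M]`, states in `[0,L]` and controls in `U`. -/
structure Data where
  L : ℝ
  M : ℝ
  σ : ℝ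
  U : Set ℝ
  b : ℝ → ProbabilityMeasure (Set.Icc (0 : ℝ) L) → ℝ → ℝ → ℝ
  f : ℝ → ProbabilityMeasure (Set.Icc (0 : ℝ) L) → ℝ → ℝ → ℝ
  g : ProbabilityMeasure (Set.Icc (0 : ℝ) L) → ℝ → ℝ
  y : ℝ → ℝ
  r : ℝ → ℝ

namespace Data

variable (D : Data)

/-- Probability measures on the state space `[0,L]`. -/
abbrev StateLaw : Type := ProbabilityMeasure (Set.Icc (0 : ℝ) D.L)

/-- The standing assumptions on the constants and the control set, and the joint Lipschitz
condition on the coefficients. -/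
structure Regular : Prop where
  L_pos : 0 < D.L
  M_pos : 0 < D.M
  σ_pos : 0 < D.σ
  U_compact : IsCompact D.U
  lipschitz : ∃ cL : ℝ, 0 < cL ∧
    ∀ t ∈ Set.Icc 0 D.M, ∀ t' ∈ Set.Icc 0 D.M, ∀ η η' : D.StateLaw,
    ∀ x ∈ Set.Icc 0 D.L, ∀ x' ∈ Set.Icc 0 D.L, ∀ u ∈ D.U, ∀ u' ∈ D.U,
      |D.f t η x u - D.f t' η' x' u'| + |D.g η x - D.g η' x'|
        + |D.b t η x u - D.b t' η' x' u'| + |D.y t - D.y t'| + |D.r t - D.r t'|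
        ≤ cL * (|t - t'| + W1 η η' + |x - x'| + |u - u'|)

/-- `αhat t η x p` is the unique minimizer over `u ∈ U` of `f(t,η,x,u) + b(t,η,x,u) p`. -/
def IsUniqueArgmin (αhat : ℝ → D.StateLaw → ℝ → ℝ → ℝ) : Prop :=
  ∀ t ∈ Set.Icc 0 D.M, ∀ η : D.StateLaw, ∀ x ∈ Set.Icc 0 D.L, ∀ p : ℝ,
    αhat t η x p ∈ D.U ∧ ∀ u ∈ D.U, u ≠ αhat t η x p →
      D.f t η x (αhat t η x p) + D.b t η x (αhat t η x p) * p < D.f t η x u + D.b t η x u * p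

/-- The Lipschitz assumption on the minimizer. -/
def ArgminLipschitz (αhat : ℝ → D.StateLaw → ℝ → ℝ → ℝ) : Prop :=
  ∃ cα : ℝ, 0 < cα ∧ ∀ t ∈ Set.Icc 0 D.M, ∀ η η' : D.StateLaw,
    ∀ x ∈ Set.Icc 0 D.L, ∀ x' ∈ Set.Icc 0 D.L, ∀ p p' : ℝ,
      |αhat t η x p - αhat t η' x' p'| ≤ cα * (W1 η η' + |x - x'| + |p - p'|)

/-! ### The grid -/

/-- The time step `Δ^h = h² / σ²`. -/
def timeStep (h : ℝ) : ℝ := h ^ 2 / D.σ ^ 2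

/-- The mesh `h > 0` is admissible for the horizon `T`: `L / h` and `T / Δ^h` are integers, and
`h < σ² / sup |b|`, so that the transition probabilities are positive. -/
structure AdmissibleMesh (T h : ℝ) : Prop where
  h_pos : 0 < h
  space_int : ∃ N : ℕ, D.L = N * h
  time_int : ∃ I : ℕ, T = I * D.timeStep h
  prob_pos : ∃ cB : ℝ, h * cB < D.σ ^ 2 ∧
    ∀ t ∈ Set.Icc 0 T, ∀ η : D.StateLaw, ∀ x ∈ Set.Icc 0 D.L, ∀ u ∈ D.U, |D.b t η x u| ≤ cB

/-- The number `L / h` of space steps. -/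
def numSpace (h : ℝ) : ℕ := ⌊D.L / h⌋₊

/-- The number `I(h) = T / Δ^h` of time steps. -/
def numTime (T h : ℝ) : ℕ := ⌊T / D.timeStep h⌋₊

/-- A state `(j, i)` of the chain: the current time instant is `j Δ^h` and the current position is
`i h`.  The positions of the grid `{-h, 0, h, …, L, L + h}` are those with
`-1 ≤ i ≤ L / h + 1`; the two extreme ones are the reflecting positions. -/
abbrev State : Type := ℕ × ℤ

/-- `i h` belongs to the grid `{-h, 0, h, …, L, L + h}`. -/
def IsGridIndex (h : ℝ) (i : ℤ) : Prop := -1 ≤ i ∧ i ≤ (D.numSpace h : ℤ) + 1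

/-! ### The controlled chain

In what follows `0 ≤ T` is the horizon and `ν` is a law on the path space `C([0,T] : [0,L])`. -/

variable {T : ℝ} (hT : 0 ≤ T) (h : ℝ) (ν : ProbabilityMeasure (PathSpace T D.L))

/-- The probability `(h b + σ²) / (2 σ²)` of an upward rate control step from the state `s` under
the control `u` (for an admissible mesh it lies in `(0,1)`, and the projection onto `[0,1]` does
nothing). -/
def upProb (s : State) (u : ℝ) : Set.Icc (0 : ℝ) 1 :=
  Set.projIcc 0 1 zero_le_one
    ((h * D.b (s.1 * D.timeStep h) (marginal hT ν (s.1 * D.timeStep h)) (s.2 * h) u + D.σ ^ 2)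
      / (2 * D.σ ^ 2))

/-- The law on `Bool` giving mass `p` to `true` and `1 - p` to `false`. -/
def coin (p : Set.Icc (0 : ℝ) 1) : PMF Bool :=
  PMF.ofFintype (fun c => ENNReal.ofReal (if c then (p : ℝ) else 1 - p)) (by
    have h0 : (0 : ℝ) ≤ p := p.2.1
    have h1 : (0 : ℝ) ≤ 1 - p := sub_nonneg.2 p.2.2
    rw [Fintype.sum_bool, if_pos rfl, if_neg Bool.false_ne_true, ← ENNReal.ofReal_add h0 h1]
    simp)

/-- One step of the chain from the state `s` under the control `u`.  At the positions `-h` and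
`L + h` there is an instantaneous reflection step, to `0` and `L` respectively; elsewhere, before
the time `T`, there is a rate control step, which moves the position by `± h` and advances the
time by `Δ^h`.  At time `T`, after a possible reflection, the chain is stopped. -/
def step (s : State) (u : ℝ) : PMF State :=
  if s.2 = -1 then PMF.pure (s.1, 0)
  else if s.2 = (D.numSpace h : ℤ) + 1 then PMF.pure (s.1, (D.numSpace h : ℤ))
  else if s.1 < D.numTime T h then
    (coin (D.upProb hT h ν s u)).map (fun c => (s.1 + 1, if c then s.2 + 1 else s.2 - 1))
  else PMF.pure s

/-- The law of the first `n + 1` states of the chain started from `s` under the control `π`.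
A path is recorded as a list, the most recent state first, and the control applied at each step is
a function of the whole history (as the controls are adapted to the filtration that the chain and
the past controls generate, they are functions of the past and present states). -/
def pathLaw (π : List State → ℝ) (s : State) : ℕ → PMF (List State)
  | 0 => PMF.pure [s]
  | n + 1 => (pathLaw π s n).bind fun w =>
      (D.step hT h ν (w.headD s) (π w)).map (fun s' => s' :: w)

/-- The law of the whole path up to the time `T`.  Between two consecutive rate control steps
there is at most one reflection step, so after `2 I(h) + 1` steps the chain has been stopped. -/
def fullLaw (π : List State → ℝ) (s : State) : PMF (List State) :=
  D.pathLaw hT h ν π s (2 * D.numTime T h + 1)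

/-- The position at the time `j Δ^h` in the continuous time interpolation: the position of the last
state of the path whose time instant is `j Δ^h`, that is, the one after a possible reflection. -/
def position (w : List State) (j : ℕ) : ℝ :=
  match w.find? (fun s => s.1 == j) with
  | some s => s.2 * h
  | none => 0

/-! ### Costs and value function -/

/-- The cost incurred in one step from the state `s` under the control `u`: `y h` or `r h` in a
reflection step, and `f Δ^h` in a rate control step. -/
def stepCost (s : State) (u : ℝ) : ℝ :=
  if s.2 = -1 then D.y (s.1 * D.timeStep h) * h
  else if s.2 = (D.numSpace h : ℤ) + 1 then D.r (s.1 * D.timeStep h) * h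
  else if s.1 < D.numTime T h then
    D.f (s.1 * D.timeStep h) (marginal hT ν (s.1 * D.timeStep h)) (s.2 * h) u * D.timeStep h
  else 0

/-- The total running and boundary cost along a path, under the control `π`; this is
`∫ f ds + ∫ y dY + ∫ r dR` for the interpolated processes. -/
def runningCost (π : List State → ℝ) : List State → ℝ
  | [] => 0
  | s :: w => D.stepCost hT h ν s (π (s :: w)) + runningCost π w

/-- The expected total cost `J^{h,ν}` of the control `π` for the chain started from the state `s`
(a sum with finitely many nonzero terms). -/
def cost (π : List State → ℝ) (s : State) : ℝ :=
  ∑' w : List State, (D.fullLaw hT h ν π s w).toReal *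
    (D.runningCost hT h ν π w + D.g (marginal hT ν T) (position h w (D.numTime T h)))

/-- The value function `V^h_ν(j Δ^h, i h)` for `0 ≤ i ≤ L / h`: the infimum of the cost over all
`U`-valued adapted controls. -/
def value (j : ℕ) (i : ℤ) : ℝ :=
  sInf {c : ℝ | ∃ π : List State → ℝ, (∀ w, π w ∈ D.U) ∧ c = D.cost hT h ν π (j, i)}

/-- The value function, extended to the positions `-h` and `L + h`. -/
def extValue (j : ℕ) (i : ℤ) : ℝ :=
  if i = -1 then D.y (j * D.timeStep h) * h + D.value hT h ν j 0
  else if i = (D.numSpace h : ℤ) + 1 then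
    D.r (j * D.timeStep h) * h + D.value hT h ν j (D.numSpace h : ℤ)
  else D.value hT h ν j i

/-- The finite difference `𝒟^h_x V^h_ν(j Δ^h, i h)`. -/
def diffValue (j : ℕ) (i : ℤ) : ℝ :=
  (D.extValue hT h ν (j + 1) (i + 1) - D.extValue hT h ν (j + 1) (i - 1)) / (2 * h)

/-! ### The map `Φ^h` -/

variable (αhat : ℝ → ProbabilityMeasure (Set.Icc (0 : ℝ) D.L) → ℝ → ℝ → ℝ)

/-- The optimal feedback control `(t, x) ↦ αhat(t, ν(t), x, 𝒟^h_x V^h_ν(t, x))`. -/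
def optControl (s : State) : ℝ :=
  αhat (s.1 * D.timeStep h) (marginal hT ν (s.1 * D.timeStep h)) (s.2 * h)
    (D.diffValue hT h ν s.1 s.2)

/-- The continuous path on `[0,T]` that equals `x j` at each time `j Δ^h`, `0 ≤ j ≤ I(h)`, and is
linear in between (for values `x j` in `[0,L]` the projection onto `[0,L]` does nothing). -/
def interpolation (hL : 0 ≤ D.L) (T h : ℝ) (x : ℕ → ℝ) : PathSpace T D.L where
  toFun t := Set.projIcc 0 D.L hL (x 0 + ∑ j ∈ Finset.range (D.numTime T h),
    (x (j + 1) - x j) * max 0 (min 1 ((t : ℝ) / D.timeStep h - j)))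
  continuous_toFun := continuous_projIcc.comp (by fun_prop)

/-- `Φ^h(ν)`: the law on `C([0,T] : [0,L])` of the piecewise linear interpolation of the chain
started at time `0` at the grid point `i₀ h` and governed by the optimal feedback control. -/
def Phi (hL : 0 ≤ D.L) (i₀ : ℤ) : ProbabilityMeasure (PathSpace T D.L) :=
  ⟨((D.fullLaw hT h ν (fun w => D.optControl hT h ν αhat (w.headD (0, i₀))) (0, i₀)).map
      (fun w => D.interpolation hL T h (position h w))).toMeasure, inferInstance⟩

/-! ### The iteration -/

/-- The iterates `ν^k`, `k ≥ 1`: `ν^1` is given and `ν^{k+1} = Φ^h(ν^k)`. -/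
def iterate (hL : 0 ≤ D.L) (i₀ : ℤ) (ν₁ : ProbabilityMeasure (PathSpace T D.L)) (k : ℕ) :
    ProbabilityMeasure (PathSpace T D.L) :=
  (fun ν => D.Phi hT h ν αhat hL i₀)^[k - 1] ν₁

/-- The indices `k ≥ 1` with `W₁²(Φ^h(ν^k), ν^k) ≤ (2 q / (1 - q)) h²`. -/
def stoppingIndices (hL : 0 ≤ D.L) (i₀ : ℤ) (ν₁ : ProbabilityMeasure (PathSpace T D.L)) (q : ℝ) :
    Set ℕ :=
  {k | 1 ≤ k ∧
    W1 (D.Phi hT h (D.iterate hT h αhat hL i₀ ν₁ k) αhat hL i₀)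
      (D.iterate hT h αhat hL i₀ ν₁ k) ^ 2 ≤ 2 * q / (1 - q) * h ^ 2}

/-- The selected measure `ν_h = ν^{k_h}`, where `k_h` is the least of the indices above. -/
def selected (hL : 0 ≤ D.L) (i₀ : ℤ) (ν₁ : ProbabilityMeasure (PathSpace T D.L)) (q : ℝ) :
    ProbabilityMeasure (PathSpace T D.L) :=
  D.iterate hT h αhat hL i₀ ν₁ (sInf (D.stoppingIndices hT h αhat hL i₀ ν₁ q))

end Data

end MFG

end

noncomputable section

namespace MFG

open MeasureTheory

/-! The map contracts over a short horizon because each estimate carries a factor of order `T` or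
`√T`, uniformly in the mesh. In fact `W1 (Φ ν) (Φ ν') ≤ (1/2) W1 ν ν'` is obtained, with no error
term in `h`.

Dynamic programming (`value_eq_bellman`). Since the time step is `h² / σ²`, one step of the chain is
a step of the simple random walk plus a drift of order one time step, so the value function solves a
discrete heat equation whose source is the time step times the minimized Hamiltonian at the central
difference. The boundary costs prescribe the increments at the two ends. Subtracting an explicit
quadratic (`corrector`) makes these increments zero, and folding `ℤ` onto the grid then turns the
reflected equation into one for the free walk on `ℤ`.

Smoothing (`abs_cdiff_avg_pow_le`). For the free walk, a discrete integration by parts bounds the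
central difference after `n` averagings of bounded data by a multiple of `1 / √(n + 1)`. By the
variation of constants formula a source at lag `k` enters with weight `1 / √(k + 1)`. These weights
sum to at most `2 √I`, and `Δ √I = h √T / σ`, so dividing by `h` is harmless and, for small `T`, the
dependence of the Hamiltonian on the gradient is absorbed. This yields a uniform gradient bound
(`abs_diffValue_le`) and Lipschitz bounds for the gradient in space (`exists_diffValue_fdiff_le`)
and in the measure (`exists_diffValue_sub_le`). The last two degenerate near the terminal time, but
their constants are summable in time.

Coupling (`expect_reflectedWalkPair_le`). The chains for `ν` and `ν'` are driven by the same uniform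
variables. Reflection never increases their distance, and their coins differ with probability
proportional to the difference of the drifts. Gronwall's inequality needs only time sums of the
constants, which is why summability suffices. The result is `W1_Phi_le_mul`, and `exists_horizon`
makes its constant at most `1/2`. The squared residuals of the iteration then satisfy a geometric
recursion, which gives the stopping index and, by squeezing, the limit. -/

/-! ### The averaging operator of the simple random walk on `ℤ` -/

/-- The transition operator of the simple random walk. -/
def avg : Module.End ℝ (ℤ → ℝ) where
  toFun F i := (F (i + 1) + F (i - 1)) / 2
  map_add' F G := by ext i; simp only [Pi.add_apply]; ring
  map_smul' c F := by ext i; simp only [Pi.smul_apply, smul_eq_mul, RingHom.id_apply]; ring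

/-- The central difference. -/
def cdiff : Module.End ℝ (ℤ → ℝ) where
  toFun F i := F (i + 1) - F (i - 1)
  map_add' F G := by ext i; simp only [Pi.add_apply]; ring
  map_smul' c F := by ext i; simp only [Pi.smul_apply, smul_eq_mul, RingHom.id_apply]; ring

/-- The forward difference. -/
def fdiff : Module.End ℝ (ℤ → ℝ) where
  toFun F i := F (i + 1) - F i
  map_add' F G := by ext i; simp only [Pi.add_apply]; ring
  map_smul' c F := by ext i; simp only [Pi.smul_apply, smul_eq_mul, RingHom.id_apply]; ring

theorem avg_apply (F : ℤ → ℝ) (i : ℤ) : avg F i = (F (i + 1) + F (i - 1)) / 2 := rfl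

theorem cdiff_apply (F : ℤ → ℝ) (i : ℤ) : cdiff F i = F (i + 1) - F (i - 1) := rfl

theorem fdiff_apply (F : ℤ → ℝ) (i : ℤ) : fdiff F i = F (i + 1) - F i := rfl

theorem commute_cdiff_avg : Commute cdiff avg := by
  ext F i
  simp only [Module.End.mul_apply, cdiff_apply, avg_apply]
  ring_nf

theorem commute_fdiff_avg : Commute fdiff avg := by
  ext F i
  simp only [Module.End.mul_apply, fdiff_apply, avg_apply]
  ring_nf

theorem cdiff_avg_pow (n : ℕ) (F : ℤ → ℝ) : cdiff ((avg ^ n) F) = (avg ^ n) (cdiff F) := by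
  rw [← Module.End.mul_apply, (commute_cdiff_avg.pow_right n).eq, Module.End.mul_apply]

theorem avg_pow_succ_apply (n : ℕ) (F : ℤ → ℝ) : (avg ^ (n + 1)) F = avg ((avg ^ n) F) := by
  rw [pow_succ', Module.End.mul_apply]

theorem avg_pow_mono (n : ℕ) {F G : ℤ → ℝ} (hFG : ∀ i, F i ≤ G i) (i : ℤ) :
    (avg ^ n) F i ≤ (avg ^ n) G i := by
  induction n generalizing i with
  | zero => simpa using hFG i
  | succ n ih =>
    simp only [avg_pow_succ_apply, avg_apply]
    linarith [ih (i + 1), ih (i - 1)]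

theorem avg_pow_const (n : ℕ) (a : ℝ) (i : ℤ) : (avg ^ n) (fun _ => a) i = a := by
  induction n generalizing i with
  | zero => simp
  | succ n ih => simp only [avg_pow_succ_apply, avg_apply, ih]; ring

theorem abs_avg_pow_le_avg_pow (n : ℕ) {F G : ℤ → ℝ} (hFG : ∀ i, |F i| ≤ G i) (i : ℤ) :
    |(avg ^ n) F i| ≤ (avg ^ n) G i := by
  rw [abs_le]
  refine ⟨?_, avg_pow_mono n (fun i => (abs_le.1 (hFG i)).2) i⟩
  have := avg_pow_mono n (F := -F) (G := G) (fun i => by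
    simpa using neg_le.1 (abs_le.1 (hFG i)).1) i
  rw [map_neg, Pi.neg_apply] at this
  linarith

theorem abs_avg_pow_le (n : ℕ) {F : ℤ → ℝ} {a : ℝ} (hF : ∀ i, |F i| ≤ a) (i : ℤ) :
    |(avg ^ n) F i| ≤ a :=
  (abs_avg_pow_le_avg_pow n hF i).trans_eq (avg_pow_const n a i)

/-- Discrete integration by parts. If `S` is a sum of `n + 1` independent signs, exchangeability
reduces `E[S F(i + S)]` to `n + 1` times the contribution of one sign, and averaging over that sign
leaves half a central difference. -/
theorem avg_pow_succ_mul_id (n : ℕ) (F : ℤ → ℝ) (i : ℤ) :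
    (avg ^ (n + 1)) (fun m => (m : ℝ) * F m) i
      = i * (avg ^ (n + 1)) F i + ((n + 1 : ℕ) : ℝ) / 2 * cdiff ((avg ^ n) F) i := by
  induction n generalizing i with
  | zero =>
    simp only [zero_add, pow_one, pow_zero, Module.End.one_apply, avg_apply, cdiff_apply]
    push_cast
    ring
  | succ n ih =>
    rw [avg_pow_succ_apply, avg_apply, ih, ih, avg_pow_succ_apply (n + 1) F, avg_apply]
    have h1 : cdiff ((avg ^ (n + 1)) F) i
        = (cdiff ((avg ^ n) F) (i + 1) + cdiff ((avg ^ n) F) (i - 1)) / 2 := by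
      rw [cdiff_avg_pow, avg_pow_succ_apply, avg_apply, cdiff_avg_pow]
    have h2 : cdiff ((avg ^ (n + 1)) F) i
        = (avg ^ (n + 1)) F (i + 1) - (avg ^ (n + 1)) F (i - 1) := rfl
    push_cast
    linear_combination (-((n : ℝ) + 1) / 2) * h1 - (1 / 2) * h2

theorem avg_pow_sq (n : ℕ) (a : ℝ) (i : ℤ) :
    (avg ^ n) (fun m => ((m : ℝ) - a) ^ 2) i = (i - a) ^ 2 + n := by
  induction n generalizing i with
  | zero => simp
  | succ n ih =>
    rw [avg_pow_succ_apply, avg_apply, ih, ih]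
    push_cast
    ring

/-- By the integration by parts formula the central difference is `2 / (n + 1)` times `E[S F(i +
S)]`, and `E|S|` is at most the standard deviation `√(n + 1)`. -/
theorem abs_cdiff_avg_pow_le (n : ℕ) {F : ℤ → ℝ} {a : ℝ} (hF : ∀ i, |F i| ≤ a) (i : ℤ) :
    |cdiff ((avg ^ n) F) i| ≤ 2 * a / √(n + 1) := by
  have ha : 0 ≤ a := (abs_nonneg _).trans (hF 0)
  set r : ℝ := √(n + 1) with hr
  have hr0 : 0 < r := Real.sqrt_pos.2 (by positivity)
  have hrr : r ^ 2 = n + 1 := Real.sq_sqrt (by positivity)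
  have key : ((n : ℝ) + 1) / 2 * cdiff ((avg ^ n) F) i
      = (avg ^ (n + 1)) (fun m => ((m : ℝ) - i) * F m) i := by
    have h1 : (fun m : ℤ => ((m : ℝ) - i) * F m) = (fun m : ℤ => (m : ℝ) * F m) - (i : ℝ) • F := by
      ext m; simp only [Pi.sub_apply, Pi.smul_apply, smul_eq_mul]; ring
    rw [h1, map_sub, map_smul, Pi.sub_apply, avg_pow_succ_mul_id, Pi.smul_apply, smul_eq_mul]
    push_cast
    ring
  have hle : |((n : ℝ) + 1) / 2 * cdiff ((avg ^ n) F) i| ≤ a * r := by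
    rw [key]
    -- Young's inequality `|x| ≤ x² / (2r) + r / 2` stands in for Cauchy–Schwarz. With `r = √(n +
    -- 1)` the second moment is `r²`, so the two halves balance and add up to `a r`.
    refine (abs_avg_pow_le_avg_pow (n + 1)
      (G := (a / (2 * r)) • (fun m : ℤ => ((m : ℝ) - i) ^ 2) + fun _ => a * r / 2) ?_ i).trans ?_
    · intro m
      simp only [Pi.add_apply, Pi.smul_apply, smul_eq_mul, abs_mul]
      have h2 : |(m : ℝ) - i| ≤ ((m : ℝ) - i) ^ 2 / (2 * r) + r / 2 := by
        rw [← sq_abs ((m : ℝ) - i), div_add_div _ _ (by positivity) (by positivity),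
          le_div_iff₀ (by positivity)]
        nlinarith [sq_nonneg (|(m : ℝ) - i| - r)]
      calc |(m : ℝ) - i| * |F m| ≤ (((m : ℝ) - i) ^ 2 / (2 * r) + r / 2) * a :=
            mul_le_mul h2 (hF m) (abs_nonneg _) (by positivity)
        _ = _ := by ring
    · rw [map_add, map_smul, Pi.add_apply, Pi.smul_apply, avg_pow_sq, avg_pow_const]
      simp only [sub_self, smul_eq_mul]
      push_cast
      rw [← hrr]
      apply le_of_eq
      field_simp
      ring
  rw [abs_mul, abs_of_pos (by positivity : (0 : ℝ) < ((n : ℝ) + 1) / 2), ← hrr] at hle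
  rw [le_div_iff₀ hr0]
  nlinarith

/-- Variation of constants, backwards from the terminal time: the source at lag `k` has undergone
`k` averagings. -/
theorem avg_duhamel {I : ℕ} {u s : ℕ → ℤ → ℝ} (hu : ∀ j < I, u j = avg (u (j + 1)) + s j)
    {n j : ℕ} (hj : j + n = I) :
    u j = (avg ^ n) (u I) + ∑ k ∈ Finset.range n, (avg ^ k) (s (j + k)) := by
  induction n generalizing j with
  | zero => simp at hj; subst hj; simp
  | succ n ih =>
    have h1 : ∀ k, s (j + 1 + k) = s (j + (k + 1)) := fun k => by rw [add_assoc, add_comm 1 k]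
    rw [hu j (by omega), ih (j := j + 1) (by omega), Finset.sum_range_succ', map_add,
      avg_pow_succ_apply]
    simp only [avg_pow_succ_apply, pow_zero, Module.End.one_apply, add_zero, h1]
    rw [map_sum, add_assoc]

/-- The source terms contribute to the central difference with the integrable weights
`2 / √(k + 1)`. -/
theorem abs_cdiff_le_add {I : ℕ} {u s : ℕ → ℤ → ℝ} (hu : ∀ j < I, u j = avg (u (j + 1)) + s j)
    {c : ℕ → ℝ} (hs : ∀ j < I, ∀ i, |s j i| ≤ c j) {j : ℕ} (hj : j < I) (i : ℤ) :
    |cdiff (u (j + 1)) i| ≤ |cdiff ((avg ^ (I - j - 1)) (u I)) i|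
      + ∑ k ∈ Finset.range (I - j - 1), 2 * c (j + 1 + k) / √(k + 1) := by
  rw [avg_duhamel hu (n := I - j - 1) (j := j + 1) (by omega), map_add, map_sum, Pi.add_apply,
    Finset.sum_apply]
  refine (abs_add_le _ _).trans (add_le_add_right ((Finset.abs_sum_le_sum_abs _ _).trans
    (Finset.sum_le_sum fun k hk => ?_)) _)
  have := Finset.mem_range.1 hk
  exact abs_cdiff_avg_pow_le k (hs _ (by omega)) i

theorem abs_cdiff_le_of_bounded {I : ℕ} {u s : ℕ → ℤ → ℝ}
    (hu : ∀ j < I, u j = avg (u (j + 1)) + s j)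
    {c : ℕ → ℝ} (hs : ∀ j < I, ∀ i, |s j i| ≤ c j) {a : ℝ} (ha : ∀ i, |u I i| ≤ a)
    {j : ℕ} (hj : j < I) (i : ℤ) :
    |cdiff (u (j + 1)) i| ≤ 2 * a / √(I - j : ℕ)
      + ∑ k ∈ Finset.range (I - j - 1), 2 * c (j + 1 + k) / √(k + 1) := by
  refine (abs_cdiff_le_add hu hs hj i).trans (add_le_add_left ?_ _)
  have := abs_cdiff_avg_pow_le (I - j - 1) ha i
  rwa [← Nat.cast_add_one, Nat.sub_add_cancel (by omega)] at this

/-- The central difference commutes with averaging, so terminal data with bounded differences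
contribute without any singularity at the terminal time. -/
theorem abs_cdiff_le_of_cdiff_bounded {I : ℕ} {u s : ℕ → ℤ → ℝ}
    (hu : ∀ j < I, u j = avg (u (j + 1)) + s j)
    {c : ℕ → ℝ} (hs : ∀ j < I, ∀ i, |s j i| ≤ c j) {a : ℝ} (ha : ∀ i, |cdiff (u I) i| ≤ a)
    {j : ℕ} (hj : j < I) (i : ℤ) :
    |cdiff (u (j + 1)) i| ≤ a
      + ∑ k ∈ Finset.range (I - j - 1), 2 * c (j + 1 + k) / √(k + 1) := by
  refine (abs_cdiff_le_add hu hs hj i).trans (add_le_add_left ?_ _)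
  rw [cdiff_avg_pow]
  exact abs_avg_pow_le _ ha i

/-! ### Summing the square root singularity; a discrete Volterra inequality. -/

theorem sum_inv_sqrt_le (n : ℕ) : ∑ k ∈ Finset.range n, 1 / √((k : ℝ) + 1) ≤ 2 * √n := by
  induction n with
  | zero => simp
  | succ n ih =>
    rw [Finset.sum_range_succ]
    push_cast
    have h1 : 0 < √((n : ℝ) + 1) := Real.sqrt_pos.2 (by positivity)
    have h2 : √(n : ℝ) ^ 2 = n := Real.sq_sqrt (by positivity)
    have h3 : √((n : ℝ) + 1) ^ 2 = n + 1 := Real.sq_sqrt (by positivity)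
    have h4 : 1 / √((n : ℝ) + 1) ≤ 2 * √((n : ℝ) + 1) - 2 * √n := by
      rw [div_le_iff₀ h1]
      nlinarith [sq_nonneg (√((n : ℝ) + 1) - √n)]
    linarith

/-- Summation of a discrete Volterra inequality with a square root singularity. -/
theorem sum_le_of_volterra {I : ℕ} {d c : ℕ → ℝ} {c₀ a : ℝ} (hc : ∀ j, 0 ≤ c j) (ha : 0 ≤ a)
    (hd : ∀ j < I, d j ≤ c₀ + a / √(I - j : ℕ)
      + ∑ k ∈ Finset.range (I - j - 1), c (j + 1 + k) / √((k : ℝ) + 1)) :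
    ∑ j ∈ Finset.range I, d j
      ≤ I * c₀ + 2 * a * √I + 2 * √I * ∑ j ∈ Finset.range I, c j := by
  have h1 : ∑ j ∈ Finset.range I, a / √(I - j : ℕ) ≤ 2 * a * √I := by
    rw [← Finset.sum_range_reflect]
    calc ∑ j ∈ Finset.range I, a / √((I - (I - 1 - j) : ℕ) : ℝ)
        = ∑ j ∈ Finset.range I, a * (1 / √((j : ℝ) + 1)) := by
          refine Finset.sum_congr rfl fun j hj => ?_
          have := Finset.mem_range.1 hj
          rw [show I - (I - 1 - j) = j + 1 by omega]
          push_cast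
          ring
      _ ≤ a * (2 * √I) := by
          rw [← Finset.mul_sum]
          exact mul_le_mul_of_nonneg_left (sum_inv_sqrt_le I) ha
      _ = _ := by ring
  -- An indicator extends the inner sum to a range independent of `j`, so that the sums can be
  -- exchanged. For a fixed lag `k` the indices `j + 1 + k` are then distinct and below `I`, and
  -- their terms are dominated by the full sum of `c`.
  have h2 : ∀ j < I, ∑ k ∈ Finset.range (I - j - 1), c (j + 1 + k) / √((k : ℝ) + 1)
      = ∑ k ∈ Finset.range I, if j + 1 + k < I then c (j + 1 + k) / √((k : ℝ) + 1) else 0 := by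
    intro j hj
    rw [← Finset.sum_filter]
    refine Finset.sum_congr ?_ fun _ _ => rfl
    ext k
    simp only [Finset.mem_range, Finset.mem_filter]
    omega
  calc ∑ j ∈ Finset.range I, d j
      ≤ ∑ j ∈ Finset.range I, (c₀ + a / √(I - j : ℕ) + ∑ k ∈ Finset.range I,
          if j + 1 + k < I then c (j + 1 + k) / √((k : ℝ) + 1) else 0) :=
        Finset.sum_le_sum fun j hj => by
          rw [← h2 j (Finset.mem_range.1 hj)]; exact hd j (Finset.mem_range.1 hj)
    _ = I * c₀ + ∑ j ∈ Finset.range I, a / √(I - j : ℕ) + ∑ k ∈ Finset.range I,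
          ∑ j ∈ Finset.range I, if j + 1 + k < I then c (j + 1 + k) / √((k : ℝ) + 1) else 0 := by
        rw [Finset.sum_add_distrib, Finset.sum_add_distrib, Finset.sum_comm]
        simp
    _ ≤ I * c₀ + 2 * a * √I + ∑ k ∈ Finset.range I,
          (1 / √((k : ℝ) + 1)) * ∑ j ∈ Finset.range I, c j := by
        refine add_le_add (add_le_add_right h1 _) (Finset.sum_le_sum fun k _ => ?_)
        rw [← Finset.sum_filter, Finset.mul_sum]
        calc _ = ∑ j ∈ (Finset.range I).filter (fun j => j + 1 + k < I),
                (1 / √((k : ℝ) + 1)) * c (j + 1 + k) :=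
              Finset.sum_congr rfl fun j _ => by ring
          _ = ∑ l ∈ ((Finset.range I).filter (fun j => j + 1 + k < I)).image (· + (1 + k)),
                (1 / √((k : ℝ) + 1)) * c l := by
              rw [Finset.sum_image (fun x _ y _ h => by simpa using h)]
              simp only [add_assoc]
          _ ≤ _ := by
              refine Finset.sum_le_sum_of_subset_of_nonneg ?_ fun l _ _ =>
                mul_nonneg (by positivity) (hc l)
              intro l hl
              simp only [Finset.mem_image, Finset.mem_filter, Finset.mem_range] at hl ⊢
              omega
    _ ≤ _ := by
        rw [← Finset.sum_mul]
        exact add_le_add_right (mul_le_mul_of_nonneg_right (sum_inv_sqrt_le I)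
          (Finset.sum_nonneg fun j _ => hc j)) _

/-! ### Reflection at the ends of the grid -/

/-- The projection of `ℤ` onto `{0, …, N}`. -/
def clampIdx (N : ℕ) (i : ℤ) : ℤ := max 0 (min i N)

/-- The folding map of `ℤ` onto `{0, …, N}`, even about `-1/2` and of period `2 (N + 1)`. -/
def foldIdx (N : ℕ) (i : ℤ) : ℤ :=
  if i % (2 * (N + 1)) ≤ N then i % (2 * (N + 1)) else 2 * N + 1 - i % (2 * (N + 1))

theorem clampIdx_nonneg (N : ℕ) (i : ℤ) : 0 ≤ clampIdx N i := le_max_left _ _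

theorem clampIdx_le (N : ℕ) (i : ℤ) : clampIdx N i ≤ N := by
  simp only [clampIdx]; omega

theorem clampIdx_of_mem {N : ℕ} {i : ℤ} (h0 : 0 ≤ i) (hN : i ≤ N) : clampIdx N i = i := by
  simp only [clampIdx]; omega

theorem abs_clampIdx_sub_le (N : ℕ) (i k : ℤ) : |clampIdx N i - clampIdx N k| ≤ |i - k| := by
  rw [abs_le]
  have h1 := le_abs_self (i - k)
  have h2 := neg_le_abs (i - k)
  simp only [clampIdx]
  omega

theorem foldIdx_nonneg (N : ℕ) (i : ℤ) : 0 ≤ foldIdx N i := by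
  have h1 := Int.emod_nonneg i (b := 2 * (N + 1)) (by omega)
  have h2 := Int.emod_lt_of_pos i (b := 2 * (N + 1)) (by omega)
  simp only [foldIdx]
  split_ifs <;> omega

theorem foldIdx_le (N : ℕ) (i : ℤ) : foldIdx N i ≤ N := by
  simp only [foldIdx]
  split_ifs <;> omega

theorem emod_add_one (P i : ℤ) (hP : 1 < P) :
    (i + 1) % P = if i % P + 1 = P then 0 else i % P + 1 := by
  have h1 := Int.emod_nonneg i (b := P) (by omega)
  have h2 := Int.emod_lt_of_pos i (b := P) (by omega)
  rw [Int.add_emod, Int.emod_eq_of_lt (a := 1) (by omega) hP]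
  split_ifs with h
  · rw [h, Int.emod_self]
  · exact Int.emod_eq_of_lt (by omega) (by omega)

/-- The folding carries the two neighbours of `i` to the two reflected neighbours of its image,
possibly in exchanged order. The average does not see the order, and the modulus of the central
difference does not either. -/
theorem foldIdx_add_one_sub_one (N : ℕ) (i : ℤ) :
    (foldIdx N (i + 1) = clampIdx N (foldIdx N i + 1) ∧
      foldIdx N (i - 1) = clampIdx N (foldIdx N i - 1)) ∨
    (foldIdx N (i + 1) = clampIdx N (foldIdx N i - 1) ∧
      foldIdx N (i - 1) = clampIdx N (foldIdx N i + 1)) := by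
  have h1 := Int.emod_nonneg (i - 1) (b := 2 * (N + 1)) (by omega)
  have h2 := Int.emod_lt_of_pos (i - 1) (b := 2 * (N + 1)) (by omega)
  have h3 := emod_add_one (2 * (N + 1)) (i - 1) (by omega)
  have h4 := emod_add_one (2 * (N + 1)) i (by omega)
  rw [sub_add_cancel] at h3
  simp only [foldIdx, clampIdx]
  generalize (i - 1) % (2 * ((N : ℤ) + 1)) = a at *
  generalize (i + 1) % (2 * ((N : ℤ) + 1)) = c at *
  generalize i % (2 * ((N : ℤ) + 1)) = b at *
  split_ifs at * <;> omega

/-- One step beyond the grid, folding and projecting coincide; this brings estimates on `ℤ` back to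
the grid. -/
theorem foldIdx_eq_clampIdx {N : ℕ} {i : ℤ} (h0 : -1 ≤ i) (hN : i ≤ N + 1) :
    foldIdx N i = clampIdx N i := by
  rcases h0.eq_or_lt with rfl | h0
  · have := emod_add_one (2 * (N + 1)) (-1) (by omega)
    have h1 := Int.emod_nonneg (-1) (b := 2 * ((N : ℤ) + 1)) (by omega)
    simp only [foldIdx, clampIdx]
    simp only [neg_add_cancel, Int.zero_emod] at this
    generalize (-1) % (2 * ((N : ℤ) + 1)) = b at *
    split_ifs at * <;> omega
  · rw [foldIdx, Int.emod_eq_of_lt (by omega) (by omega)]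
    simp only [clampIdx]
    split_ifs <;> omega

/-- The difference of a grid function across a step of the folding map. -/
theorem abs_fdiff_comp_foldIdx_le {N : ℕ} {F : ℤ → ℝ} {a : ℝ} (ha : 0 ≤ a)
    (hF : ∀ i : ℤ, 0 ≤ i → i < N → |F (i + 1) - F i| ≤ a) (i : ℤ) :
    |fdiff (F ∘ foldIdx N) i| ≤ a := by
  have h0 := foldIdx_nonneg N i
  have hN := foldIdx_le N i
  have key : foldIdx N (i + 1) = foldIdx N i ∨
      (foldIdx N (i + 1) = foldIdx N i + 1 ∧ foldIdx N i < N) ∨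
      (foldIdx N i = foldIdx N (i + 1) + 1 ∧ 0 ≤ foldIdx N (i + 1)) := by
    rcases foldIdx_add_one_sub_one N i with ⟨h, -⟩ | ⟨h, -⟩ <;>
    (simp only [clampIdx] at h; omega)
  simp only [fdiff_apply, Function.comp_apply]
  rcases key with h | ⟨h, h'⟩ | ⟨h, h'⟩
  · rw [h, sub_self, abs_zero]; exact ha
  · rw [h]; exact hF _ h0 h'
  · rw [h, abs_sub_comm]; exact hF _ h' (by omega)

/-- `u` solves a discrete heat equation with reflection at the ends of the grid `{0, …, N}` and
source `s`. -/
def IsReflectedHeat (N I : ℕ) (u s : ℕ → ℤ → ℝ) : Prop :=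
  ∀ j < I, ∀ i : ℤ, 0 ≤ i → i ≤ N →
    u j i = (u (j + 1) (clampIdx N (i + 1)) + u (j + 1) (clampIdx N (i - 1))) / 2 + s j i

namespace IsReflectedHeat

variable {N I : ℕ} {u s : ℕ → ℤ → ℝ} {c : ℕ → ℝ} {a : ℝ}

/-- The method of images: composition with the folding removes the boundary. -/
theorem comp_foldIdx (hu : IsReflectedHeat N I u s) :
    ∀ j < I, u j ∘ foldIdx N = avg (u (j + 1) ∘ foldIdx N) + s j ∘ foldIdx N := by
  intro j hj
  ext i
  simp only [Function.comp_apply, Pi.add_apply, avg_apply]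
  rw [hu j hj _ (foldIdx_nonneg N i) (foldIdx_le N i)]
  rcases foldIdx_add_one_sub_one N i with ⟨h, h'⟩ | ⟨h, h'⟩
  · rw [h, h']
  · rw [h, h']
    ring

theorem cdiff_comp_foldIdx (j : ℕ) {i : ℤ} (h0 : 0 ≤ i) (hN : i ≤ N) :
    cdiff (u j ∘ foldIdx N) i = u j (clampIdx N (i + 1)) - u j (clampIdx N (i - 1)) := by
  simp only [cdiff_apply, Function.comp_apply]
  rw [foldIdx_eq_clampIdx (by omega) (by omega), foldIdx_eq_clampIdx (by omega) (by omega)]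

/-- The smoothing estimate for bounded terminal values. -/
theorem abs_cdiff_le_of_bounded (hu : IsReflectedHeat N I u s)
    (hs : ∀ j < I, ∀ i : ℤ, 0 ≤ i → i ≤ N → |s j i| ≤ c j)
    (ha : ∀ i : ℤ, 0 ≤ i → i ≤ N → |u I i| ≤ a) {j : ℕ} (hj : j < I) {i : ℤ}
    (h0 : 0 ≤ i) (hN : i ≤ N) :
    |u (j + 1) (clampIdx N (i + 1)) - u (j + 1) (clampIdx N (i - 1))| ≤ 2 * a / √(I - j : ℕ)
      + ∑ k ∈ Finset.range (I - j - 1), 2 * c (j + 1 + k) / √(k + 1) := by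
  rw [← cdiff_comp_foldIdx (j + 1) h0 hN]
  exact MFG.abs_cdiff_le_of_bounded (u := fun j => u j ∘ foldIdx N) (s := fun j => s j ∘ foldIdx N)
    hu.comp_foldIdx (fun j hj i => hs j hj _ (foldIdx_nonneg N i) (foldIdx_le N i))
    (fun i => ha _ (foldIdx_nonneg N i) (foldIdx_le N i)) hj i

/-- The gradient estimate for Lipschitz terminal values. -/
theorem abs_cdiff_le_of_lipschitz (hu : IsReflectedHeat N I u s)
    (hs : ∀ j < I, ∀ i : ℤ, 0 ≤ i → i ≤ N → |s j i| ≤ c j) (ha0 : 0 ≤ a)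
    (ha : ∀ i : ℤ, 0 ≤ i → i < N → |u I (i + 1) - u I i| ≤ a) {j : ℕ} (hj : j < I) {i : ℤ}
    (h0 : 0 ≤ i) (hN : i ≤ N) :
    |u (j + 1) (clampIdx N (i + 1)) - u (j + 1) (clampIdx N (i - 1))| ≤ 2 * a
      + ∑ k ∈ Finset.range (I - j - 1), 2 * c (j + 1 + k) / √(k + 1) := by
  rw [← cdiff_comp_foldIdx (j + 1) h0 hN]
  refine MFG.abs_cdiff_le_of_cdiff_bounded (u := fun j => u j ∘ foldIdx N)
    (s := fun j => s j ∘ foldIdx N)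
    hu.comp_foldIdx (fun j hj i => hs j hj _ (foldIdx_nonneg N i) (foldIdx_le N i))
    (fun i => ?_) hj i
  have h1 := abs_fdiff_comp_foldIdx_le ha0 ha i
  have h2 := abs_fdiff_comp_foldIdx_le ha0 ha (i - 1)
  simp only [fdiff_apply, cdiff_apply, sub_add_cancel] at *
  rw [abs_le] at *
  constructor <;> linarith [h1.1, h1.2, h2.1, h2.2]

/-- The smoothing estimate for second differences, for Lipschitz terminal values and sources. -/
theorem abs_cdiff_fdiff_le (hu : IsReflectedHeat N I u s) (hc : ∀ j, 0 ≤ c j)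
    (hs : ∀ j < I, ∀ i : ℤ, 0 ≤ i → i < N → |s j (i + 1) - s j i| ≤ c j) (ha0 : 0 ≤ a)
    (ha : ∀ i : ℤ, 0 ≤ i → i < N → |u I (i + 1) - u I i| ≤ a) {j : ℕ} (hj : j < I) {i : ℤ}
    (h0 : 0 ≤ i) (hN : i < N) :
    |(u (j + 1) (clampIdx N (i + 1 + 1)) - u (j + 1) (clampIdx N (i + 1 - 1)))
      - (u (j + 1) (clampIdx N (i + 1)) - u (j + 1) (clampIdx N (i - 1)))| ≤ 2 * a / √(I - j : ℕ)
      + ∑ k ∈ Finset.range (I - j - 1), 2 * c (j + 1 + k) / √(k + 1) := by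
  rw [← cdiff_comp_foldIdx (j + 1) h0 hN.le,
    ← cdiff_comp_foldIdx (j + 1) (i := i + 1) (by omega) (by omega)]
  -- The forward difference of the folded solution solves the same free equation, and Lipschitz data
  -- are bounded data for it, so the smoothing estimate for bounded data applies.
  have key : cdiff (u (j + 1) ∘ foldIdx N) (i + 1) - cdiff (u (j + 1) ∘ foldIdx N) i
      = cdiff (fdiff (u (j + 1) ∘ foldIdx N)) i := by
    simp only [cdiff_apply, fdiff_apply]
    ring_nf
  rw [key]
  refine MFG.abs_cdiff_le_of_bounded (u := fun j => fdiff (u j ∘ foldIdx N))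
    (s := fun j => fdiff (s j ∘ foldIdx N)) (fun j hj => ?_)
    (fun j hj i => abs_fdiff_comp_foldIdx_le (hc j) (hs j hj) i)
    (fun i => abs_fdiff_comp_foldIdx_le ha0 ha i) hj i
  rw [hu.comp_foldIdx j hj, map_add, ← Module.End.mul_apply, commute_fdiff_avg.eq,
    Module.End.mul_apply]

end IsReflectedHeat

/-! ### Expectations under finitely supported laws -/

section Expectation

variable {α β : Type*}

/-- The expectation of a real function under a probability mass function. -/
def expect (p : PMF α) (F : α → ℝ) : ℝ := ∑' a, (p a).toReal * F a

theorem expect_eq_sum {p : PMF α} {s : Finset α} (hs : p.support ⊆ s) (F : α → ℝ) :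
    expect p F = ∑ a ∈ s, (p a).toReal * F a := by
  refine tsum_eq_sum fun a ha => ?_
  have : p a = 0 := by
    by_contra h
    exact ha (hs ((PMF.mem_support_iff _ _).2 h))
  rw [this, ENNReal.toReal_zero, zero_mul]

theorem expect_pure (a : α) (F : α → ℝ) : expect (PMF.pure a) F = F a := by
  rw [expect_eq_sum (s := {a}) (by simp [PMF.support_pure])]
  simp

/-- All laws of the chain have finite support, so conditioning on the first step is an exchange of
finite sums and asks no integrability of `F`. -/
theorem expect_bind {p : PMF α} {k : α → PMF β} (hp : p.support.Finite)
    (hk : ∀ a, (k a).support.Finite) (F : β → ℝ) :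
    expect (p.bind k) F = expect p fun a => expect (k a) F := by
  classical
  set s := hp.toFinset
  set t := s.biUnion fun a => (hk a).toFinset with ht
  have h1 : (p.bind k).support ⊆ t := by
    intro b hb
    rw [PMF.mem_support_bind_iff] at hb
    obtain ⟨a, ha, hb⟩ := hb
    simp only [ht, Finset.coe_biUnion, Set.mem_iUnion]
    exact ⟨a, by simpa [s] using ha, by simpa using hb⟩
  have h2 : ∀ a ∈ s, (k a).support ⊆ t := by
    intro a ha b hb
    simp only [ht, Finset.coe_biUnion, Set.mem_iUnion]
    exact ⟨a, ha, by simpa using hb⟩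
  rw [expect_eq_sum h1, expect_eq_sum (s := s) (by simp [s])]
  have h3 : ∀ b, ((p.bind k) b).toReal = ∑ a ∈ s, (p a).toReal * (k a b).toReal := by
    intro b
    rw [PMF.bind_apply, tsum_eq_sum (s := s), ENNReal.toReal_sum]
    · simp
    · exact fun a _ => ENNReal.mul_ne_top (p.apply_ne_top a) ((k a).apply_ne_top b)
    · intro a ha
      have : p a = 0 := by
        by_contra h
        exact ha (by simpa [s] using h)
      rw [this, zero_mul]
  simp_rw [h3, Finset.sum_mul]
  rw [Finset.sum_comm]
  refine Finset.sum_congr rfl fun a ha => ?_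
  rw [expect_eq_sum (h2 a ha), Finset.mul_sum]
  exact Finset.sum_congr rfl fun b _ => by ring

theorem finite_support_pure (a : α) : (PMF.pure a).support.Finite := by
  simp [PMF.support_pure]

theorem finite_support_bind {p : PMF α} {k : α → PMF β} (hp : p.support.Finite)
    (hk : ∀ a, (k a).support.Finite) : (p.bind k).support.Finite := by
  rw [PMF.support_bind]
  exact hp.biUnion fun a _ => hk a

theorem finite_support_map {p : PMF α} (hp : p.support.Finite) (f : α → β) :
    (p.map f).support.Finite := by
  rw [PMF.support_map]
  exact hp.image f

end Expectation

/-! ### Coins -/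

section Coins

open Data

theorem expect_coin (p : Set.Icc (0 : ℝ) 1) (F : Bool → ℝ) :
    expect (coin p) F = p * F true + (1 - p) * F false := by
  have h0 : (0 : ℝ) ≤ p := p.2.1
  have h1 : (0 : ℝ) ≤ 1 - p := sub_nonneg.2 p.2.2
  rw [expect_eq_sum (s := Finset.univ) (fun _ _ => Finset.mem_coe.2 (Finset.mem_univ _)),
    Fintype.sum_bool]
  simp [coin, PMF.ofFintype_apply, ENNReal.toReal_ofReal, h0, -sub_nonneg, h1]

/-- The coupling of two coins through one uniform random variable. -/
def coinPair (p p' : Set.Icc (0 : ℝ) 1) : PMF (Bool × Bool) :=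
  PMF.ofFintype (fun c => ENNReal.ofReal
      (if c.1 then (if c.2 then min (p : ℝ) p' else p - min (p : ℝ) p')
        else (if c.2 then p' - min (p : ℝ) p' else 1 - max (p : ℝ) p'))) (by
    have h1 : (0 : ℝ) ≤ min (p : ℝ) p' := le_min p.2.1 p'.2.1
    have h2 : (0 : ℝ) ≤ p - min (p : ℝ) p' := sub_nonneg.2 (min_le_left _ _)
    have h3 : (0 : ℝ) ≤ p' - min (p : ℝ) p' := sub_nonneg.2 (min_le_right _ _)
    have h4 : (0 : ℝ) ≤ 1 - max (p : ℝ) p' := sub_nonneg.2 (max_le p.2.2 p'.2.2)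
    rw [Fintype.sum_prod_type]
    simp only [Fintype.sum_bool, if_true, Bool.false_eq_true, if_false]
    rw [← ENNReal.ofReal_add h1 h2, ← ENNReal.ofReal_add h3 h4,
      ← ENNReal.ofReal_add (by linarith) (by linarith), ← ENNReal.ofReal_one]
    congr 1
    linarith [min_add_max (p : ℝ) p'])

theorem coinPair_map_fst (p p' : Set.Icc (0 : ℝ) 1) : (coinPair p p').map Prod.fst = coin p := by
  have h1 : (0 : ℝ) ≤ min (p : ℝ) p' := le_min p.2.1 p'.2.1
  have h2 : (0 : ℝ) ≤ p - min (p : ℝ) p' := sub_nonneg.2 (min_le_left _ _)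
  have h3 : (0 : ℝ) ≤ p' - min (p : ℝ) p' := sub_nonneg.2 (min_le_right _ _)
  have h4 : (0 : ℝ) ≤ 1 - max (p : ℝ) p' := sub_nonneg.2 (max_le p.2.2 p'.2.2)
  have h5 := min_add_max (p : ℝ) p'
  ext c
  rw [PMF.map_apply, tsum_fintype, Fintype.sum_prod_type]
  cases c
  · simp only [coinPair, coin, PMF.ofFintype_apply, Fintype.sum_bool, if_true, Bool.false_eq_true,
      if_false, add_zero, zero_add]
    rw [← ENNReal.ofReal_add h3 h4]
    congr 1
    linarith
  · simp only [coinPair, coin, PMF.ofFintype_apply, Fintype.sum_bool, if_true, Bool.false_eq_true,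
      Bool.true_eq_false, if_false, add_zero]
    rw [← ENNReal.ofReal_add h1 h2]
    congr 1
    linarith

theorem coinPair_map_snd (p p' : Set.Icc (0 : ℝ) 1) : (coinPair p p').map Prod.snd = coin p' := by
  have h1 : (0 : ℝ) ≤ min (p : ℝ) p' := le_min p.2.1 p'.2.1
  have h2 : (0 : ℝ) ≤ p - min (p : ℝ) p' := sub_nonneg.2 (min_le_left _ _)
  have h3 : (0 : ℝ) ≤ p' - min (p : ℝ) p' := sub_nonneg.2 (min_le_right _ _)
  have h4 : (0 : ℝ) ≤ 1 - max (p : ℝ) p' := sub_nonneg.2 (max_le p.2.2 p'.2.2)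
  have h5 := min_add_max (p : ℝ) p'
  ext c
  rw [PMF.map_apply, tsum_fintype, Fintype.sum_prod_type]
  cases c
  · simp only [coinPair, coin, PMF.ofFintype_apply, Fintype.sum_bool, if_true, Bool.false_eq_true,
      if_false, zero_add]
    rw [← ENNReal.ofReal_add h2 h4]
    congr 1
    linarith
  · simp only [coinPair, coin, PMF.ofFintype_apply, Fintype.sum_bool, if_true, Bool.false_eq_true,
      Bool.true_eq_false, if_false, add_zero]
    rw [← ENNReal.ofReal_add h1 h3]
    congr 1
    linarith

/-- The two coins of the coupling differ with probability `|p - p'|`. -/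
theorem expect_coinPair_le {p p' : Set.Icc (0 : ℝ) 1} {F : Bool × Bool → ℝ} {A B : ℝ}
    (hF : ∀ c, F (c, c) ≤ A) (hF' : ∀ c, F (c, !c) ≤ A + B) :
    expect (coinPair p p') F ≤ A + B * |(p : ℝ) - p'| := by
  have h1 : (0 : ℝ) ≤ min (p : ℝ) p' := le_min p.2.1 p'.2.1
  have h2 : (0 : ℝ) ≤ p - min (p : ℝ) p' := sub_nonneg.2 (min_le_left _ _)
  have h3 : (0 : ℝ) ≤ p' - min (p : ℝ) p' := sub_nonneg.2 (min_le_right _ _)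
  have h4 : (0 : ℝ) ≤ 1 - max (p : ℝ) p' := sub_nonneg.2 (max_le p.2.2 p'.2.2)
  have h5 := min_add_max (p : ℝ) p'
  have h6 := max_sub_min_eq_abs (p : ℝ) p'
  rw [expect_eq_sum (s := Finset.univ) (by simp), Fintype.sum_prod_type]
  simp only [coinPair, PMF.ofFintype_apply, Fintype.sum_bool, if_true, Bool.false_eq_true,
    if_false]
  rw [ENNReal.toReal_ofReal h1, ENNReal.toReal_ofReal h2, ENNReal.toReal_ofReal h3,
    ENNReal.toReal_ofReal h4, abs_sub_comm, ← h6]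
  have k1 := mul_le_mul_of_nonneg_left (hF true) h1
  have k2 := mul_le_mul_of_nonneg_left (hF' true) h2
  have k3 := mul_le_mul_of_nonneg_left (hF' false) h3
  have k4 := mul_le_mul_of_nonneg_left (hF false) h4
  simp only [Bool.not_true, Bool.not_false] at k2 k3
  have h7 : (max (p : ℝ) p') = p + p' - min (p : ℝ) p' := by linarith
  rw [h7] at k4 ⊢
  linarith

end Coins

/-! ### The Bellman equation of the controlled chain -/

/-- The extension of a grid function to the reflecting positions. -/
def extendBdry (N : ℕ) (h y r : ℝ) (F : ℤ → ℝ) (i : ℤ) : ℝ :=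
  if i = -1 then y * h + F 0 else if i = (N : ℤ) + 1 then r * h + F N else F i

theorem extendBdry_of_mem {N : ℕ} {h y r : ℝ} {F : ℤ → ℝ} {i : ℤ} (h0 : 0 ≤ i) (hN : i ≤ N) :
    extendBdry N h y r F i = F i := by
  rw [extendBdry, if_neg (by omega), if_neg (by omega)]

namespace Data

variable {D : Data} {T : ℝ}

section Grid

variable {h : ℝ}

/-! ### Elementary facts on the grid -/

theorem Regular.timeStep_pos (hD : D.Regular) (hh : 0 < h) : 0 < D.timeStep h := by
  have := hD.σ_pos
  rw [timeStep]
  positivity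

namespace AdmissibleMesh

theorem numSpace_mul (hm : D.AdmissibleMesh T h) : (D.numSpace h : ℝ) * h = D.L := by
  obtain ⟨N, hN⟩ := hm.space_int
  have := hm.h_pos
  rw [numSpace, hN, mul_div_cancel_right₀ _ this.ne', Nat.floor_natCast]

theorem numTime_mul (hD : D.Regular) (hm : D.AdmissibleMesh T h) :
    (D.numTime T h : ℝ) * D.timeStep h = T := by
  obtain ⟨I, hI⟩ := hm.time_int
  have := hD.timeStep_pos hm.h_pos
  rw [numTime]
  nth_rw 1 [hI]
  rw [mul_div_cancel_right₀ _ this.ne', Nat.floor_natCast, hI]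

theorem time_mem (hD : D.Regular) (hm : D.AdmissibleMesh T h) {j : ℕ} (hj : j ≤ D.numTime T h) :
    (j : ℝ) * D.timeStep h ∈ Set.Icc 0 T := by
  have := hD.timeStep_pos hm.h_pos
  refine ⟨by positivity, ?_⟩
  rw [← hm.numTime_mul hD]
  exact mul_le_mul_of_nonneg_right (by exact_mod_cast hj) this.le

theorem space_mem (hm : D.AdmissibleMesh T h) {i : ℤ} (h0 : 0 ≤ i) (hN : i ≤ D.numSpace h) :
    (i : ℝ) * h ∈ Set.Icc 0 D.L := by
  have := hm.h_pos
  have h0' : (0 : ℝ) ≤ i := by exact_mod_cast h0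
  refine ⟨by positivity, ?_⟩
  rw [← hm.numSpace_mul]
  exact mul_le_mul_of_nonneg_right (by exact_mod_cast hN) this.le

theorem upProb_eq (hD : D.Regular) (hm : D.AdmissibleMesh T h) (hT : 0 ≤ T)
    (ν : ProbabilityMeasure (PathSpace T D.L)) {j : ℕ} (hj : j ≤ D.numTime T h) {i : ℤ}
    (h0 : 0 ≤ i) (hN : i ≤ D.numSpace h) {u : ℝ} (hu : u ∈ D.U) :
    (D.upProb hT h ν (j, i) u : ℝ)
      = (h * D.b (j * D.timeStep h) (marginal hT ν (j * D.timeStep h)) (i * h) u + D.σ ^ 2)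
        / (2 * D.σ ^ 2) := by
  obtain ⟨cB, hcB, hb⟩ := hm.prob_pos
  have hσ := hD.σ_pos
  have hh := hm.h_pos
  have hb := abs_le.1 (hb _ (hm.time_mem hD hj) (marginal hT ν (j * D.timeStep h)) _
    (hm.space_mem h0 hN) u hu)
  have h1 := mul_le_mul_of_nonneg_left hb.1 hh.le
  have h2 := mul_le_mul_of_nonneg_left hb.2 hh.le
  rw [upProb, Set.projIcc_of_mem]
  constructor
  · exact div_nonneg (by linarith) (by positivity)
  · rw [div_le_one (by positivity)]
    linarith

end AdmissibleMesh

end Grid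

/-! ### The chain by its first step -/

section Run

variable (D) (hT : 0 ≤ T) (h : ℝ) (ν : ProbabilityMeasure (PathSpace T D.L)) (π : List State → ℝ)
  (s : State)

/-- One step of the chain, recorded on the list of past states. -/
def grow (w : List State) : PMF (List State) :=
  (D.step hT h ν (w.headD s) (π w)).map (fun s' => s' :: w)

/-- The law of the history after `n` further steps. -/
def run : ℕ → List State → PMF (List State)
  | 0, w => PMF.pure w
  | n + 1, w => (D.grow hT h ν π s w).bind (run n)

/-- `pathLaw` appends the last step, while `run` splits off the first one, which is the form that
backward induction needs; this reconciles the two. -/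
theorem run_succ_eq_bind_grow (n : ℕ) (w : List State) :
    D.run hT h ν π s (n + 1) w = (D.run hT h ν π s n w).bind (D.grow hT h ν π s) := by
  induction n generalizing w with
  | zero =>
    simp only [run, PMF.pure_bind]
    exact PMF.bind_pure _
  | succ n ih =>
    rw [run, run, PMF.bind_bind]
    congr 1
    ext1 w'
    exact ih w'

theorem pathLaw_eq_run (n : ℕ) : D.pathLaw hT h ν π s n = D.run hT h ν π s n [s] := by
  induction n with
  | zero => rfl
  | succ n ih => rw [run_succ_eq_bind_grow, ← ih]; rfl

variable {D h s}

theorem run_succ_low (n t : ℕ) (w : List State) :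
    D.run hT h ν π s (n + 1) ((t, -1) :: w) = D.run hT h ν π s n ((t, 0) :: (t, -1) :: w) := by
  simp [run, grow, step, PMF.pure_map, PMF.pure_bind]

theorem run_succ_high (n t : ℕ) (w : List State) :
    D.run hT h ν π s (n + 1) ((t, (D.numSpace h : ℤ) + 1) :: w)
      = D.run hT h ν π s n ((t, (D.numSpace h : ℤ)) :: (t, (D.numSpace h : ℤ) + 1) :: w) := by
  have : (D.numSpace h : ℤ) + 1 ≠ -1 := by omega
  simp [run, grow, step, PMF.pure_map, PMF.pure_bind, this]

theorem run_succ_interior (n : ℕ) {t : ℕ} {i : ℤ} (w : List State) (h0 : 0 ≤ i)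
    (hN : i ≤ D.numSpace h) (ht : t < D.numTime T h) :
    D.run hT h ν π s (n + 1) ((t, i) :: w)
      = (coin (D.upProb hT h ν (t, i) (π ((t, i) :: w)))).bind fun c =>
          D.run hT h ν π s n ((t + 1, if c then i + 1 else i - 1) :: (t, i) :: w) := by
  have h1 : i ≠ -1 := by omega
  have h2 : i ≠ (D.numSpace h : ℤ) + 1 := by omega
  simp only [run, grow, step, List.headD_cons, h1, h2, ht, if_false, if_true, PMF.map_comp,
    PMF.bind_map, Function.comp_def]

theorem run_succ_stopped (n : ℕ) {t : ℕ} {i : ℤ} (w : List State) (h0 : 0 ≤ i)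
    (hN : i ≤ D.numSpace h) (ht : ¬ t < D.numTime T h) :
    D.run hT h ν π s (n + 1) ((t, i) :: w) = D.run hT h ν π s n ((t, i) :: (t, i) :: w) := by
  have h1 : i ≠ -1 := by omega
  have h2 : i ≠ (D.numSpace h : ℤ) + 1 := by omega
  simp [run, grow, step, h1, h2, ht, PMF.pure_map, PMF.pure_bind]

theorem finite_support_coin (p : Set.Icc (0 : ℝ) 1) : (coin p).support.Finite :=
  Set.toFinite _

theorem finite_support_step (s : State) (u : ℝ) : (D.step hT h ν s u).support.Finite := by
  unfold step
  split_ifs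
  · exact finite_support_pure _
  · exact finite_support_pure _
  · exact finite_support_map (finite_support_coin _) _
  · exact finite_support_pure _

theorem finite_support_run (n : ℕ) (w : List State) :
    (D.run hT h ν π s n w).support.Finite := by
  induction n generalizing w with
  | zero => exact finite_support_pure _
  | succ n ih =>
    exact finite_support_bind (finite_support_map (finite_support_step hT ν _ _) _) fun a => ih a

/-- After `n` steps from a state of rank `2 I + 1 - n` the chain has been stopped. -/
def rank (D : Data) (h : ℝ) (s : State) : ℕ :=
  2 * s.1 + if s.2 = -1 ∨ s.2 = (D.numSpace h : ℤ) + 1 then 0 else 1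

theorem rank_of_boundary {t : ℕ} {i : ℤ} (hi : i = -1 ∨ i = (D.numSpace h : ℤ) + 1) :
    rank D h (t, i) = 2 * t := by
  rw [rank, if_pos hi, add_zero]

theorem rank_of_interior {t : ℕ} {i : ℤ} (h0 : 0 ≤ i) (hN : i ≤ D.numSpace h) :
    rank D h (t, i) = 2 * t + 1 := by
  rw [rank, if_neg (by dsimp only; omega)]

theorem two_mul_le_rank (t : ℕ) (i : ℤ) : 2 * t ≤ rank D h (t, i) := Nat.le_add_right _ _

/-! ### Verification -/

/-- The comparison of a solution of the Bellman equation with the cost of a control, for both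
directions of the inequality. -/
theorem mul_le_mul_expect_run (ε : ℝ) {V : ℕ → ℤ → ℝ}
    (hV : ∀ t < D.numTime T h, ∀ i : ℤ, 0 ≤ i → i ≤ D.numSpace h → ∀ w : List State,
      let u := π ((t, i) :: w)
      let E := extendBdry (D.numSpace h) h (D.y ((t + 1 : ℕ) * D.timeStep h))
        (D.r ((t + 1 : ℕ) * D.timeStep h)) (V (t + 1))
      let p : ℝ := D.upProb hT h ν (t, i) u
      ε * V t i ≤ ε * (D.stepCost hT h ν (t, i) u + (p * E (i + 1) + (1 - p) * E (i - 1))))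
    (hV' : ∀ i : ℤ, 0 ≤ i → i ≤ D.numSpace h →
      V (D.numTime T h) i = D.g (marginal hT ν T) (i * h))
    (n t : ℕ) (i : ℤ) (w : List State) (ht : t ≤ D.numTime T h) (hi : D.IsGridIndex h i)
    (hn : 2 * D.numTime T h + 1 ≤ n + rank D h (t, i)) :
    ε * (D.runningCost hT h ν π w + extendBdry (D.numSpace h) h (D.y (t * D.timeStep h))
        (D.r (t * D.timeStep h)) (V t) i)
      ≤ ε * expect (D.run hT h ν π s n ((t, i) :: w)) fun w' =>
          D.runningCost hT h ν π w' + D.g (marginal hT ν T) (position h w' (D.numTime T h)) := by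
  induction n generalizing t i w with
  | zero =>
    -- With no step left, `hn` forces rank at least `2 I + 1`. As `t ≤ I`, the clock is at `I` and
    -- the position is not a reflecting one.
    simp only [rank] at hn
    obtain ⟨h0, hN⟩ := hi
    split_ifs at hn with hr
    · omega
    · have ht' : t = D.numTime T h := by omega
      subst ht'
      have h1 : i ≠ -1 := by omega
      have h2 : i ≠ (D.numSpace h : ℤ) + 1 := by omega
      rw [run, expect_pure, extendBdry_of_mem (by omega) (by omega), hV' i (by omega) (by omega)]
      simp [runningCost, stepCost, position, h1, h2]
  | succ n ih =>
    obtain ⟨h0, hN⟩ := hi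
    by_cases h1 : i = -1
    · subst h1
      rw [run_succ_low]
      -- A reflection raises the rank by one and costs exactly what `extendBdry` adds, so the
      -- inequality passes through as an equality.
      refine le_trans (le_of_eq ?_) (ih t 0 _ ht ⟨by omega, by omega⟩ ?_)
      · rw [extendBdry_of_mem le_rfl (by omega), extendBdry, if_pos rfl]
        simp only [runningCost, stepCost, if_true]
        ring
      · rw [rank_of_boundary (by omega)] at hn
        rw [rank_of_interior (by omega) (by omega)]
        omega
    by_cases h2 : i = (D.numSpace h : ℤ) + 1
    · subst h2
      rw [run_succ_high]
      refine le_trans (le_of_eq ?_) (ih t (D.numSpace h) _ ht ⟨by omega, by omega⟩ ?_)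
      · rw [extendBdry_of_mem (i := (D.numSpace h : ℤ)) (by omega) le_rfl, extendBdry, if_neg h1, if_pos rfl]
        simp only [runningCost, stepCost, if_neg h1, if_true]
        ring
      · rw [rank_of_boundary (by omega)] at hn
        rw [rank_of_interior (by omega) (by omega)]
        omega
    by_cases h3 : t < D.numTime T h
    · rw [run_succ_interior hT ν π n w (by omega) (by omega) h3,
        expect_bind (finite_support_coin _) fun c => finite_support_run hT ν π n _, expect_coin]
      have hup := ih (t + 1) (i + 1) ((t, i) :: w) h3 ⟨by omega, by omega⟩ (by
        rw [rank_of_interior (by omega) (by omega)] at hn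
        have := two_mul_le_rank (D := D) (h := h) (t + 1) (i + 1)
        omega)
      have hdn := ih (t + 1) (i - 1) ((t, i) :: w) h3 ⟨by omega, by omega⟩ (by
        rw [rank_of_interior (by omega) (by omega)] at hn
        have := two_mul_le_rank (D := D) (h := h) (t + 1) (i - 1)
        omega)
      have hstep := hV t h3 i (by omega) (by omega) w
      simp only [if_true, Bool.false_eq_true, if_false]
      rw [extendBdry_of_mem (by omega) (by omega)]
      simp only [runningCost] at hup hdn hstep ⊢
      set p := D.upProb hT h ν (t, i) (π ((t, i) :: w))
      have hp0 : (0 : ℝ) ≤ p := p.2.1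
      have hp1 : (0 : ℝ) ≤ 1 - p := sub_nonneg.2 p.2.2
      have k1 := mul_le_mul_of_nonneg_left hup hp0
      have k2 := mul_le_mul_of_nonneg_left hdn hp1
      linarith
    · rw [run_succ_stopped hT ν π n w (by omega) (by omega) h3]
      refine le_trans (le_of_eq ?_) (ih t i _ ht ⟨by omega, by omega⟩ ?_)
      · simp [runningCost, stepCost, if_neg h1, if_neg h2, if_neg h3]
      · rw [rank_of_interior (by omega) (by omega)] at hn ⊢
        omega

end Run

end Data

theorem extendBdry_congr {N : ℕ} {h y r : ℝ} {F G : ℤ → ℝ}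
    (hFG : ∀ i : ℤ, 0 ≤ i → i ≤ N → F i = G i) {i : ℤ} (h0 : -1 ≤ i) (hN : i ≤ N + 1) :
    extendBdry N h y r F i = extendBdry N h y r G i := by
  unfold extendBdry
  split_ifs
  · rw [hFG 0 le_rfl (by omega)]
  · rw [hFG N (by omega) le_rfl]
  · exact hFG i (by omega) (by omega)

namespace Data

variable (D : Data) {T : ℝ}

/-! ### The value function -/

/-- The minimized Hamiltonian. -/
def hamiltonian (αhat : ℝ → D.StateLaw → ℝ → ℝ → ℝ) (t : ℝ) (η : D.StateLaw) (x p : ℝ) : ℝ :=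
  D.f t η x (αhat t η x p) + D.b t η x (αhat t η x p) * p

/-- The solution of the Bellman equation, as a function of the number of remaining time steps. -/
def bellman (hT : 0 ≤ T) (h : ℝ) (ν : ProbabilityMeasure (PathSpace T D.L))
    (αhat : ℝ → D.StateLaw → ℝ → ℝ → ℝ) : ℕ → ℤ → ℝ
  | 0, i => D.g (marginal hT ν T) (i * h)
  | m + 1, i =>
    let t : ℕ := D.numTime T h - (m + 1)
    let E := extendBdry (D.numSpace h) h (D.y ((t + 1 : ℕ) * D.timeStep h))
      (D.r ((t + 1 : ℕ) * D.timeStep h)) (bellman hT h ν αhat m)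
    (E (i + 1) + E (i - 1)) / 2 + D.timeStep h * D.hamiltonian αhat (t * D.timeStep h)
      (marginal hT ν (t * D.timeStep h)) (i * h) ((E (i + 1) - E (i - 1)) / (2 * h))

variable {D} {hT : 0 ≤ T} {h : ℝ} {ν : ProbabilityMeasure (PathSpace T D.L)}
  {αhat : ℝ → D.StateLaw → ℝ → ℝ → ℝ}

theorem IsUniqueArgmin.hamiltonian_le (hα : D.IsUniqueArgmin αhat) {t : ℝ}
    (ht : t ∈ Set.Icc 0 D.M) (η : D.StateLaw) {x : ℝ} (hx : x ∈ Set.Icc 0 D.L) (p : ℝ) {u : ℝ}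
    (hu : u ∈ D.U) : D.hamiltonian αhat t η x p ≤ D.f t η x u + D.b t η x u * p := by
  by_cases h : u = αhat t η x p
  · rw [h]; exact le_rfl
  · exact ((hα t ht η x hx p).2 u hu h).le

theorem bellman_step (hT : 0 ≤ T) (ν : ProbabilityMeasure (PathSpace T D.L))
    (αhat : ℝ → D.StateLaw → ℝ → ℝ → ℝ) {t : ℕ} (ht : t < D.numTime T h) (i : ℤ) :
    let E := extendBdry (D.numSpace h) h (D.y ((t + 1 : ℕ) * D.timeStep h))
      (D.r ((t + 1 : ℕ) * D.timeStep h)) (D.bellman hT h ν αhat (D.numTime T h - (t + 1)))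
    D.bellman hT h ν αhat (D.numTime T h - t) i
      = (E (i + 1) + E (i - 1)) / 2 + D.timeStep h * D.hamiltonian αhat (t * D.timeStep h)
        (marginal hT ν (t * D.timeStep h)) (i * h) ((E (i + 1) - E (i - 1)) / (2 * h)) := by
  obtain ⟨m, hm⟩ : ∃ m, D.numTime T h - t = m + 1 := ⟨D.numTime T h - t - 1, by omega⟩
  have h1 : D.numTime T h - (t + 1) = m := by omega
  have h2 : D.numTime T h - (m + 1) = t := by omega
  rw [hm, h1, bellman, h2]

/-- The scaling of the time step by `h² / σ²` turns the bias of the coin into the drift times a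
central difference quotient, so one step costs the symmetric average plus a Hamiltonian term. -/
theorem step_identity (hD : D.Regular) (hm : D.AdmissibleMesh T h) {t : ℕ}
    (ht : t < D.numTime T h) {i : ℤ} (h0 : 0 ≤ i) (hN : i ≤ D.numSpace h) {u : ℝ} (hu : u ∈ D.U)
    (a c : ℝ) :
    D.stepCost hT h ν (t, i) u
        + ((D.upProb hT h ν (t, i) u : ℝ) * a + (1 - (D.upProb hT h ν (t, i) u : ℝ)) * c)
      = (a + c) / 2 + D.timeStep h * (D.f (t * D.timeStep h) (marginal hT ν (t * D.timeStep h))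
          (i * h) u + D.b (t * D.timeStep h) (marginal hT ν (t * D.timeStep h))
          (i * h) u * ((a - c) / (2 * h))) := by
  have h1 : i ≠ -1 := by omega
  have h2 : i ≠ (D.numSpace h : ℤ) + 1 := by omega
  have hσ := hD.σ_pos
  have hh := hm.h_pos
  rw [hm.upProb_eq hD hT ν ht.le h0 hN hu]
  simp only [stepCost, h1, h2, ht, if_true, if_false]
  have : D.timeStep h = h ^ 2 / D.σ ^ 2 := rfl
  generalize D.f (t * D.timeStep h) (marginal hT ν (t * D.timeStep h)) (i * h) u = f
  generalize D.b (t * D.timeStep h) (marginal hT ν (t * D.timeStep h)) (i * h) u = b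
  rw [this]
  field_simp
  ring

theorem cost_eq_expect (π : List State → ℝ) (s : State) :
    D.cost hT h ν π s = expect (D.run hT h ν π s (2 * D.numTime T h + 1) [s]) fun w =>
      D.runningCost hT h ν π w + D.g (marginal hT ν T) (position h w (D.numTime T h)) := by
  rw [← pathLaw_eq_run]; rfl

/-- The value function solves the Bellman equation. -/
theorem value_eq_bellman (hD : D.Regular) (hm : D.AdmissibleMesh T h) (hTM : T ≤ D.M)
    (hα : D.IsUniqueArgmin αhat) {j : ℕ} (hj : j ≤ D.numTime T h) {i : ℤ} (h0 : 0 ≤ i)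
    (hN : i ≤ D.numSpace h) :
    D.value hT h ν j i = D.bellman hT h ν αhat (D.numTime T h - j) i := by
  set V : ℕ → ℤ → ℝ := fun t => D.bellman hT h ν αhat (D.numTime T h - t) with hVdef
  have htime : ∀ t ≤ D.numTime T h, (t : ℝ) * D.timeStep h ∈ Set.Icc 0 D.M := fun t ht =>
    Set.Icc_subset_Icc_right hTM (hm.time_mem hD ht)
  have hrank : 2 * D.numTime T h + 1 ≤ 2 * D.numTime T h + 1 + rank D h (j, i) :=
    Nat.le_add_right _ _
  have hV' : ∀ i : ℤ, 0 ≤ i → i ≤ D.numSpace h →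
      V (D.numTime T h) i = D.g (marginal hT ν T) (i * h) := by
    intro i _ _
    simp only [hVdef, Nat.sub_self, bellman]
  have lower : ∀ π : List State → ℝ, (∀ w, π w ∈ D.U) → V j i ≤ D.cost hT h ν π (j, i) := by
    intro π hπ
    have := mul_le_mul_expect_run (s := (j, i)) hT ν π 1 (V := V) (fun t ht i h0 hN w => ?_) hV'
      (2 * D.numTime T h + 1) j i [] hj ⟨by omega, by omega⟩ hrank
    · rw [extendBdry_of_mem h0 hN, ← cost_eq_expect] at this
      simpa [runningCost] using this
    · simp only [one_mul]
      rw [step_identity hD hm ht h0 hN (hπ _), hVdef]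
      simp only
      rw [bellman_step hT ν αhat ht]
      exact add_le_add_right (mul_le_mul_of_nonneg_left (hα.hamiltonian_le (htime t ht.le) _
        (hm.space_mem h0 hN) _ (hπ _)) (hD.timeStep_pos hm.h_pos).le) _
  obtain ⟨π, hπ, hle⟩ : ∃ π : List State → ℝ, (∀ w, π w ∈ D.U) ∧
      D.cost hT h ν π (j, i) ≤ V j i := by
    classical
    let E : ℕ → ℤ → ℝ := fun t => extendBdry (D.numSpace h) h (D.y (t * D.timeStep h))
      (D.r (t * D.timeStep h)) (V t)
    let β : State → ℝ := fun s => αhat (s.1 * D.timeStep h) (marginal hT ν (s.1 * D.timeStep h))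
      (s.2 * h) ((E (s.1 + 1) (s.2 + 1) - E (s.1 + 1) (s.2 - 1)) / (2 * h))
    let u₀ : ℝ := β (j, i)
    have hβ : ∀ s : State, s.1 ≤ D.numTime T h → 0 ≤ s.2 → s.2 ≤ D.numSpace h → β s ∈ D.U :=
      fun s h1 h2 h3 => (hα _ (htime _ h1) _ _ (hm.space_mem h2 h3) _).1
    -- A control must be `U`-valued on every list, whereas `β` is known to be so only at interior
    -- grid states up to the horizon. Elsewhere the fixed element `u₀` is used, and this affects no
    -- rate control step of the chain.
    let π : List State → ℝ := fun w =>
      if β (w.headD (j, i)) ∈ D.U then β (w.headD (j, i)) else u₀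
    have hπU : ∀ w, π w ∈ D.U := by
      intro w
      simp only [π]
      split_ifs with h
      · exact h
      · exact hβ (j, i) hj h0 hN
    refine ⟨π, hπU, ?_⟩
    have := mul_le_mul_expect_run (s := (j, i)) hT ν π (-1) (V := V) (fun t ht i h0 hN w => ?_) hV'
      (2 * D.numTime T h + 1) j i [] hj ⟨by omega, by omega⟩ hrank
    · rw [extendBdry_of_mem h0 hN, ← cost_eq_expect] at this
      simp only [runningCost, zero_add] at this
      linarith
    · have hu : π ((t, i) :: w) = β (t, i) := if_pos (hβ (t, i) ht.le h0 hN)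
      simp only [neg_mul, one_mul, neg_le_neg_iff]
      rw [step_identity hD hm ht h0 hN (hπU _), hu]
      simp only [V]
      rw [bellman_step hT ν αhat ht]
      exact le_rfl
  refine le_antisymm ?_ ?_
  · refine le_trans (csInf_le (a := D.cost hT h ν π (j, i)) ⟨V j i, ?_⟩ ⟨π, hπ, rfl⟩) hle
    rintro c ⟨π, hπ, rfl⟩
    exact lower π hπ
  · refine le_csInf ⟨_, π, hπ, rfl⟩ ?_
    rintro c ⟨π, hπ, rfl⟩
    exact lower π hπ

theorem extValue_eq_extendBdry (j : ℕ) : D.extValue hT h ν j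
    = extendBdry (D.numSpace h) h (D.y (j * D.timeStep h)) (D.r (j * D.timeStep h))
      (D.value hT h ν j) := rfl

theorem value_terminal (hD : D.Regular) (hm : D.AdmissibleMesh T h) (hTM : T ≤ D.M)
    (hα : D.IsUniqueArgmin αhat) {i : ℤ} (h0 : 0 ≤ i) (hN : i ≤ D.numSpace h) :
    D.value hT h ν (D.numTime T h) i = D.g (marginal hT ν T) (i * h) := by
  rw [value_eq_bellman hD hm hTM hα le_rfl h0 hN, Nat.sub_self, bellman]

theorem value_step (hD : D.Regular) (hm : D.AdmissibleMesh T h) (hTM : T ≤ D.M)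
    (hα : D.IsUniqueArgmin αhat) {j : ℕ} (hj : j < D.numTime T h) {i : ℤ} (h0 : 0 ≤ i)
    (hN : i ≤ D.numSpace h) :
    D.value hT h ν j i
      = (D.extValue hT h ν (j + 1) (i + 1) + D.extValue hT h ν (j + 1) (i - 1)) / 2
        + D.timeStep h * D.hamiltonian αhat (j * D.timeStep h)
          (marginal hT ν (j * D.timeStep h)) (i * h) (D.diffValue hT h ν j i) := by
  have hE : ∀ i : ℤ, -1 ≤ i → i ≤ D.numSpace h + 1 → D.extValue hT h ν (j + 1) i
      = extendBdry (D.numSpace h) h (D.y ((j + 1 : ℕ) * D.timeStep h))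
        (D.r ((j + 1 : ℕ) * D.timeStep h))
        (D.bellman hT h ν αhat (D.numTime T h - (j + 1))) i := by
    intro i hi hi'
    rw [extValue_eq_extendBdry]
    exact extendBdry_congr (fun i h0 hN => value_eq_bellman hD hm hTM hα hj h0 hN) hi hi'
  rw [value_eq_bellman hD hm hTM hα hj.le h0 hN, bellman_step hT ν αhat hj, diffValue,
    hE _ (by omega) (by omega), hE _ (by omega) (by omega)]

end Data

/-! ### The Wasserstein distance -/

section Wasserstein

variable {S S' : Type*} [PseudoMetricSpace S] [MeasurableSpace S] [PseudoMetricSpace S']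
  [MeasurableSpace S']

theorem W1_bddBelow (μ ν : ProbabilityMeasure S) : BddBelow {c : ℝ | ∃ π : ProbabilityMeasure (S × S),
    (π : Measure (S × S)).map Prod.fst = (μ : Measure S) ∧
    (π : Measure (S × S)).map Prod.snd = (ν : Measure S) ∧
    c = ∫ z, dist z.1 z.2 ∂(π : Measure (S × S))} := by
  refine ⟨0, ?_⟩
  rintro c ⟨π, -, -, rfl⟩
  exact integral_nonneg fun z => dist_nonneg

theorem W1_nonempty (μ ν : ProbabilityMeasure S) : {c : ℝ | ∃ π : ProbabilityMeasure (S × S),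
    (π : Measure (S × S)).map Prod.fst = (μ : Measure S) ∧
    (π : Measure (S × S)).map Prod.snd = (ν : Measure S) ∧
    c = ∫ z, dist z.1 z.2 ∂(π : Measure (S × S))}.Nonempty :=
  ⟨_, μ.prod ν, by simp, by simp, rfl⟩

theorem W1_le_of_coupling {μ ν : ProbabilityMeasure S} (π : ProbabilityMeasure (S × S))
    (h1 : (π : Measure (S × S)).map Prod.fst = (μ : Measure S))
    (h2 : (π : Measure (S × S)).map Prod.snd = (ν : Measure S)) :
    W1 μ ν ≤ ∫ z, dist z.1 z.2 ∂(π : Measure (S × S)) :=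
  csInf_le (W1_bddBelow μ ν) ⟨π, h1, h2, rfl⟩

theorem W1_nonneg (μ ν : ProbabilityMeasure S) : 0 ≤ W1 μ ν := by
  refine le_csInf (W1_nonempty μ ν) ?_
  rintro c ⟨π, -, -, rfl⟩
  exact integral_nonneg fun z => dist_nonneg

theorem W1_le_of_dist_le {C : ℝ} (hC : ∀ x y : S, dist x y ≤ C) (μ ν : ProbabilityMeasure S) :
    W1 μ ν ≤ C := by
  have hC0 : 0 ≤ C := by
    have : Nonempty S := μ.nonempty
    exact dist_nonneg.trans (hC (Classical.arbitrary S) (Classical.arbitrary S))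
  refine (W1_le_of_coupling (μ.prod ν) (by simp) (by simp)).trans ?_
  -- No compatibility of the measurable structure with the metric is assumed here, so the distance
  -- may fail to be measurable; its integral is then zero by convention.
  by_cases hi : Integrable (fun z : S × S => dist z.1 z.2) (μ.prod ν : ProbabilityMeasure (S × S))
  · refine (integral_mono hi (integrable_const C) fun z => hC _ _).trans ?_
    simp
  · rw [integral_undef hi]
    exact hC0

variable [BorelSpace S] [SecondCountableTopology S] [BorelSpace S'] [SecondCountableTopology S']

theorem integrable_dist {C : ℝ} (hC : ∀ x y : S, dist x y ≤ C) (π : ProbabilityMeasure (S × S)) :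
    Integrable (fun z : S × S => dist z.1 z.2) (π : Measure (S × S)) :=
  Integrable.of_bound (measurable_fst.dist measurable_snd).aestronglyMeasurable C
    (Filter.Eventually.of_forall fun z => by
      rw [Real.norm_of_nonneg dist_nonneg]; exact hC _ _)

theorem W1_map_le {C : ℝ} (hC : ∀ x y : S, dist x y ≤ C) {φ : S → S'} (hφ : LipschitzWith 1 φ)
    (μ ν : ProbabilityMeasure S) :
    W1 (μ.map hφ.continuous.measurable.aemeasurable) (ν.map hφ.continuous.measurable.aemeasurable)
      ≤ W1 μ ν := by
  have hm : Measurable φ := hφ.continuous.measurable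
  refine le_csInf (W1_nonempty μ ν) ?_
  rintro c ⟨π, h1, h2, rfl⟩
  have hm2 : Measurable (Prod.map φ φ) := hm.prodMap hm
  refine (W1_le_of_coupling (π.map hm2.aemeasurable) ?_ ?_).trans ?_
  · rw [ProbabilityMeasure.toMeasure_map, ProbabilityMeasure.toMeasure_map, ← h1,
      Measure.map_map measurable_fst hm2, Measure.map_map hm measurable_fst]
    rfl
  · rw [ProbabilityMeasure.toMeasure_map, ProbabilityMeasure.toMeasure_map, ← h2,
      Measure.map_map measurable_snd hm2, Measure.map_map hm measurable_snd]
    rfl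
  · rw [ProbabilityMeasure.toMeasure_map, integral_map hm2.aemeasurable
      (measurable_fst.dist measurable_snd).aestronglyMeasurable]
    refine integral_mono_of_nonneg (Filter.Eventually.of_forall fun z => dist_nonneg)
      (integrable_dist hC π) (Filter.Eventually.of_forall fun z => ?_)
    simpa using hφ.dist_le_mul z.1 z.2

theorem W1_self (μ : ProbabilityMeasure S) : W1 μ μ = 0 := by
  have hm : Measurable fun x : S => (x, x) := measurable_id.prodMk measurable_id
  refine le_antisymm ((W1_le_of_coupling (μ.map hm.aemeasurable) ?_ ?_).trans_eq ?_)
    (W1_nonneg μ μ)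
  · rw [ProbabilityMeasure.toMeasure_map, Measure.map_map measurable_fst hm]
    exact Measure.map_id
  · rw [ProbabilityMeasure.toMeasure_map, Measure.map_map measurable_snd hm]
    exact Measure.map_id
  · rw [ProbabilityMeasure.toMeasure_map, integral_map hm.aemeasurable
      (measurable_fst.dist measurable_snd).aestronglyMeasurable]
    simp

theorem W1_comm (μ ν : ProbabilityMeasure S) : W1 μ ν = W1 ν μ := by
  have key : ∀ μ ν : ProbabilityMeasure S, W1 ν μ ≤ W1 μ ν := by
    intro μ ν
    refine le_csInf (W1_nonempty μ ν) ?_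
    rintro c ⟨π, h1, h2, rfl⟩
    have hs : Measurable (Prod.swap : S × S → S × S) := measurable_swap
    refine (W1_le_of_coupling (π.map hs.aemeasurable) ?_ ?_).trans_eq ?_
    · rw [ProbabilityMeasure.toMeasure_map, Measure.map_map measurable_fst hs, ← h2]
      rfl
    · rw [ProbabilityMeasure.toMeasure_map, Measure.map_map measurable_snd hs, ← h1]
      rfl
    · rw [ProbabilityMeasure.toMeasure_map, integral_map hs.aemeasurable
        (measurable_fst.dist measurable_snd).aestronglyMeasurable]
      simp only [Prod.fst_swap, Prod.snd_swap, dist_comm]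
  exact le_antisymm (key ν μ) (key μ ν)

theorem W1_toMeasure_map_le {C : ℝ} (hC : ∀ x y : S, dist x y ≤ C) {α : Type*} (p : PMF α)
    (F F' : α → S) {μ ν : ProbabilityMeasure S}
    (hμ : (μ : Measure S) = (p.map F).toMeasure) (hν : (ν : Measure S) = (p.map F').toMeasure) :
    W1 μ ν ≤ expect p fun a => dist (F a) (F' a) := by
  -- With the discrete σ-algebra every map out of `α` is measurable, and pushing `p` forward along
  -- the pair `(F, F')` gives the coupling.
  let _ : MeasurableSpace α := ⊤
  have _ : MeasurableSingletonClass α := ⟨fun _ => trivial⟩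
  have hF : Measurable F := measurable_from_top
  have hF' : Measurable F' := measurable_from_top
  have hG : Measurable fun a => (F a, F' a) := hF.prodMk hF'
  let π : ProbabilityMeasure (S × S) := ⟨p.toMeasure.map fun a => (F a, F' a),
    Measure.isProbabilityMeasure_map hG.aemeasurable⟩
  have hπ : (π : Measure (S × S)) = p.toMeasure.map fun a => (F a, F' a) := rfl
  have hd : Measurable fun z : S × S => dist z.1 z.2 := measurable_fst.dist measurable_snd
  refine (W1_le_of_coupling π ?_ ?_).trans_eq ?_
  · rw [hπ, Measure.map_map measurable_fst hG, hμ, ← PMF.toMeasure_map F p hF]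
    rfl
  · rw [hπ, Measure.map_map measurable_snd hG, hν, ← PMF.toMeasure_map F' p hF']
    rfl
  · rw [hπ, integral_map hG.aemeasurable hd.aestronglyMeasurable, PMF.integral_eq_tsum]
    · rfl
    · refine Integrable.of_bound (measurable_from_top).aestronglyMeasurable C
        (Filter.Eventually.of_forall fun a => ?_)
      rw [Real.norm_of_nonneg dist_nonneg]
      exact hC _ _

end Wasserstein

/-! ### The reflected walk on the grid -/

/-- The law of the trajectory of a reflected walk on `{0, …, N}` up to the time `I`, given the
trajectory `x` up to the time `I - m`; `P t i` is the probability of an upward step. -/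
def reflectedWalk (N I : ℕ) (P : ℕ → ℤ → Set.Icc (0 : ℝ) 1) : ℕ → (ℕ → ℤ) → PMF (ℕ → ℤ)
  | 0, x => PMF.pure x
  | m + 1, x => (Data.coin (P (I - (m + 1)) (x (I - (m + 1))))).bind fun c =>
      reflectedWalk N I P m (Function.update x (I - (m + 1) + 1)
        (clampIdx N (if c then x (I - (m + 1)) + 1 else x (I - (m + 1)) - 1)))

/-- Two reflected walks driven by the same uniform random variables. -/
def reflectedWalkPair (N I : ℕ) (P P' : ℕ → ℤ → Set.Icc (0 : ℝ) 1) :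
    ℕ → (ℕ → ℤ) × (ℕ → ℤ) → PMF ((ℕ → ℤ) × (ℕ → ℤ))
  | 0, x => PMF.pure x
  | m + 1, x =>
    (coinPair (P (I - (m + 1)) (x.1 (I - (m + 1)))) (P' (I - (m + 1)) (x.2 (I - (m + 1))))).bind
      fun c => reflectedWalkPair N I P P' m
        (Function.update x.1 (I - (m + 1) + 1)
          (clampIdx N (if c.1 then x.1 (I - (m + 1)) + 1 else x.1 (I - (m + 1)) - 1)),
        Function.update x.2 (I - (m + 1) + 1)
          (clampIdx N (if c.2 then x.2 (I - (m + 1)) + 1 else x.2 (I - (m + 1)) - 1)))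

section Pair

variable {N I : ℕ} {P P' : ℕ → ℤ → Set.Icc (0 : ℝ) 1}

theorem reflectedWalkPair_map_fst (m : ℕ) (x : (ℕ → ℤ) × (ℕ → ℤ)) :
    (reflectedWalkPair N I P P' m x).map Prod.fst = reflectedWalk N I P m x.1 := by
  induction m generalizing x with
  | zero => exact PMF.pure_map _ _
  | succ m ih =>
    rw [reflectedWalkPair, reflectedWalk, PMF.map_bind, ← coinPair_map_fst _
      (P' (I - (m + 1)) (x.2 (I - (m + 1)))), PMF.bind_map]
    congr 1
    ext1 c
    exact ih _

theorem reflectedWalkPair_map_snd (m : ℕ) (x : (ℕ → ℤ) × (ℕ → ℤ)) :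
    (reflectedWalkPair N I P P' m x).map Prod.snd = reflectedWalk N I P' m x.2 := by
  induction m generalizing x with
  | zero => exact PMF.pure_map _ _
  | succ m ih =>
    rw [reflectedWalkPair, reflectedWalk, PMF.map_bind, ← coinPair_map_snd
      (P (I - (m + 1)) (x.1 (I - (m + 1)))), PMF.bind_map]
    congr 1
    ext1 c
    exact ih _

theorem finite_support_coinPair (p p' : Set.Icc (0 : ℝ) 1) : (coinPair p p').support.Finite :=
  Set.toFinite _

theorem finite_support_reflectedWalkPair (m : ℕ) (x : (ℕ → ℤ) × (ℕ → ℤ)) :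
    (reflectedWalkPair N I P P' m x).support.Finite := by
  induction m generalizing x with
  | zero => exact finite_support_pure _
  | succ m ih => exact finite_support_bind (finite_support_coinPair _ _) fun a => ih _

/-- The projection is nonexpansive, so reflection never drives the walks apart; only differing coins
do. -/
theorem abs_clampIdx_step_le (N : ℕ) (c c' : Bool) (i i' : ℤ) :
    |((clampIdx N (if c then i + 1 else i - 1) : ℤ) : ℝ)
        - (clampIdx N (if c' then i' + 1 else i' - 1) : ℤ)|
      ≤ |(i : ℝ) - i'| + if c = c' then 0 else 2 := by
  have h1 := abs_clampIdx_sub_le N (if c then i + 1 else i - 1) (if c' then i' + 1 else i' - 1)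
  have h2 : |(if c then i + 1 else i - 1) - (if c' then i' + 1 else i' - 1)|
      ≤ |i - i'| + if c = c' then 0 else 2 := by
    have h3 := le_abs_self (i - i')
    have h4 := neg_le_abs (i - i')
    rw [abs_le]
    cases c <;> cases c' <;> simp <;> omega
  exact_mod_cast h1.trans h2

/-- The coupling estimate: the expected uniform distance of the two walks is controlled by the
discrepancy of their transition probabilities. -/
theorem expect_reflectedWalkPair_le {h : ℝ} (hh : 0 ≤ h) {a κ : ℕ → ℝ}
    (ha : ∀ t, 0 ≤ a t) (hκ : ∀ t, 0 ≤ κ t)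
    (hP : ∀ t < I, ∀ i i' : ℤ, 0 ≤ i → i ≤ N → 0 ≤ i' → i' ≤ N →
      2 * h * |(P t i : ℝ) - P' t i'| ≤ a t + κ t * (|(i : ℝ) - i'| * h))
    {G : (ℕ → ℤ) × (ℕ → ℤ) → ℝ}
    (hG : ∀ x r, (∀ j ≤ I, |(x.1 j : ℝ) - x.2 j| * h ≤ r) → G x ≤ r)
    {m : ℕ} (hm : m ≤ I) (x : (ℕ → ℤ) × (ℕ → ℤ)) (r : ℝ)
    (hx : ∀ j ≤ I - m, 0 ≤ x.1 j ∧ x.1 j ≤ N ∧ 0 ≤ x.2 j ∧ x.2 j ≤ N ∧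
      |(x.1 j : ℝ) - x.2 j| * h ≤ r) :
    expect (reflectedWalkPair N I P P' m x) G
      ≤ (r + ∑ t ∈ Finset.Ico (I - m) I, a t) * Real.exp (∑ t ∈ Finset.Ico (I - m) I, κ t) := by
  induction m generalizing x r with
  | zero =>
    simp only [reflectedWalkPair, expect_pure, Nat.sub_zero, Finset.Ico_self, Finset.sum_empty,
      add_zero, Real.exp_zero, mul_one]
    exact hG x r fun j hj => (hx j (by simpa using hj)).2.2.2.2
  | succ m ih =>
    rw [reflectedWalkPair, expect_bind (finite_support_coinPair _ _)
      fun c => finite_support_reflectedWalkPair _ _]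
    obtain ⟨t, ht⟩ : ∃ t, t = I - (m + 1) := ⟨_, rfl⟩
    have ht1 : I - m = t + 1 := by omega
    have htI : t < I := by omega
    rw [← ht] at hx ⊢
    rw [ht1] at ih
    rw [Finset.sum_eq_sum_Ico_succ_bot htI, Finset.sum_eq_sum_Ico_succ_bot htI]
    set A := ∑ t ∈ Finset.Ico (t + 1) I, a t
    set K := ∑ t ∈ Finset.Ico (t + 1) I, κ t
    obtain ⟨h1, h2, h3, h4, h5⟩ := hx t le_rfl
    have hr : 0 ≤ r := le_trans (by positivity) h5
    have hA : 0 ≤ A := Finset.sum_nonneg fun t _ => ha t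
    -- The number `r` bounds all distances up to the present, so the induction controls the maximum
    -- over time. It is unchanged when the coins agree and grows by `2 h` when they differ.
    have key : ∀ (c : Bool × Bool) (r' : ℝ), r + (if c.1 = c.2 then 0 else 2) * h ≤ r' →
        expect (reflectedWalkPair N I P P' m
          (Function.update x.1 (t + 1) (clampIdx N (if c.1 then x.1 t + 1 else x.1 t - 1)),
            Function.update x.2 (t + 1) (clampIdx N (if c.2 then x.2 t + 1 else x.2 t - 1)))) G
          ≤ (r' + A) * Real.exp K := by
      intro c r' hr'
      refine ih (by omega) _ r' fun j hj => ?_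
      rcases hj.eq_or_lt with rfl | hj
      · simp only [Function.update_self]
        refine ⟨clampIdx_nonneg _ _, clampIdx_le _ _, clampIdx_nonneg _ _, clampIdx_le _ _, ?_⟩
        refine (mul_le_mul_of_nonneg_right (abs_clampIdx_step_le N c.1 c.2 (x.1 t) (x.2 t))
          hh).trans ?_
        rw [add_mul]
        linarith
      · simp only [Function.update_of_ne hj.ne]
        obtain ⟨k1, k2, k3, k4, k5⟩ := hx j (by omega)
        refine ⟨k1, k2, k3, k4, ?_⟩
        have : 0 ≤ (if c.1 = c.2 then (0 : ℝ) else 2) * h := by split_ifs <;> positivity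
        linarith
    refine (expect_coinPair_le (A := (r + A) * Real.exp K) (B := 2 * h * Real.exp K)
      (fun c => key (c, c) r (by simp)) fun c => ?_).trans ?_
    · refine (key (c, !c) (r + 2 * h) ?_).trans (le_of_eq (by ring))
      cases c <;> simp
    -- The expected growth of the bound is at most `a t + κ t * r`; with `1 + κ t ≤ exp (κ t)` this
    -- is one step of the discrete Gronwall inequality.
    · have h6 := hP t htI _ _ h1 h2 h3 h4
      have h7 : κ t * (|(x.1 t : ℝ) - x.2 t| * h) ≤ κ t * r := mul_le_mul_of_nonneg_left h5 (hκ t)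
      have h8 : κ t + 1 ≤ Real.exp (κ t) := Real.add_one_le_exp _
      rw [Real.exp_add]
      have hK := (Real.exp_pos K).le
      calc (r + A) * Real.exp K
            + 2 * h * Real.exp K * |(P t (x.1 t) : ℝ) - P' t (x.2 t)|
          = (r + A + 2 * h * |(P t (x.1 t) : ℝ) - P' t (x.2 t)|) * Real.exp K := by ring
        _ ≤ ((r + (a t + A)) * Real.exp (κ t)) * Real.exp K := by
            refine mul_le_mul_of_nonneg_right ?_ hK
            calc _ ≤ (r + (a t + A)) + κ t * r := by linarith
              _ ≤ (r + (a t + A)) * (κ t + 1) := by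
                  have := mul_nonneg (hκ t) (add_nonneg (ha t) hA)
                  linarith
              _ ≤ _ := mul_le_mul_of_nonneg_left h8 (by linarith [ha t])
        _ = _ := by ring

end Pair

/-! ### The chain observed at the grid times -/

namespace Data

variable {D : Data} {T : ℝ}

/-- The grid index of the last position recorded at the time instant `j`. -/
def posIdx (w : List State) (j : ℕ) : ℤ :=
  match w.find? (fun s => s.1 == j) with
  | some s => s.2
  | none => 0

theorem position_eq (h : ℝ) (w : List State) (j : ℕ) : position h w j = posIdx w j * h := by
  unfold position posIdx
  cases w.find? (fun s => s.1 == j) <;> simp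

theorem posIdx_cons_self (t : ℕ) (i : ℤ) (w : List State) : posIdx ((t, i) :: w) t = i := by
  simp [posIdx]

theorem posIdx_cons_of_ne {t j : ℕ} (h : t ≠ j) (i : ℤ) (w : List State) :
    posIdx ((t, i) :: w) j = posIdx w j := by
  simp [posIdx, h]

theorem posIdx_cons_mem {N t : ℕ} {i : ℤ} {w : List State} (h0 : 0 ≤ i) (hN : i ≤ N)
    (hw : ∀ j, t ≠ j → 0 ≤ posIdx w j ∧ posIdx w j ≤ N) (j : ℕ) :
    0 ≤ posIdx ((t, i) :: w) j ∧ posIdx ((t, i) :: w) j ≤ N := by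
  by_cases hj : t = j
  · subst hj; rw [posIdx_cons_self]; exact ⟨h0, hN⟩
  · rw [posIdx_cons_of_ne hj]; exact hw j hj

/-- A later record at the same clock time shadows the earlier one. Reflection does not change the
clamped index, so after clamping the shadowing is invisible. -/
theorem clampIdx_posIdx_cons_cons {N t : ℕ} {i i' : ℤ} (h : clampIdx N i' = clampIdx N i)
    (w : List State) :
    (fun j => clampIdx N (posIdx ((t, i') :: (t, i) :: w) j))
      = fun j => clampIdx N (posIdx ((t, i) :: w) j) := by
  ext j
  by_cases hj : t = j
  · subst hj; rw [posIdx_cons_self, posIdx_cons_self, h]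
  · rw [posIdx_cons_of_ne hj]

theorem clampIdx_posIdx_cons (N t : ℕ) (i : ℤ) (w : List State) :
    (fun j => clampIdx N (posIdx ((t, i) :: w) j))
      = Function.update (fun j => clampIdx N (posIdx w j)) t (clampIdx N i) := by
  ext j
  by_cases hj : t = j
  · subst hj; rw [posIdx_cons_self, Function.update_self]
  · rw [posIdx_cons_of_ne hj, Function.update_of_ne (Ne.symm hj)]

/-- Under a feedback control the recorded positions form a reflected walk. -/
theorem run_map_posIdx (hT : 0 ≤ T) {h : ℝ} (ν : ProbabilityMeasure (PathSpace T D.L))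
    (β : State → ℝ) (s₀ : State) (n t : ℕ) (i : ℤ) (w : List State)
    (ht : t ≤ D.numTime T h) (hi : D.IsGridIndex h i)
    (hn : 2 * D.numTime T h + 1 ≤ n + rank D h (t, i))
    (hw : ∀ j, t ≠ j → 0 ≤ posIdx w j ∧ posIdx w j ≤ D.numSpace h) :
    (D.run hT h ν (fun w => β (w.headD s₀)) s₀ n ((t, i) :: w)).map posIdx
      = reflectedWalk (D.numSpace h) (D.numTime T h) (fun t i => D.upProb hT h ν (t, i) (β (t, i)))
        (D.numTime T h - t) (fun j => clampIdx (D.numSpace h) (posIdx ((t, i) :: w) j)) := by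
  have hpush : ∀ (t : ℕ) (i : ℤ) (w : List State),
      (∀ j, t ≠ j → 0 ≤ posIdx w j ∧ posIdx w j ≤ D.numSpace h) →
      ∀ j, t ≠ j → 0 ≤ posIdx ((t, i) :: w) j ∧ posIdx ((t, i) :: w) j ≤ D.numSpace h :=
    fun t i w hw j hj => by rw [posIdx_cons_of_ne hj]; exact hw j hj
  induction n generalizing t i w with
  | zero =>
    obtain ⟨h0, hN⟩ := hi
    simp only [rank] at hn
    split_ifs at hn with hr
    · omega
    · have ht' : t = D.numTime T h := by omega
      subst ht'
      rw [Nat.sub_self, reflectedWalk, run, PMF.pure_map]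
      congr 1
      ext j
      have := posIdx_cons_mem (i := i) (by omega) (by omega) hw j
      exact (clampIdx_of_mem this.1 this.2).symm
  | succ n ih =>
    obtain ⟨h0, hN⟩ := hi
    by_cases h1 : i = -1
    · subst h1
      rw [run_succ_low, ih t 0 _ ht ⟨by omega, by omega⟩ ?_ (hpush t _ w hw),
        clampIdx_posIdx_cons_cons]
      · simp [clampIdx]
      · rw [rank_of_boundary (by omega)] at hn
        rw [rank_of_interior (by omega) (by omega)]
        omega
    by_cases h2 : i = (D.numSpace h : ℤ) + 1
    · subst h2
      rw [run_succ_high, ih t (D.numSpace h) _ ht ⟨by omega, by omega⟩ ?_ (hpush t _ w hw),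
        clampIdx_posIdx_cons_cons]
      · simp only [clampIdx]; omega
      · rw [rank_of_boundary (by omega)] at hn
        rw [rank_of_interior (by omega) (by omega)]
        omega
    by_cases h3 : t < D.numTime T h
    · obtain ⟨m, hm⟩ : ∃ m, D.numTime T h - t = m + 1 := ⟨D.numTime T h - t - 1, by omega⟩
      have hm' : D.numTime T h - (t + 1) = m := by omega
      have ht' : D.numTime T h - (m + 1) = t := by omega
      rw [run_succ_interior hT ν _ n w (by omega) (by omega) h3, PMF.map_bind, hm, reflectedWalk,
        ht', posIdx_cons_self, clampIdx_of_mem (by omega) (by omega)]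
      simp only [List.headD_cons]
      congr 1
      ext1 c
      rw [← clampIdx_posIdx_cons, ← hm']
      refine ih (t + 1) _ _ h3 ?_ ?_ fun j _ => posIdx_cons_mem (by omega) (by omega) hw j
      · constructor <;> cases c <;> simp <;> omega
      · rw [rank_of_interior (by omega) (by omega)] at hn
        have := two_mul_le_rank (D := D) (h := h) (t + 1) (if c then i + 1 else i - 1)
        omega
    · rw [run_succ_stopped hT ν _ n w (by omega) (by omega) h3,
        ih t i _ ht ⟨by omega, by omega⟩ ?_ (hpush t _ w hw), clampIdx_posIdx_cons_cons rfl]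
      rw [rank_of_interior (by omega) (by omega)] at hn ⊢
      omega

/-! ### The interpolation -/

/-- Abel summation rewrites the expression as a convex combination of the `x j`, the weights being
the decrements of `θ`. In the induction, the part already settled after `m` terms has total weight
`1 - θ m`. -/
theorem abs_interpolation_sum_le {x θ : ℕ → ℝ} {r : ℝ} {n : ℕ} (hx : ∀ j ≤ n, |x j| ≤ r)
    (h0 : ∀ j, 0 ≤ θ j) (h1 : ∀ j, θ j ≤ 1) (hθ : ∀ j, θ (j + 1) ≤ θ j) :
    |x 0 + ∑ j ∈ Finset.range n, (x (j + 1) - x j) * θ j| ≤ r := by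
  have key : ∀ m ≤ n, |x 0 + ∑ j ∈ Finset.range m, (x (j + 1) - x j) * θ j - θ m * x m|
      ≤ (1 - θ m) * r := by
    intro m
    induction m with
    | zero =>
      intro _
      rw [Finset.sum_range_zero, add_zero, show x 0 - θ 0 * x 0 = (1 - θ 0) * x 0 by ring, abs_mul,
        abs_of_nonneg (sub_nonneg.2 (h1 0))]
      exact mul_le_mul_of_nonneg_left (hx 0 (Nat.zero_le _)) (sub_nonneg.2 (h1 0))
    | succ m ih =>
      intro hm
      have e : x 0 + ∑ j ∈ Finset.range (m + 1), (x (j + 1) - x j) * θ j - θ (m + 1) * x (m + 1)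
          = (x 0 + ∑ j ∈ Finset.range m, (x (j + 1) - x j) * θ j - θ m * x m)
            + (θ m - θ (m + 1)) * x (m + 1) := by
        rw [Finset.sum_range_succ]; ring
      have h2 : |(θ m - θ (m + 1)) * x (m + 1)| ≤ (θ m - θ (m + 1)) * r := by
        rw [abs_mul, abs_of_nonneg (sub_nonneg.2 (hθ m))]
        exact mul_le_mul_of_nonneg_left (hx _ hm) (sub_nonneg.2 (hθ m))
      rw [e]
      refine (abs_add_le _ _).trans ((add_le_add (ih (by omega)) h2).trans_eq (by ring))
  have h2 := key n le_rfl
  have h3 : |θ n * x n| ≤ θ n * r := by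
    rw [abs_mul, abs_of_nonneg (h0 n)]
    exact mul_le_mul_of_nonneg_left (hx n le_rfl) (h0 n)
  have h4 := abs_add_le (x 0 + ∑ j ∈ Finset.range n, (x (j + 1) - x j) * θ j - θ n * x n) (θ n * x n)
  rw [sub_add_cancel] at h4
  linarith

theorem dist_interpolation_le (hL : 0 ≤ D.L) (T h : ℝ) {x x' : ℕ → ℝ} {r : ℝ}
    (hx : ∀ j ≤ D.numTime T h, |x j - x' j| ≤ r) :
    dist (D.interpolation hL T h x) (D.interpolation hL T h x') ≤ r := by
  have hr : 0 ≤ r := (abs_nonneg _).trans (hx 0 (Nat.zero_le _))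
  rw [ContinuousMap.dist_le hr]
  intro t
  rw [Subtype.dist_eq, Real.dist_eq]
  refine (Set.abs_projIcc_sub_projIcc hL).trans ?_
  refine le_trans (le_of_eq ?_) (abs_interpolation_sum_le (x := fun j => x j - x' j)
    (θ := fun j => max 0 (min 1 ((t : ℝ) / D.timeStep h - j))) (n := D.numTime T h) hx
    (fun j => le_max_left _ _) (fun j => max_le zero_le_one (min_le_left _ _)) fun j => ?_)
  · congr 1
    have : ∀ a b c d : ℝ, a + b - (c + d) = (a - c) + (b - d) := fun _ _ _ _ => by ring
    rw [this, ← Finset.sum_sub_distrib]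
    congr 1
    exact Finset.sum_congr rfl fun j _ => by ring
  · refine max_le_max le_rfl (min_le_min le_rfl ?_)
    push_cast
    linarith

/-! ### The fixed point map through reflected walks -/

/-- The interpolation reads only the last position at each clock time. Under a feedback control
these positions are Markov, which reduces `Phi` to a walk without reflection steps that can be
coupled. -/
theorem Phi_toMeasure (hT : 0 ≤ T) (h : ℝ) (ν : ProbabilityMeasure (PathSpace T D.L))
    (αhat : ℝ → ProbabilityMeasure (Set.Icc (0 : ℝ) D.L) → ℝ → ℝ → ℝ) (hL : 0 ≤ D.L) {i₀ : ℤ}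
    (hi₀ : D.IsGridIndex h i₀) :
    (D.Phi hT h ν αhat hL i₀ : Measure (PathSpace T D.L))
      = ((reflectedWalk (D.numSpace h) (D.numTime T h)
          (fun t i => D.upProb hT h ν (t, i) (D.optControl hT h ν αhat (t, i))) (D.numTime T h)
          (fun j => clampIdx (D.numSpace h) (posIdx [(0, i₀)] j))).map
        fun x => D.interpolation hL T h fun j => x j * h).toMeasure := by
  have hw : ∀ j, 0 ≠ j → 0 ≤ posIdx [] j ∧ posIdx [] j ≤ D.numSpace h := fun j _ => by
    simp [posIdx]
  have := run_map_posIdx hT ν (D.optControl hT h ν αhat) (0, i₀) (2 * D.numTime T h + 1) 0 i₀ []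
    (Nat.zero_le _) hi₀ (Nat.le_add_right _ _) hw
  rw [Nat.sub_zero] at this
  rw [← this, PMF.map_comp, ← pathLaw_eq_run]
  have h2 : (fun x : ℕ → ℤ => D.interpolation hL T h fun j => x j * h) ∘ posIdx
      = fun w => D.interpolation hL T h (position h w) := by
    ext1 w
    simp only [Function.comp_apply]
    congr 1
    ext j
    exact (position_eq h w j).symm
  rw [h2]
  rfl

theorem dist_stateSpace_le {L : ℝ} (x y : Set.Icc (0 : ℝ) L) : dist x y ≤ L := by
  rw [Subtype.dist_eq]
  exact (Real.dist_le_of_mem_Icc x.2 y.2).trans_eq (sub_zero L)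

theorem dist_pathSpace_le {L : ℝ} (hL : 0 ≤ L) (φ ψ : PathSpace T L) : dist φ ψ ≤ L :=
  (ContinuousMap.dist_le hL).2 fun _ => dist_stateSpace_le _ _

theorem W1_marginal_le (hT : 0 ≤ T) {L : ℝ} (hL : 0 ≤ L) (ν ν' : ProbabilityMeasure (PathSpace T L))
    (t : ℝ) : W1 (marginal hT ν t) (marginal hT ν' t) ≤ W1 ν ν' :=
  W1_map_le (dist_pathSpace_le hL) (φ := fun φ : PathSpace T L => φ (Set.projIcc 0 T hT t))
    (LipschitzWith.of_dist_le_mul fun φ ψ => by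
      rw [NNReal.coe_one, one_mul]; exact ContinuousMap.dist_apply_le_dist _) ν ν'

/-- The Wasserstein distance of the images of two laws, through the discrepancy of the transition
probabilities. -/
theorem W1_Phi_le (hT : 0 ≤ T) {h : ℝ} (hh : 0 ≤ h) (ν ν' : ProbabilityMeasure (PathSpace T D.L))
    (αhat : ℝ → ProbabilityMeasure (Set.Icc (0 : ℝ) D.L) → ℝ → ℝ → ℝ) (hL : 0 ≤ D.L) {i₀ : ℤ}
    (hi₀ : D.IsGridIndex h i₀) {a κ : ℕ → ℝ} (ha : ∀ t, 0 ≤ a t) (hκ : ∀ t, 0 ≤ κ t)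
    (hP : ∀ t < D.numTime T h, ∀ i i' : ℤ, 0 ≤ i → i ≤ D.numSpace h → 0 ≤ i' →
      i' ≤ D.numSpace h →
      2 * h * |(D.upProb hT h ν (t, i) (D.optControl hT h ν αhat (t, i)) : ℝ)
        - D.upProb hT h ν' (t, i') (D.optControl hT h ν' αhat (t, i'))|
      ≤ a t + κ t * (|(i : ℝ) - i'| * h)) :
    W1 (D.Phi hT h ν αhat hL i₀) (D.Phi hT h ν' αhat hL i₀)
      ≤ (∑ t ∈ Finset.range (D.numTime T h), a t)
        * Real.exp (∑ t ∈ Finset.range (D.numTime T h), κ t) := by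
  set P : ℕ → ℤ → Set.Icc (0 : ℝ) 1 := fun t i =>
    D.upProb hT h ν (t, i) (D.optControl hT h ν αhat (t, i))
  set P' : ℕ → ℤ → Set.Icc (0 : ℝ) 1 := fun t i =>
    D.upProb hT h ν' (t, i) (D.optControl hT h ν' αhat (t, i))
  set x₀ : ℕ → ℤ := fun j => clampIdx (D.numSpace h) (posIdx [(0, i₀)] j) with hx₀
  set R := reflectedWalkPair (D.numSpace h) (D.numTime T h) P P' (D.numTime T h) (x₀, x₀)
  let F : (ℕ → ℤ) → PathSpace T D.L := fun x => D.interpolation hL T h fun j => x j * h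
  refine (W1_toMeasure_map_le (dist_pathSpace_le hL) R (fun x => F x.1) (fun x => F x.2)
    ?_ ?_).trans ?_
  · rw [Phi_toMeasure hT h ν αhat hL hi₀, ← reflectedWalkPair_map_fst (P' := P') (D.numTime T h)
      (x₀, x₀), PMF.map_comp]
    rfl
  · rw [Phi_toMeasure hT h ν' αhat hL hi₀, ← reflectedWalkPair_map_snd (P := P) (D.numTime T h)
      (x₀, x₀), PMF.map_comp]
    rfl
  · have := expect_reflectedWalkPair_le hh ha hκ hP (G := fun x => dist (F x.1) (F x.2))
      (fun x r hx => dist_interpolation_le hL T h fun j hj => by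
        rw [← sub_mul, abs_mul, abs_of_nonneg hh]; exact hx j hj) le_rfl (x₀, x₀) 0
      (fun j _ => ⟨clampIdx_nonneg _ _, clampIdx_le _ _, clampIdx_nonneg _ _, clampIdx_le _ _,
        by simp⟩)
    rwa [Nat.sub_self, ← Finset.range_eq_Ico, zero_add] at this

end Data

namespace Data

/-! ### Uniform constants -/

/-- `C` bounds all constants of the data that matter for the estimates. -/
structure BoundedBy (D : Data) (αhat : ℝ → D.StateLaw → ℝ → ℝ → ℝ) (C : ℝ) : Prop where
  one_le : 1 ≤ C
  f_lip : ∀ t ∈ Set.Icc 0 D.M, ∀ η η' : D.StateLaw, ∀ x ∈ Set.Icc 0 D.L, ∀ x' ∈ Set.Icc 0 D.L,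
    ∀ u ∈ D.U, |D.f t η x u - D.f t η' x' u| ≤ C * (W1 η η' + |x - x'|)
  b_lip : ∀ t ∈ Set.Icc 0 D.M, ∀ η η' : D.StateLaw, ∀ x ∈ Set.Icc 0 D.L, ∀ x' ∈ Set.Icc 0 D.L,
    ∀ u ∈ D.U, ∀ u' ∈ D.U, |D.b t η x u - D.b t η' x' u'| ≤ C * (W1 η η' + |x - x'| + |u - u'|)
  g_lip : ∀ η η' : D.StateLaw, ∀ x ∈ Set.Icc 0 D.L, ∀ x' ∈ Set.Icc 0 D.L,
    |D.g η x - D.g η' x'| ≤ C * (W1 η η' + |x - x'|)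
  y_lip : ∀ t ∈ Set.Icc 0 D.M, ∀ t' ∈ Set.Icc 0 D.M, |D.y t - D.y t'| ≤ C * |t - t'|
  r_lip : ∀ t ∈ Set.Icc 0 D.M, ∀ t' ∈ Set.Icc 0 D.M, |D.r t - D.r t'| ≤ C * |t - t'|
  b_le : ∀ t ∈ Set.Icc 0 D.M, ∀ η : D.StateLaw, ∀ x ∈ Set.Icc 0 D.L, ∀ u ∈ D.U, |D.b t η x u| ≤ C
  f_le : ∀ t ∈ Set.Icc 0 D.M, ∀ η : D.StateLaw, ∀ x ∈ Set.Icc 0 D.L, ∀ u ∈ D.U, |D.f t η x u| ≤ C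
  y_le : ∀ t ∈ Set.Icc 0 D.M, |D.y t| ≤ C
  r_le : ∀ t ∈ Set.Icc 0 D.M, |D.r t| ≤ C
  αhat_lip : ∀ t ∈ Set.Icc 0 D.M, ∀ η η' : D.StateLaw, ∀ x ∈ Set.Icc 0 D.L,
    ∀ x' ∈ Set.Icc 0 D.L, ∀ p p' : ℝ,
      |αhat t η x p - αhat t η' x' p'| ≤ C * (W1 η η' + |x - x'| + |p - p'|)

variable {D : Data} {αhat : ℝ → D.StateLaw → ℝ → ℝ → ℝ}

theorem exists_boundedBy (hD : D.Regular) (hα : D.IsUniqueArgmin αhat)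
    (hLip : D.ArgminLipschitz αhat) : ∃ C, D.BoundedBy αhat C := by
  obtain ⟨cL, hcL, hlip⟩ := hD.lipschitz
  obtain ⟨cα, hcα, hαlip⟩ := hLip
  have h0M : (0 : ℝ) ∈ Set.Icc 0 D.M := ⟨le_rfl, hD.M_pos.le⟩
  have h0L : (0 : ℝ) ∈ Set.Icc 0 D.L := ⟨le_rfl, hD.L_pos.le⟩
  let η₀ : D.StateLaw := ⟨Measure.dirac ⟨0, h0L⟩, inferInstance⟩
  -- The control set is nonempty because it contains a minimizer.
  obtain ⟨u₀, hu₀⟩ : ∃ u, u ∈ D.U := ⟨_, (hα 0 h0M η₀ 0 h0L 0).1⟩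
  obtain ⟨A, hA⟩ := hD.U_compact.isBounded.exists_norm_le
  have hA0 : 0 ≤ A := (norm_nonneg _).trans (hA u₀ hu₀)
  have hdU : ∀ u ∈ D.U, |u - u₀| ≤ 2 * A := fun u hu => by
    have h1 := hA u hu
    have h2 := hA u₀ hu₀
    rw [Real.norm_eq_abs] at h1 h2
    linarith [abs_sub u u₀]
  -- `Q` bounds the distance of any argument to the reference point `(0, η₀, 0, u₀)`: time,
  -- Wasserstein, space and control. The Lipschitz condition thus also gives uniform bounds.
  set Q := D.M + D.L + D.L + 2 * A with hQ
  have hM := hD.M_pos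
  have hL := hD.L_pos
  have hQ0 : 0 ≤ Q := by positivity
  have hdist : ∀ t ∈ Set.Icc 0 D.M, ∀ η : D.StateLaw, ∀ x ∈ Set.Icc 0 D.L, ∀ u ∈ D.U,
      cL * (|t - 0| + W1 η η₀ + |x - 0| + |u - u₀|) ≤ cL * Q := by
    intro t ht η x hx u hu
    have h1 := W1_le_of_dist_le (dist_stateSpace_le (L := D.L)) η η₀
    have h2 := hdU u hu
    rw [sub_zero, sub_zero, abs_of_nonneg ht.1, abs_of_nonneg hx.1]
    exact mul_le_mul_of_nonneg_left (by linarith [ht.2, hx.2]) hcL.le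
  set C := 1 + cL + cα + cL * Q + |D.b 0 η₀ 0 u₀| + |D.f 0 η₀ 0 u₀| + |D.y 0| + |D.r 0| with hC
  have hcQ : 0 ≤ cL * Q := by positivity
  have n1 := abs_nonneg (D.b 0 η₀ 0 u₀)
  have n2 := abs_nonneg (D.f 0 η₀ 0 u₀)
  have n3 := abs_nonneg (D.y 0)
  have n4 := abs_nonneg (D.r 0)
  have hcLC : cL ≤ C := by linarith
  have hcαC : cα ≤ C := by linarith
  have tri : ∀ a c : ℝ, |a| ≤ |a - c| + |c| := fun a c => by
    have := abs_add_le (a - c) c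
    rwa [sub_add_cancel] at this
  have comb : ∀ {a1 a2 a3 a4 a5 X : ℝ}, |a1| + |a2| + |a3| + |a4| + |a5| ≤ X →
      |a1| ≤ X ∧ |a2| ≤ X ∧ |a3| ≤ X ∧ |a4| ≤ X ∧ |a5| ≤ X := by
    intro a1 a2 a3 a4 a5 X h
    have := abs_nonneg a1
    have := abs_nonneg a2
    have := abs_nonneg a3
    have := abs_nonneg a4
    have := abs_nonneg a5
    refine ⟨?_, ?_, ?_, ?_, ?_⟩ <;> linarith
  have all := fun t ht t' ht' η η' x hx x' hx' u hu u' hu' =>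
    comb (hlip t ht t' ht' η η' x hx x' hx' u hu u' hu')
  refine ⟨C, ⟨by linarith, ?_, ?_, ?_, ?_, ?_, ?_, ?_, ?_, ?_, ?_⟩⟩
  · intro t ht η η' x hx x' hx' u hu
    have h1 := (all t ht t ht η η' x hx x' hx' u hu u hu).1
    rw [sub_self, sub_self, abs_zero, zero_add, add_zero] at h1
    exact h1.trans (mul_le_mul_of_nonneg_right hcLC (add_nonneg (W1_nonneg _ _) (abs_nonneg _)))
  · intro t ht η η' x hx x' hx' u hu u' hu'
    have h1 := (all t ht t ht η η' x hx x' hx' u hu u' hu').2.2.1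
    rw [sub_self, abs_zero, zero_add] at h1
    exact h1.trans (mul_le_mul_of_nonneg_right hcLC
      (add_nonneg (add_nonneg (W1_nonneg _ _) (abs_nonneg _)) (abs_nonneg _)))
  · intro η η' x hx x' hx'
    have h1 := (all 0 h0M 0 h0M η η' x hx x' hx' u₀ hu₀ u₀ hu₀).2.1
    rw [sub_self, sub_self, abs_zero, zero_add, add_zero] at h1
    exact h1.trans (mul_le_mul_of_nonneg_right hcLC (add_nonneg (W1_nonneg _ _) (abs_nonneg _)))
  · intro t ht t' ht'
    have h1 := (all t ht t' ht' η₀ η₀ 0 h0L 0 h0L u₀ hu₀ u₀ hu₀).2.2.2.1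
    rw [W1_self, sub_self, sub_self, abs_zero, add_zero, add_zero, add_zero] at h1
    exact h1.trans (mul_le_mul_of_nonneg_right hcLC (abs_nonneg _))
  · intro t ht t' ht'
    have h1 := (all t ht t' ht' η₀ η₀ 0 h0L 0 h0L u₀ hu₀ u₀ hu₀).2.2.2.2
    rw [W1_self, sub_self, sub_self, abs_zero, add_zero, add_zero, add_zero] at h1
    exact h1.trans (mul_le_mul_of_nonneg_right hcLC (abs_nonneg _))
  · intro t ht η x hx u hu
    have h1 := (all t ht 0 h0M η η₀ x hx 0 h0L u hu u₀ hu₀).2.2.1.trans (hdist t ht η x hx u hu)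
    linarith [tri (D.b t η x u) (D.b 0 η₀ 0 u₀)]
  · intro t ht η x hx u hu
    have h1 := (all t ht 0 h0M η η₀ x hx 0 h0L u hu u₀ hu₀).1.trans (hdist t ht η x hx u hu)
    linarith [tri (D.f t η x u) (D.f 0 η₀ 0 u₀)]
  · intro t ht
    have h1 := (all t ht 0 h0M η₀ η₀ 0 h0L 0 h0L u₀ hu₀ u₀ hu₀).2.2.2.1.trans
      (hdist t ht η₀ 0 h0L u₀ hu₀)
    linarith [tri (D.y t) (D.y 0)]
  · intro t ht
    have h1 := (all t ht 0 h0M η₀ η₀ 0 h0L 0 h0L u₀ hu₀ u₀ hu₀).2.2.2.2.trans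
      (hdist t ht η₀ 0 h0L u₀ hu₀)
    linarith [tri (D.r t) (D.r 0)]
  · intro t ht η η' x hx x' hx' p p'
    exact (hαlip t ht η η' x hx x' hx' p p').trans (mul_le_mul_of_nonneg_right hcαC
      (add_nonneg (add_nonneg (W1_nonneg _ _) (abs_nonneg _)) (abs_nonneg _)))

namespace BoundedBy

variable {C : ℝ}

theorem abs_hamiltonian_le (hC : D.BoundedBy αhat C) (hα : D.IsUniqueArgmin αhat) {t : ℝ}
    (ht : t ∈ Set.Icc 0 D.M) (η : D.StateLaw) {x : ℝ} (hx : x ∈ Set.Icc 0 D.L) (p : ℝ) :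
    |D.hamiltonian αhat t η x p| ≤ C * (1 + |p|) := by
  have hu := (hα t ht η x hx p).1
  refine (abs_add_le _ _).trans ?_
  rw [abs_mul]
  have h1 := hC.f_le t ht η x hx _ hu
  have h2 := mul_le_mul_of_nonneg_right (hC.b_le t ht η x hx _ hu) (abs_nonneg p)
  linarith

/-- A minimum of Lipschitz functions is Lipschitz: each side is tested with the minimizer of the
other, so the regularity of `αhat` plays no role. The sup bound of `b` multiplies `|p - p'|`, and
`K` enters where the difference of drifts multiplies `p`. -/
theorem abs_hamiltonian_sub_le (hC : D.BoundedBy αhat C) (hα : D.IsUniqueArgmin αhat) {t : ℝ}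
    (ht : t ∈ Set.Icc 0 D.M) (η η' : D.StateLaw) {x x' : ℝ} (hx : x ∈ Set.Icc 0 D.L)
    (hx' : x' ∈ Set.Icc 0 D.L) {p p' K : ℝ} (hp : |p| ≤ K) (hp' : |p'| ≤ K) {w : ℝ}
    (hw : W1 η η' ≤ w) (hw' : W1 η' η ≤ w) :
    |D.hamiltonian αhat t η x p - D.hamiltonian αhat t η' x' p'|
      ≤ C * (w + |x - x'|) * (1 + K) + C * |p - p'| := by
  have hC0 : 0 ≤ C := zero_le_one.trans hC.one_le
  have key : ∀ (η η' : D.StateLaw) {x x' : ℝ}, x ∈ Set.Icc 0 D.L → x' ∈ Set.Icc 0 D.L →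
      ∀ {p p' : ℝ}, |p| ≤ K → W1 η η' ≤ w →
      D.hamiltonian αhat t η x p - D.hamiltonian αhat t η' x' p'
        ≤ C * (w + |x - x'|) * (1 + K) + C * |p - p'| := by
    intro η η' x x' hx hx' p p' hp hw
    have hu := (hα t ht η' x' hx' p').1
    have h0 := hα.hamiltonian_le ht η hx p hu
    set u := αhat t η' x' p' with hudef
    have h1 := (le_abs_self _).trans (hC.f_lip t ht η η' x hx x' hx' u hu)
    have h2 := hC.b_lip t ht η η' x hx x' hx' u hu u hu
    rw [sub_self, abs_zero, add_zero] at h2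
    have hd : C * (W1 η η' + |x - x'|) ≤ C * (w + |x - x'|) :=
      mul_le_mul_of_nonneg_left (by linarith) hC0
    have hd0 : 0 ≤ C * (W1 η η' + |x - x'|) :=
      mul_nonneg hC0 (add_nonneg (W1_nonneg _ _) (abs_nonneg _))
    have h3 : (D.b t η x u - D.b t η' x' u) * p ≤ C * (w + |x - x'|) * K := by
      refine (le_abs_self _).trans ?_
      rw [abs_mul]
      exact mul_le_mul (h2.trans hd) hp (abs_nonneg _) (hd0.trans hd)
    have h4 : D.b t η' x' u * (p - p') ≤ C * |p - p'| := by
      refine (le_abs_self _).trans ?_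
      rw [abs_mul]
      exact mul_le_mul_of_nonneg_right (hC.b_le t ht η' x' hx' u hu) (abs_nonneg _)
    have h5 : D.hamiltonian αhat t η' x' p' = D.f t η' x' u + D.b t η' x' u * p' := rfl
    rw [h5]
    linarith
  rw [abs_le]
  have h1 := key η η' hx hx' hp hw (p' := p')
  have h2 := key η' η hx' hx hp' hw' (p' := p)
  rw [abs_sub_comm x' x, abs_sub_comm p' p] at h2
  constructor <;> linarith

end BoundedBy

end Data

/-! ### The boundary corrector -/

/-- The quadratic grid function with increments `-y h` and `r h` at the two ends of the grid. -/
def corrector (N : ℕ) (h y r : ℝ) (i : ℤ) : ℝ :=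
  h * (-y * i + (r + y) * (i * (i + 1)) / (2 * (N + 1)))

section Corrector

variable {N : ℕ} {h y r : ℝ}

/-- The corrector has the increments that the boundary costs prescribe, so once it is subtracted the
extension is by constants, that is, by projection onto the grid. -/
theorem extendBdry_eq_add_corrector (F : ℤ → ℝ) {i : ℤ} (h0 : -1 ≤ i) (hN : i ≤ N + 1) :
    extendBdry N h y r F i
      = (F (clampIdx N i) - corrector N h y r (clampIdx N i)) + corrector N h y r i := by
  unfold extendBdry
  have hN1 : (N : ℝ) + 1 ≠ 0 := by positivity
  split_ifs with h1 h2
  · subst h1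
    rw [show clampIdx N (-1) = 0 by simp only [clampIdx]; omega]
    simp only [corrector]
    push_cast
    ring
  · subst h2
    rw [show clampIdx N (N + 1) = N by simp only [clampIdx]; omega]
    simp only [corrector]
    push_cast
    field_simp
    ring
  · rw [clampIdx_of_mem (by omega) (by omega)]
    ring

/-- The price of the corrector is a constant source. As `1 / (N + 1)` is of order `h`, it is of
order `h²`, like the time step. -/
theorem corrector_second_diff (i : ℤ) :
    (corrector N h y r (i + 1) + corrector N h y r (i - 1)) / 2 - corrector N h y r i
      = h * (r + y) / (2 * (N + 1)) := by
  have hN1 : (N : ℝ) + 1 ≠ 0 := by positivity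
  simp only [corrector]
  push_cast
  field_simp
  ring

theorem corrector_fdiff (i : ℤ) :
    corrector N h y r (i + 1) - corrector N h y r i
      = h * (-y + (r + y) * ((i + 1) / (N + 1))) := by
  have hN1 : (N : ℝ) + 1 ≠ 0 := by positivity
  simp only [corrector]
  push_cast
  field_simp
  ring

theorem corrector_cdiff (i : ℤ) :
    corrector N h y r (i + 1) - corrector N h y r (i - 1)
      = 2 * h * (-y + (r + y) * ((2 * i + 1) / (2 * (N + 1)))) := by
  have hN1 : (N : ℝ) + 1 ≠ 0 := by positivity
  simp only [corrector]
  push_cast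
  field_simp
  ring

theorem abs_boundary_interpolation_le {A τ : ℝ} (hy : |y| ≤ A) (hr : |r| ≤ A) (h0 : 0 ≤ τ)
    (h1 : τ ≤ 1) : |-y + (r + y) * τ| ≤ 3 * A := by
  have h2 : |(r + y) * τ| ≤ 2 * A := by
    rw [abs_mul, abs_of_nonneg h0]
    have := abs_add_le r y
    have := abs_nonneg (r + y)
    nlinarith
  have h3 := abs_add_le (-y) ((r + y) * τ)
  rw [abs_neg] at h3
  linarith

theorem corrector_sub_corrector (y' r' : ℝ) (i : ℤ) :
    corrector N h y r i - corrector N h y' r' i = corrector N h (y - y') (r - r') i := by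
  simp only [corrector]
  ring

theorem abs_corrector_le {A : ℝ} (hh : 0 ≤ h) (hy : |y| ≤ A) (hr : |r| ≤ A) {i : ℤ}
    (h0 : 0 ≤ i) (hN : i ≤ N) : |corrector N h y r i| ≤ 2 * A * (N * h) := by
  have hN1 : (0 : ℝ) < N + 1 := by positivity
  have h0' : (0 : ℝ) ≤ i := by exact_mod_cast h0
  have hN' : (i : ℝ) ≤ N := by exact_mod_cast hN
  have hA : 0 ≤ A := (abs_nonneg y).trans hy
  have e : corrector N h y r i = (h * i) * (-y + (r + y) * ((i + 1) / (2 * (N + 1)))) := by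
    simp only [corrector]
    field_simp
  have hτ0 : 0 ≤ ((i : ℝ) + 1) / (2 * (N + 1)) := by positivity
  have hτ : ((i : ℝ) + 1) / (2 * (N + 1)) ≤ 1 / 2 := by
    rw [div_le_div_iff₀ (by positivity) (by positivity)]
    linarith
  have h2 : |-y + (r + y) * (((i : ℝ) + 1) / (2 * (N + 1)))| ≤ 2 * A := by
    have h3 : |(r + y) * (((i : ℝ) + 1) / (2 * (N + 1)))| ≤ (2 * A) * (1 / 2) := by
      rw [abs_mul, abs_of_nonneg hτ0]
      exact mul_le_mul ((abs_add_le r y).trans (by linarith)) hτ hτ0 (by linarith)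
    have h4 := abs_add_le (-y) ((r + y) * (((i : ℝ) + 1) / (2 * (N + 1))))
    rw [abs_neg] at h4
    linarith
  rw [e, abs_mul, abs_of_nonneg (by positivity)]
  calc h * i * _ ≤ (N * h) * (2 * A) :=
        mul_le_mul (by nlinarith) h2 (abs_nonneg _) (by positivity)
    _ = _ := by ring

end Corrector

/-- The least nonnegative bound, which is zero on the empty set. Its minimality turns pointwise
estimates into inequalities for the bound itself, which can then be absorbed. -/
theorem exists_sup_abs (S : Finset ℤ) (F : ℤ → ℝ) : ∃ d : ℝ, 0 ≤ d ∧ (∀ i ∈ S, |F i| ≤ d) ∧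
    ∀ B : ℝ, 0 ≤ B → (∀ i ∈ S, |F i| ≤ B) → d ≤ B := by
  refine ⟨(S.sup fun i => ‖F i‖₊ : NNReal), NNReal.coe_nonneg _, fun i hi => ?_, fun B hB h => ?_⟩
  · exact NNReal.coe_le_coe.2 (Finset.le_sup (f := fun i => ‖F i‖₊) hi)
  · lift B to NNReal using hB
    exact NNReal.coe_le_coe.2 (Finset.sup_le fun i hi => NNReal.coe_le_coe.1 (h i hi))

namespace Data

variable {D : Data} {αhat : ℝ → D.StateLaw → ℝ → ℝ → ℝ} {C T h : ℝ}

/-! ### The value function without its boundary increments -/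

/-- The value function minus the boundary corrector. -/
def reducedValue (D : Data) {T : ℝ} (hT : 0 ≤ T) (h : ℝ) (ν : ProbabilityMeasure (PathSpace T D.L))
    (j : ℕ) (i : ℤ) : ℝ :=
  D.value hT h ν j i
    - corrector (D.numSpace h) h (D.y (j * D.timeStep h)) (D.r (j * D.timeStep h)) i

/-- The part of the source of the reduced value function that comes from the corrector. -/
def correctorSource (D : Data) (h : ℝ) (j : ℕ) (i : ℤ) : ℝ :=
  h * (D.r ((j + 1 : ℕ) * D.timeStep h) + D.y ((j + 1 : ℕ) * D.timeStep h))
      / (2 * (D.numSpace h + 1))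
    + corrector (D.numSpace h) h (D.y ((j + 1 : ℕ) * D.timeStep h) - D.y (j * D.timeStep h))
      (D.r ((j + 1 : ℕ) * D.timeStep h) - D.r (j * D.timeStep h)) i

/-- The Hamiltonian along the value function. -/
def valueHamiltonian (D : Data) (αhat : ℝ → D.StateLaw → ℝ → ℝ → ℝ) {T : ℝ} (hT : 0 ≤ T) (h : ℝ)
    (ν : ProbabilityMeasure (PathSpace T D.L)) (j : ℕ) (i : ℤ) : ℝ :=
  D.hamiltonian αhat (j * D.timeStep h) (marginal hT ν (j * D.timeStep h)) (i * h)
    (D.diffValue hT h ν j i)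

theorem extValue_eq_reducedValue (hT : 0 ≤ T) (ν : ProbabilityMeasure (PathSpace T D.L)) (j : ℕ)
    {i : ℤ} (h0 : -1 ≤ i) (hN : i ≤ D.numSpace h + 1) :
    D.extValue hT h ν j i = D.reducedValue hT h ν j (clampIdx (D.numSpace h) i)
      + corrector (D.numSpace h) h (D.y (j * D.timeStep h)) (D.r (j * D.timeStep h)) i :=
  extendBdry_eq_add_corrector _ h0 hN

/-- Besides the Hamiltonian, the source collects the curvature of the corrector and its change in
time, the latter coming from the time dependence of the boundary costs. -/
theorem isReflectedHeat_reducedValue (hD : D.Regular) (hα : D.IsUniqueArgmin αhat) (hT : 0 ≤ T)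
    (hTM : T ≤ D.M) (hm : D.AdmissibleMesh T h) (ν : ProbabilityMeasure (PathSpace T D.L)) :
    IsReflectedHeat (D.numSpace h) (D.numTime T h) (D.reducedValue hT h ν) fun j i =>
      D.timeStep h * D.valueHamiltonian αhat hT h ν j i + D.correctorSource h j i := by
  intro j hj i h0 hN
  beta_reduce
  rw [reducedValue, value_step hD hm hTM hα hj h0 hN,
    extValue_eq_reducedValue hT ν (j + 1) (by omega) (by omega),
    extValue_eq_reducedValue hT ν (j + 1) (by omega) (by omega), correctorSource,
    ← corrector_second_diff i, ← corrector_sub_corrector, valueHamiltonian]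
  ring

/-- The boundary costs do not depend on the measure, so the correctors cancel in the difference. -/
theorem isReflectedHeat_value_sub (hD : D.Regular) (hα : D.IsUniqueArgmin αhat) (hT : 0 ≤ T)
    (hTM : T ≤ D.M) (hm : D.AdmissibleMesh T h) (ν ν' : ProbabilityMeasure (PathSpace T D.L)) :
    IsReflectedHeat (D.numSpace h) (D.numTime T h)
      (fun j i => D.value hT h ν j i - D.value hT h ν' j i) fun j i =>
      D.timeStep h * (D.valueHamiltonian αhat hT h ν j i - D.valueHamiltonian αhat hT h ν' j i) := by
  intro j hj i h0 hN
  simp only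
  rw [value_step hD hm hTM hα hj h0 hN, value_step hD hm hTM hα hj h0 hN,
    extValue_eq_reducedValue hT ν (j + 1) (by omega) (by omega),
    extValue_eq_reducedValue hT ν (j + 1) (by omega) (by omega),
    extValue_eq_reducedValue hT ν' (j + 1) (by omega) (by omega),
    extValue_eq_reducedValue hT ν' (j + 1) (by omega) (by omega)]
  simp only [reducedValue, valueHamiltonian]
  ring

theorem two_mul_diffValue (hh : 0 < h) (hT : 0 ≤ T) (ν : ProbabilityMeasure (PathSpace T D.L))
    (j : ℕ) {i : ℤ} (h0 : 0 ≤ i) (hN : i ≤ D.numSpace h) :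
    2 * h * D.diffValue hT h ν j i
      = (D.reducedValue hT h ν (j + 1) (clampIdx (D.numSpace h) (i + 1))
          - D.reducedValue hT h ν (j + 1) (clampIdx (D.numSpace h) (i - 1)))
        + 2 * h * (-D.y ((j + 1 : ℕ) * D.timeStep h)
          + (D.r ((j + 1 : ℕ) * D.timeStep h) + D.y ((j + 1 : ℕ) * D.timeStep h))
            * ((2 * i + 1) / (2 * (D.numSpace h + 1)))) := by
  rw [diffValue, mul_div_cancel₀ _ (by positivity : 2 * h ≠ 0),
    extValue_eq_reducedValue hT ν (j + 1) (by omega) (by omega),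
    extValue_eq_reducedValue hT ν (j + 1) (by omega) (by omega), ← corrector_cdiff]
  ring

theorem two_mul_diffValue_sub (hh : 0 < h) (hT : 0 ≤ T)
    (ν ν' : ProbabilityMeasure (PathSpace T D.L)) (j : ℕ) {i : ℤ} (h0 : 0 ≤ i)
    (hN : i ≤ D.numSpace h) :
    2 * h * (D.diffValue hT h ν j i - D.diffValue hT h ν' j i)
      = (D.value hT h ν (j + 1) (clampIdx (D.numSpace h) (i + 1))
          - D.value hT h ν' (j + 1) (clampIdx (D.numSpace h) (i + 1)))
        - (D.value hT h ν (j + 1) (clampIdx (D.numSpace h) (i - 1))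
          - D.value hT h ν' (j + 1) (clampIdx (D.numSpace h) (i - 1))) := by
  rw [mul_sub, two_mul_diffValue hh hT ν j h0 hN, two_mul_diffValue hh hT ν' j h0 hN]
  simp only [reducedValue]
  ring

namespace AdmissibleMesh

theorem sq_eq (hD : D.Regular) (_hm : D.AdmissibleMesh T h) :
    h ^ 2 = D.σ ^ 2 * D.timeStep h := by
  have := hD.σ_pos
  rw [timeStep]
  field_simp

/-- The parabolic scaling that makes the method work: sources of size `Δ`, summed against the
weights `1 / √(k + 1)`, give `h √T`. The factor `h` cancels the difference quotient and `√T` is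
small. -/
theorem timeStep_mul_sqrt (hD : D.Regular) (hm : D.AdmissibleMesh T h) :
    D.timeStep h * √(D.numTime T h) = h * (√T / D.σ) := by
  have hσ := hD.σ_pos
  have hh := hm.h_pos
  have hΔ := hD.timeStep_pos hh
  have h1 : √T = √(D.numTime T h) * √(D.timeStep h) := by
    rw [← Real.sqrt_mul (Nat.cast_nonneg _), hm.numTime_mul hD]
  have h2 : √(D.timeStep h) = h / D.σ := by
    rw [timeStep, ← div_pow, Real.sqrt_sq (by positivity)]
  have h3 : D.timeStep h = (h / D.σ) ^ 2 := by rw [timeStep, div_pow]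
  rw [h1, h2, h3]
  field_simp

theorem inv_le (hm : D.AdmissibleMesh T h) (hL : 0 < D.L) :
    1 / ((D.numSpace h : ℝ) + 1) ≤ h / D.L := by
  have hh := hm.h_pos
  rw [div_le_div_iff₀ (by positivity) hL]
  linarith [hm.numSpace_mul]

theorem time_mem_of_le (hD : D.Regular) (hm : D.AdmissibleMesh T h) (hTM : T ≤ D.M) {j : ℕ}
    (hj : j ≤ D.numTime T h) : (j : ℝ) * D.timeStep h ∈ Set.Icc 0 D.M :=
  Set.Icc_subset_Icc_right hTM (hm.time_mem hD hj)

end AdmissibleMesh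

/-! ### Source bounds and the uniform gradient bound. -/

section Estimates

variable (hD : D.Regular) (hα : D.IsUniqueArgmin αhat) (hC : D.BoundedBy αhat C)
  (hTM : T ≤ D.M) (hm : D.AdmissibleMesh T h)

include hD hC hTM hm

theorem abs_boundary_time_diff_le {j : ℕ} (hj : j < D.numTime T h) :
    |D.y ((j + 1 : ℕ) * D.timeStep h) - D.y (j * D.timeStep h)| ≤ C * D.timeStep h ∧
      |D.r ((j + 1 : ℕ) * D.timeStep h) - D.r (j * D.timeStep h)| ≤ C * D.timeStep h := by
  have hΔ := hD.timeStep_pos hm.h_pos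
  have e : |((j + 1 : ℕ) : ℝ) * D.timeStep h - j * D.timeStep h| = D.timeStep h := by
    rw [← sub_mul]
    push_cast
    rw [add_sub_cancel_left, one_mul, abs_of_pos hΔ]
  have h1 := hC.y_lip _ (hm.time_mem_of_le hD hTM (j := j + 1) hj) _
    (hm.time_mem_of_le hD hTM hj.le)
  have h2 := hC.r_lip _ (hm.time_mem_of_le hD hTM (j := j + 1) hj) _
    (hm.time_mem_of_le hD hTM hj.le)
  rw [e] at h1 h2
  exact ⟨h1, h2⟩

/-- The curvature part is at most `C h² / L` with `h² = σ² Δ`; the time increment of the corrector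
is of order `Δ` because the boundary costs are Lipschitz in time. -/
theorem abs_correctorSource_le {j : ℕ} (hj : j < D.numTime T h) {i : ℤ} (h0 : 0 ≤ i)
    (hN : i ≤ D.numSpace h) :
    |D.correctorSource h j i| ≤ D.timeStep h * (C * (D.σ ^ 2 / D.L + 2 * D.L)) := by
  have hC0 : 0 ≤ C := zero_le_one.trans hC.one_le
  have hL := hD.L_pos
  have hh := hm.h_pos
  have htm := hm.time_mem_of_le hD hTM (j := j + 1) hj
  obtain ⟨k1, k2⟩ := abs_boundary_time_diff_le hD hC hTM hm hj
  have h1 := abs_corrector_le (N := D.numSpace h) hh.le k1 k2 h0 hN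
  rw [hm.numSpace_mul] at h1
  have h2 : |h * (D.r ((j + 1 : ℕ) * D.timeStep h) + D.y ((j + 1 : ℕ) * D.timeStep h))
      / (2 * (D.numSpace h + 1))| ≤ h * C * (h / D.L) := by
    have e : h * (D.r ((j + 1 : ℕ) * D.timeStep h) + D.y ((j + 1 : ℕ) * D.timeStep h))
        / (2 * (D.numSpace h + 1))
        = (h * ((D.r ((j + 1 : ℕ) * D.timeStep h) + D.y ((j + 1 : ℕ) * D.timeStep h)) / 2))
          * (1 / ((D.numSpace h : ℝ) + 1)) := by
      field_simp
    rw [e, abs_mul, abs_mul, abs_of_pos hh, abs_of_pos (by positivity : (0 : ℝ)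
      < 1 / ((D.numSpace h : ℝ) + 1)), abs_div, abs_two]
    refine mul_le_mul (mul_le_mul_of_nonneg_left ?_ hh.le) (hm.inv_le hL) (by positivity)
      (by positivity)
    have := abs_add_le (D.r ((j + 1 : ℕ) * D.timeStep h)) (D.y ((j + 1 : ℕ) * D.timeStep h))
    have := hC.r_le _ htm
    have := hC.y_le _ htm
    linarith
  have h3 : h * C * (h / D.L) = D.timeStep h * (C * (D.σ ^ 2 / D.L)) := by
    have := hm.sq_eq hD
    have e : h * C * (h / D.L) = C * h ^ 2 / D.L := by ring
    rw [e, this]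
    ring
  refine (abs_add_le _ _).trans ?_
  linarith

theorem abs_correctorSource_fdiff_le {j : ℕ} (hj : j < D.numTime T h) {i : ℤ} (h0 : 0 ≤ i)
    (hN : i < D.numSpace h) :
    |D.correctorSource h j (i + 1) - D.correctorSource h j i|
      ≤ D.timeStep h * h * (3 * C) := by
  have hh := hm.h_pos
  obtain ⟨k1, k2⟩ := abs_boundary_time_diff_le hD hC hTM hm hj
  have h0' : (0 : ℝ) ≤ i := by exact_mod_cast h0
  have hN' : (i : ℝ) ≤ D.numSpace h := by exact_mod_cast hN.le
  rw [correctorSource, correctorSource, add_sub_add_left_eq_sub, corrector_fdiff, abs_mul,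
    abs_of_pos hh]
  have := abs_boundary_interpolation_le k1 k2
    (τ := ((i : ℝ) + 1) / (D.numSpace h + 1)) (by positivity)
    (by rw [div_le_one (by positivity)]; linarith)
  nlinarith

theorem abs_boundary_slope_le {j : ℕ} (hj : j ≤ D.numTime T h) {τ : ℝ} (h0 : 0 ≤ τ)
    (h1 : τ ≤ 1) :
    |-D.y (j * D.timeStep h) + (D.r (j * D.timeStep h) + D.y (j * D.timeStep h)) * τ|
      ≤ 3 * C :=
  abs_boundary_interpolation_le (hC.y_le _ (hm.time_mem_of_le hD hTM hj))
    (hC.r_le _ (hm.time_mem_of_le hD hTM hj)) h0 h1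

variable (hT : 0 ≤ T) (ν ν' : ProbabilityMeasure (PathSpace T D.L))

include hα

theorem abs_reducedValue_terminal_fdiff_le {i : ℤ} (h0 : 0 ≤ i) (hN : i < D.numSpace h) :
    |D.reducedValue hT h ν (D.numTime T h) (i + 1) - D.reducedValue hT h ν (D.numTime T h) i|
      ≤ 4 * C * h := by
  have hh := hm.h_pos
  have h0' : (0 : ℝ) ≤ i := by exact_mod_cast h0
  have hN' : (i : ℝ) ≤ D.numSpace h := by exact_mod_cast hN.le
  have h1 := hC.g_lip (marginal hT ν T) (marginal hT ν T) _
    (hm.space_mem (i := i + 1) (by omega) (by omega)) _ (hm.space_mem h0 hN.le)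
  rw [W1_self, ← sub_mul, zero_add] at h1
  push_cast at h1
  rw [add_sub_cancel_left, one_mul, abs_of_pos hh] at h1
  have h2 := abs_boundary_slope_le hD hC hTM hm (le_refl (D.numTime T h))
    (τ := ((i : ℝ) + 1) / (D.numSpace h + 1)) (by positivity)
    (by rw [div_le_one (by positivity)]; linarith)
  rw [reducedValue, reducedValue, value_terminal hD hm hTM hα (by omega) (by omega),
    value_terminal hD hm hTM hα h0 hN.le, sub_sub_sub_comm, corrector_fdiff]
  refine (abs_sub _ _).trans ?_
  rw [abs_mul, abs_of_pos hh]
  push_cast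
  have := mul_le_mul_of_nonneg_left h2 hh.le
  linarith

/-- The gradient bound, uniform in the mesh, for short horizons. -/
theorem abs_diffValue_le (hθ : 2 * (√T / D.σ) * C ≤ 1 / 2) {j : ℕ} (hj : j < D.numTime T h)
    {i : ℤ} (h0 : 0 ≤ i) (hN : i ≤ D.numSpace h) :
    |D.diffValue hT h ν j i| ≤ 14 * C + (1 + D.σ ^ 2 / D.L + 2 * D.L) := by
  have hC0 : 0 ≤ C := zero_le_one.trans hC.one_le
  have hh := hm.h_pos
  have hL := hD.L_pos
  have hΔ := hD.timeStep_pos hh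
  set C' := 1 + D.σ ^ 2 / D.L + 2 * D.L with hC'
  have hC'0 : 0 ≤ C' := by positivity
  choose d hd0 hd hdle using fun j =>
    exists_sup_abs (Finset.Icc 0 (D.numSpace h : ℤ)) (D.diffValue hT h ν j)
  -- `m` is the largest gradient over all times and sites. It is finite because the grid is; what
  -- has to be shown is a bound independent of the mesh.
  obtain ⟨m, hm0, hmd, hmle⟩ := exists_sup_abs (Finset.Ico 0 (D.numTime T h : ℤ))
    fun j => d j.toNat
  have hdm : ∀ j < D.numTime T h, d j ≤ m := fun j hj => by
    have := hmd (j : ℤ) (by simp [hj])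
    rwa [Int.toNat_natCast, abs_of_nonneg (hd0 j)] at this
  have hsource : ∀ j < D.numTime T h, ∀ i : ℤ, 0 ≤ i → i ≤ D.numSpace h →
      |D.timeStep h * D.valueHamiltonian αhat hT h ν j i + D.correctorSource h j i|
        ≤ D.timeStep h * (C * (C' + m)) := by
    intro j hj i h0 hN
    have h1 := hC.abs_hamiltonian_le hα (hm.time_mem_of_le hD hTM hj.le)
      (marginal hT ν (j * D.timeStep h)) (hm.space_mem h0 hN) (D.diffValue hT h ν j i)
    have h2 : |D.diffValue hT h ν j i| ≤ m :=
      (hd j i (Finset.mem_Icc.2 ⟨h0, hN⟩)).trans (hdm j hj)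
    have h3 := abs_correctorSource_le hD hC hTM hm hj h0 hN
    have h4 : |D.timeStep h * D.valueHamiltonian αhat hT h ν j i| ≤ D.timeStep h * (C * (1 + m)) := by
      rw [abs_mul, abs_of_pos hΔ]
      exact mul_le_mul_of_nonneg_left (h1.trans (mul_le_mul_of_nonneg_left (by linarith) hC0)) hΔ.le
    refine (abs_add_le _ _).trans ((add_le_add h4 h3).trans_eq ?_)
    rw [hC']
    ring
  -- Here `7 C` is `4 C` from the terminal slope of the reduced value plus `3 C` from the slope of
  -- the corrector. By `hθ` the sources contribute at most half of `C' + m`, so `m` can be absorbed.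
  have hest : ∀ j < D.numTime T h, ∀ i : ℤ, 0 ≤ i → i ≤ D.numSpace h →
      |D.diffValue hT h ν j i| ≤ 7 * C + (C' + m) / 2 := by
    intro j hj i h0 hN
    have h0' : (0 : ℝ) ≤ i := by exact_mod_cast h0
    have hN' : (i : ℝ) ≤ D.numSpace h := by exact_mod_cast hN
    have h1 := (isReflectedHeat_reducedValue hD hα hT hTM hm ν).abs_cdiff_le_of_lipschitz
      hsource (by positivity)
      (fun i h0 hN => abs_reducedValue_terminal_fdiff_le hD hα hC hTM hm hT ν h0 hN) hj h0 hN
    have h2 := abs_boundary_slope_le hD hC hTM hm (j := j + 1) hj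
      (τ := (2 * (i : ℝ) + 1) / (2 * (D.numSpace h + 1))) (by positivity)
      (by rw [div_le_one (by positivity)]; linarith)
    have h3 : ∑ k ∈ Finset.range (D.numTime T h - j - 1),
        2 * (D.timeStep h * (C * (C' + m))) / √((k : ℝ) + 1) ≤ h * (C' + m) := by
      calc _ = 2 * (D.timeStep h * (C * (C' + m)))
            * ∑ k ∈ Finset.range (D.numTime T h - j - 1), 1 / √((k : ℝ) + 1) := by
              rw [Finset.mul_sum]
              exact Finset.sum_congr rfl fun _ _ => by ring
        _ ≤ 2 * (D.timeStep h * (C * (C' + m))) * (2 * √(D.numTime T h)) := by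
              refine mul_le_mul_of_nonneg_left ((sum_inv_sqrt_le _).trans ?_) (by positivity)
              exact mul_le_mul_of_nonneg_left (Real.sqrt_le_sqrt (by exact_mod_cast (by omega)))
                zero_le_two
        _ = 4 * (C * (C' + m)) * (D.timeStep h * √(D.numTime T h)) := by ring
        _ = (2 * (√T / D.σ) * C) * (2 * (h * (C' + m))) := by
              rw [hm.timeStep_mul_sqrt hD]; ring
        _ ≤ 1 / 2 * (2 * (h * (C' + m))) := mul_le_mul_of_nonneg_right hθ (by positivity)
        _ = _ := by ring
    have h4 : |2 * h * D.diffValue hT h ν j i| ≤ 2 * (4 * C * h) + h * (C' + m)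
        + 2 * h * (3 * C) := by
      rw [two_mul_diffValue hh hT ν j h0 hN]
      refine (abs_add_le _ _).trans (add_le_add (h1.trans (add_le_add_right h3 _)) ?_)
      rw [abs_mul, abs_of_pos (by positivity : 0 < 2 * h)]
      exact mul_le_mul_of_nonneg_left h2 (by positivity)
    rw [abs_mul, abs_of_pos (by positivity : 0 < 2 * h)] at h4
    have h5 : 2 * h * |D.diffValue hT h ν j i| ≤ 2 * h * (7 * C + (C' + m) / 2) := by
      linarith
    exact le_of_mul_le_mul_left h5 (by positivity)
  have hmB : m ≤ 7 * C + (C' + m) / 2 := by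
    refine hmle _ (by positivity) fun j hj => ?_
    rw [Finset.mem_Ico] at hj
    rw [abs_of_nonneg (hd0 _)]
    refine hdle _ _ (by positivity) fun i hi => ?_
    rw [Finset.mem_Icc] at hi
    exact hest _ (by omega) i hi.1 hi.2
  have := hest j hj i h0 hN
  linarith

end Estimates

/-! ### Dependence of the discrete gradient on the position and on the measure. -/

section DifferenceEstimates

variable (hD : D.Regular) (hα : D.IsUniqueArgmin αhat) (hC : D.BoundedBy αhat C)
  (hTM : T ≤ D.M) (hm : D.AdmissibleMesh T h)

include hD hC hTM hm hα

/-- The finite differences of the value function are Lipschitz in space, with constants that are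
summable in time. -/
theorem exists_diffValue_fdiff_le (hT : 0 ≤ T) (ν : ProbabilityMeasure (PathSpace T D.L))
    (hθ : 2 * (√T / D.σ) * C ≤ 1 / 2) {K : ℝ} (hK0 : 0 ≤ K)
    (hK : ∀ j < D.numTime T h, ∀ i : ℤ, 0 ≤ i → i ≤ D.numSpace h →
      |D.diffValue hT h ν j i| ≤ K) :
    ∃ e : ℕ → ℝ, (∀ j, 0 ≤ e j) ∧
      (∀ j < D.numTime T h, ∀ i : ℤ, 0 ≤ i → i < D.numSpace h →
        |D.diffValue hT h ν j (i + 1) - D.diffValue hT h ν j i| ≤ e j * h) ∧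
      D.timeStep h * ∑ j ∈ Finset.range (D.numTime T h), e j
        ≤ 4 * C * T / D.L + 16 * C * (√T / D.σ) + (4 + K) * T := by
  have hC0 : 0 ≤ C := zero_le_one.trans hC.one_le
  have hh := hm.h_pos
  have hL := hD.L_pos
  have hΔ := hD.timeStep_pos hh
  choose e he0 he hele using fun j =>
    exists_sup_abs (Finset.Ico 0 (D.numSpace h : ℤ))
      fun i => (D.diffValue hT h ν j (i + 1) - D.diffValue hT h ν j i) / h
  have he' : ∀ j, ∀ i : ℤ, 0 ≤ i → i < D.numSpace h →
      |D.diffValue hT h ν j (i + 1) - D.diffValue hT h ν j i| ≤ e j * h := by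
    intro j i h0 hN
    have := he j i (Finset.mem_Ico.2 ⟨h0, hN⟩)
    rwa [abs_div, abs_of_pos hh, div_le_iff₀ hh] at this
  refine ⟨e, he0, fun j _ => he' j, ?_⟩
  have hsource : ∀ j < D.numTime T h, ∀ i : ℤ, 0 ≤ i → i < D.numSpace h →
      |(D.timeStep h * D.valueHamiltonian αhat hT h ν j (i + 1) + D.correctorSource h j (i + 1))
        - (D.timeStep h * D.valueHamiltonian αhat hT h ν j i + D.correctorSource h j i)|
        ≤ D.timeStep h * h * (C * (4 + K + e j)) := by
    intro j hj i h0 hN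
    have h1 := hC.abs_hamiltonian_sub_le hα (hm.time_mem_of_le hD hTM hj.le)
      (marginal hT ν (j * D.timeStep h)) (marginal hT ν (j * D.timeStep h))
      (hm.space_mem (i := i + 1) (by omega) (by omega)) (hm.space_mem h0 hN.le)
      (hK j hj (i + 1) (by omega) (by omega)) (hK j hj i h0 hN.le)
      (w := 0) (W1_self _).le (W1_self _).le
    rw [← sub_mul] at h1
    push_cast at h1
    rw [add_sub_cancel_left, one_mul, abs_of_pos hh, zero_add] at h1
    have h2 := mul_le_mul_of_nonneg_left (he' j i h0 hN) hC0
    have h3 := abs_correctorSource_fdiff_le hD hC hTM hm hj h0 hN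
    have h4 : |D.timeStep h * (D.valueHamiltonian αhat hT h ν j (i + 1)
        - D.valueHamiltonian αhat hT h ν j i)|
        ≤ D.timeStep h * (C * h * (1 + K) + C * (e j * h)) := by
      rw [abs_mul, abs_of_pos hΔ]
      refine mul_le_mul_of_nonneg_left (le_trans (le_of_eq ?_) (h1.trans (by linarith))) hΔ.le
      simp only [valueHamiltonian]
      push_cast
      rfl
    rw [add_sub_add_comm, ← mul_sub]
    refine (abs_add_le _ _).trans ((add_le_add h4 h3).trans (le_of_eq ?_))
    ring
  -- The terms come from the variation of the corrector slope, the terminal data and the sources.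
  -- The second one is of order `1 / h` near the terminal time, so only the time sum of `e` is
  -- bounded uniformly in the mesh.
  have hvol : ∀ j < D.numTime T h, e j ≤ 2 * C / D.L
      + (4 * C / h) / √(D.numTime T h - j : ℕ)
      + ∑ k ∈ Finset.range (D.numTime T h - j - 1),
        (D.timeStep h / h * (C * (4 + K + e (j + 1 + k)))) / √((k : ℝ) + 1) := by
    intro j hj
    have hnn : 0 ≤ ∑ k ∈ Finset.range (D.numTime T h - j - 1),
        (D.timeStep h / h * (C * (4 + K + e (j + 1 + k)))) / √((k : ℝ) + 1) :=
      Finset.sum_nonneg fun k _ => by have := he0 (j + 1 + k); positivity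
    refine hele j _ (by positivity) fun i hi => ?_
    obtain ⟨h0, hN⟩ := Finset.mem_Ico.1 hi
    have h1 := (isReflectedHeat_reducedValue hD hα hT hTM hm ν).abs_cdiff_fdiff_le
      (c := fun j => D.timeStep h * h * (C * (4 + K + e j)))
      (fun j => by have := he0 j; positivity) hsource (by positivity)
      (fun i h0 hN => abs_reducedValue_terminal_fdiff_le hD hα hC hTM hm hT ν h0 hN) hj h0 hN
    have htm := hm.time_mem_of_le hD hTM (j := j + 1) hj
    have h2 : |(D.r ((j + 1 : ℕ) * D.timeStep h) + D.y ((j + 1 : ℕ) * D.timeStep h))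
        * (1 / ((D.numSpace h : ℝ) + 1))| ≤ 2 * C * (h / D.L) := by
      rw [abs_mul, abs_of_pos (by positivity : (0 : ℝ) < 1 / ((D.numSpace h : ℝ) + 1))]
      refine mul_le_mul ((abs_add_le _ _).trans ?_) (hm.inv_le hL) (by positivity) (by positivity)
      linarith [hC.r_le _ htm, hC.y_le _ htm]
    have h3 : 2 * h * (D.diffValue hT h ν j (i + 1) - D.diffValue hT h ν j i)
        = ((D.reducedValue hT h ν (j + 1) (clampIdx (D.numSpace h) (i + 1 + 1))
            - D.reducedValue hT h ν (j + 1) (clampIdx (D.numSpace h) (i + 1 - 1)))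
          - (D.reducedValue hT h ν (j + 1) (clampIdx (D.numSpace h) (i + 1))
            - D.reducedValue hT h ν (j + 1) (clampIdx (D.numSpace h) (i - 1))))
          + 2 * h * ((D.r ((j + 1 : ℕ) * D.timeStep h) + D.y ((j + 1 : ℕ) * D.timeStep h))
            * (1 / ((D.numSpace h : ℝ) + 1))) := by
      rw [mul_sub, two_mul_diffValue hh hT ν j (i := i + 1) (by omega) (by omega),
        two_mul_diffValue hh hT ν j h0 hN.le]
      have : (D.numSpace h : ℝ) + 1 ≠ 0 := by positivity
      push_cast
      field_simp
      ring
    have h4 : 2 * h * |D.diffValue hT h ν j (i + 1) - D.diffValue hT h ν j i|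
        ≤ (2 * (4 * C * h) / √(D.numTime T h - j : ℕ)
          + ∑ k ∈ Finset.range (D.numTime T h - j - 1),
            2 * (D.timeStep h * h * (C * (4 + K + e (j + 1 + k)))) / √((k : ℝ) + 1))
          + 2 * h * (2 * C * (h / D.L)) := by
      rw [← abs_of_pos (by positivity : 0 < 2 * h), ← abs_mul, abs_of_pos
        (by positivity : 0 < 2 * h), h3]
      refine (abs_add_le _ _).trans (add_le_add h1 ?_)
      rw [abs_mul, abs_of_pos (by positivity : 0 < 2 * h)]
      exact mul_le_mul_of_nonneg_left h2 (by positivity)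
    rw [abs_div, abs_of_pos hh, div_le_iff₀ hh]
    have h5 : 2 * h * |D.diffValue hT h ν j (i + 1) - D.diffValue hT h ν j i|
        ≤ 2 * h * ((2 * C / D.L + (4 * C / h) / √(D.numTime T h - j : ℕ)
          + ∑ k ∈ Finset.range (D.numTime T h - j - 1),
            (D.timeStep h / h * (C * (4 + K + e (j + 1 + k)))) / √((k : ℝ) + 1)) * h) := by
      refine h4.trans (le_of_eq ?_)
      have e1 : ∑ k ∈ Finset.range (D.numTime T h - j - 1),
          2 * (D.timeStep h * h * (C * (4 + K + e (j + 1 + k)))) / √((k : ℝ) + 1)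
          = 2 * h * ((∑ k ∈ Finset.range (D.numTime T h - j - 1),
            (D.timeStep h / h * (C * (4 + K + e (j + 1 + k)))) / √((k : ℝ) + 1)) * h) := by
        rw [Finset.sum_mul, Finset.mul_sum]
        refine Finset.sum_congr rfl fun k _ => ?_
        field_simp
      rw [e1]
      field_simp
      ring
    exact le_of_mul_le_mul_left h5 (by positivity)
  have hsum := sum_le_of_volterra (c := fun j => D.timeStep h / h * (C * (4 + K + e j)))
    (fun j => by have := he0 j; positivity) (by positivity) hvol
  set R := D.timeStep h * ∑ j ∈ Finset.range (D.numTime T h), e j with hR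
  have hR0 : 0 ≤ R := mul_nonneg hΔ.le (Finset.sum_nonneg fun j _ => he0 j)
  have e2 : ∑ j ∈ Finset.range (D.numTime T h), D.timeStep h / h * (C * (4 + K + e j))
      = C / h * ((4 + K) * T + R) := by
    rw [hR, ← Finset.mul_sum, ← Finset.mul_sum, Finset.sum_add_distrib,
      Finset.sum_const, Finset.card_range, nsmul_eq_mul]
    linear_combination (C / h * (4 + K)) * hm.numTime_mul hD
  rw [e2] at hsum
  have hsum' := mul_le_mul_of_nonneg_left hsum hΔ.le
  have e3 : D.timeStep h * (D.numTime T h * (2 * C / D.L)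
      + 2 * (4 * C / h) * √(D.numTime T h)
      + 2 * √(D.numTime T h) * (C / h * ((4 + K) * T + R)))
      = 2 * C / D.L * (D.numTime T h * D.timeStep h)
        + (D.timeStep h * √(D.numTime T h)) / h * (8 * C + 2 * C * ((4 + K) * T + R)) := by
    field_simp
    ring
  rw [e3, hm.numTime_mul hD, hm.timeStep_mul_sqrt hD, mul_div_cancel_left₀ _ hh.ne', ← hR] at hsum'
  -- Half of `R` is absorbed on the left, which doubles the remaining constants.
  have h6 : 2 * (√T / D.σ) * C * ((4 + K) * T + R) ≤ 1 / 2 * ((4 + K) * T + R) :=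
    mul_le_mul_of_nonneg_right hθ (by positivity)
  have e4 : 4 * C * T / D.L = 2 * (2 * C / D.L * T) := by ring
  rw [e4]
  linarith

/-- The finite differences of the value function depend on the flow of measures in a Lipschitz way,
with constants that are summable in time. -/
theorem exists_diffValue_sub_le (hT : 0 ≤ T) (ν ν' : ProbabilityMeasure (PathSpace T D.L))
    (hθ : 2 * (√T / D.σ) * C ≤ 1 / 2) {K : ℝ} (hK0 : 0 ≤ K)
    (hK : ∀ ν : ProbabilityMeasure (PathSpace T D.L), ∀ j < D.numTime T h, ∀ i : ℤ, 0 ≤ i →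
      i ≤ D.numSpace h → |D.diffValue hT h ν j i| ≤ K)
    {w : ℝ} (hw : W1 ν ν' ≤ w) (hw' : W1 ν' ν ≤ w) :
    ∃ δ : ℕ → ℝ, (∀ j, 0 ≤ δ j) ∧
      (∀ j < D.numTime T h, ∀ i : ℤ, 0 ≤ i → i ≤ D.numSpace h →
        |D.diffValue hT h ν j i - D.diffValue hT h ν' j i| ≤ δ j) ∧
      D.timeStep h * ∑ j ∈ Finset.range (D.numTime T h), δ j
        ≤ (4 * C * (√T / D.σ) + (1 + K) * T) * w := by
  have hC0 : 0 ≤ C := zero_le_one.trans hC.one_le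
  have hh := hm.h_pos
  have hL := hD.L_pos
  have hΔ := hD.timeStep_pos hh
  have hw0 : 0 ≤ w := (W1_nonneg _ _).trans hw
  have hmarg : ∀ t, W1 (marginal hT ν t) (marginal hT ν' t) ≤ w := fun t =>
    (W1_marginal_le hT hL.le ν ν' t).trans hw
  have hmarg' : ∀ t, W1 (marginal hT ν' t) (marginal hT ν t) ≤ w := fun t =>
    (W1_marginal_le hT hL.le ν' ν t).trans hw'
  choose δ hδ0 hδ hδle using fun j =>
    exists_sup_abs (Finset.Icc 0 (D.numSpace h : ℤ))
      fun i => D.diffValue hT h ν j i - D.diffValue hT h ν' j i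
  have hδ' : ∀ j, ∀ i : ℤ, 0 ≤ i → i ≤ D.numSpace h →
      |D.diffValue hT h ν j i - D.diffValue hT h ν' j i| ≤ δ j := fun j i h0 hN =>
    hδ j i (Finset.mem_Icc.2 ⟨h0, hN⟩)
  refine ⟨δ, hδ0, fun j _ => hδ' j, ?_⟩
  have hsource : ∀ j < D.numTime T h, ∀ i : ℤ, 0 ≤ i → i ≤ D.numSpace h →
      |D.timeStep h * (D.valueHamiltonian αhat hT h ν j i - D.valueHamiltonian αhat hT h ν' j i)|
        ≤ D.timeStep h * (C * (w * (1 + K) + δ j)) := by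
    intro j hj i h0 hN
    have h1 := hC.abs_hamiltonian_sub_le hα (hm.time_mem_of_le hD hTM hj.le)
      (marginal hT ν (j * D.timeStep h)) (marginal hT ν' (j * D.timeStep h))
      (hm.space_mem h0 hN) (hm.space_mem h0 hN) (hK ν j hj i h0 hN) (hK ν' j hj i h0 hN)
      (hmarg _) (hmarg' _)
    rw [sub_self, abs_zero, add_zero] at h1
    have h2 := mul_le_mul_of_nonneg_left (hδ' j i h0 hN) hC0
    rw [abs_mul, abs_of_pos hΔ]
    exact mul_le_mul_of_nonneg_left (h1.trans (by linarith)) hΔ.le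
  have hterm : ∀ i : ℤ, 0 ≤ i → i ≤ D.numSpace h →
      |D.value hT h ν (D.numTime T h) i - D.value hT h ν' (D.numTime T h) i| ≤ C * w := by
    intro i h0 hN
    rw [value_terminal hD hm hTM hα h0 hN, value_terminal hD hm hTM hα h0 hN]
    have h1 := hC.g_lip (marginal hT ν T) (marginal hT ν' T) _ (hm.space_mem h0 hN) _
      (hm.space_mem h0 hN)
    rw [sub_self, abs_zero, add_zero] at h1
    exact h1.trans (mul_le_mul_of_nonneg_left (hmarg _) hC0)
  -- The terminal costs of the two problems are only known to be uniformly close, so smoothing of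
  -- bounded data is used, at the price of a singularity at the terminal time.
  have hvol : ∀ j < D.numTime T h, δ j ≤ 0 + (C * w / h) / √(D.numTime T h - j : ℕ)
      + ∑ k ∈ Finset.range (D.numTime T h - j - 1),
        (D.timeStep h / h * (C * (w * (1 + K) + δ (j + 1 + k)))) / √((k : ℝ) + 1) := by
    intro j hj
    have hnn : 0 ≤ ∑ k ∈ Finset.range (D.numTime T h - j - 1),
        (D.timeStep h / h * (C * (w * (1 + K) + δ (j + 1 + k)))) / √((k : ℝ) + 1) :=
      Finset.sum_nonneg fun k _ => by have := hδ0 (j + 1 + k); positivity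
    refine hδle j _ (by positivity) fun i hi => ?_
    obtain ⟨h0, hN⟩ := Finset.mem_Icc.1 hi
    have h1 := (isReflectedHeat_value_sub hD hα hT hTM hm ν ν').abs_cdiff_le_of_bounded
      (c := fun j => D.timeStep h * (C * (w * (1 + K) + δ j))) hsource hterm hj h0 hN
    beta_reduce at h1
    rw [← two_mul_diffValue_sub hh hT ν ν' j h0 hN, abs_mul,
      abs_of_pos (by positivity : 0 < 2 * h)] at h1
    refine le_of_mul_le_mul_left (h1.trans (le_of_eq ?_)) (by positivity : 0 < 2 * h)
    have e1 : ∑ k ∈ Finset.range (D.numTime T h - j - 1),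
        2 * (D.timeStep h * (C * (w * (1 + K) + δ (j + 1 + k)))) / √((k : ℝ) + 1)
        = 2 * h * ∑ k ∈ Finset.range (D.numTime T h - j - 1),
          (D.timeStep h / h * (C * (w * (1 + K) + δ (j + 1 + k)))) / √((k : ℝ) + 1) := by
      rw [Finset.mul_sum]
      refine Finset.sum_congr rfl fun k _ => ?_
      field_simp
    rw [e1]
    field_simp
    ring
  have hsum := sum_le_of_volterra (c := fun j => D.timeStep h / h * (C * (w * (1 + K) + δ j)))
    (fun j => by have := hδ0 j; positivity) (by positivity) hvol
  set R := D.timeStep h * ∑ j ∈ Finset.range (D.numTime T h), δ j with hR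
  have hR0 : 0 ≤ R := mul_nonneg hΔ.le (Finset.sum_nonneg fun j _ => hδ0 j)
  have e2 : ∑ j ∈ Finset.range (D.numTime T h), D.timeStep h / h * (C * (w * (1 + K) + δ j))
      = C / h * (w * (1 + K) * T + R) := by
    rw [hR, ← Finset.mul_sum, ← Finset.mul_sum, Finset.sum_add_distrib,
      Finset.sum_const, Finset.card_range, nsmul_eq_mul]
    linear_combination (C / h * (w * (1 + K))) * hm.numTime_mul hD
  rw [e2] at hsum
  have hsum' := mul_le_mul_of_nonneg_left hsum hΔ.le
  have e3 : D.timeStep h * (D.numTime T h * 0 + 2 * (C * w / h) * √(D.numTime T h)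
      + 2 * √(D.numTime T h) * (C / h * (w * (1 + K) * T + R)))
      = (D.timeStep h * √(D.numTime T h)) / h * (2 * C * w + 2 * C * (w * (1 + K) * T + R)) := by
    field_simp
    ring
  rw [e3, hm.timeStep_mul_sqrt hD, mul_div_cancel_left₀ _ hh.ne', ← hR] at hsum'
  have h6 : 2 * (√T / D.σ) * C * (w * (1 + K) * T + R) ≤ 1 / 2 * (w * (1 + K) * T + R) :=
    mul_le_mul_of_nonneg_right hθ (by positivity)
  linarith

end DifferenceEstimates

/-! ### The contraction estimate for short horizons. -/

section Contraction

variable (hD : D.Regular) (hα : D.IsUniqueArgmin αhat) (hC : D.BoundedBy αhat C)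
  (hTM : T ≤ D.M) (hm : D.AdmissibleMesh T h)

/-- A grid function with increments at most `a` is Lipschitz with constant `a`. -/
theorem abs_sub_le_of_fdiff_le {N : ℕ} {F : ℤ → ℝ} {a : ℝ}
    (hF : ∀ i : ℤ, 0 ≤ i → i < N → |F (i + 1) - F i| ≤ a) {i i' : ℤ} (h0 : 0 ≤ i) (hN : i ≤ N)
    (h0' : 0 ≤ i') (hN' : i' ≤ N) : |F i - F i'| ≤ a * |(i : ℝ) - i'| := by
  have key : ∀ n : ℕ, ∀ i : ℤ, 0 ≤ i → i + n ≤ N → |F (i + n) - F i| ≤ a * n := by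
    intro n
    induction n with
    | zero => intro i _ _; simp
    | succ n ih =>
      intro i h0 hN
      have h1 := ih i h0 (by push_cast at hN; omega)
      have h2 := hF (i + n) (by omega) (by push_cast at hN; omega)
      have h3 := abs_add_le (F (i + n + 1) - F (i + n)) (F (i + n) - F i)
      rw [sub_add_sub_cancel] at h3
      push_cast
      rw [← add_assoc]
      linarith
  rcases le_total i' i with hle | hle
  · have h1 := key (i - i').toNat i' h0' (by omega)
    have h2 : ((i - i').toNat : ℤ) = i - i' := by omega
    have h3 : (((i - i').toNat : ℕ) : ℝ) = i - i' := by exact_mod_cast h2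
    rw [h2, h3, add_sub_cancel] at h1
    rwa [abs_of_nonneg (by rw [sub_nonneg]; exact_mod_cast hle : (0 : ℝ) ≤ (i : ℝ) - i')]
  · have h1 := key (i' - i).toNat i h0 (by omega)
    have h2 : ((i' - i).toNat : ℤ) = i' - i := by omega
    have h3 : (((i' - i).toNat : ℕ) : ℝ) = i' - i := by exact_mod_cast h2
    rw [h2, h3, add_sub_cancel] at h1
    rwa [abs_sub_comm (F i), abs_sub_comm (i : ℝ),
      abs_of_nonneg (by rw [sub_nonneg]; exact_mod_cast hle : (0 : ℝ) ≤ (i' : ℝ) - i)]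

include hD in
-- Two differing coins cost a distance `2 h`, and `2 h * (h / (2 σ²))` is the time step. The
-- projection onto `[0,1]` is nonexpansive.
theorem two_mul_abs_upProb_sub_le (hh : 0 < h) (hT : 0 ≤ T)
    (ν ν' : ProbabilityMeasure (PathSpace T D.L)) (t : ℕ) (i i' : ℤ) (u u' : ℝ) :
    2 * h * |(D.upProb hT h ν (t, i) u : ℝ) - D.upProb hT h ν' (t, i') u'|
      ≤ D.timeStep h * |D.b (t * D.timeStep h) (marginal hT ν (t * D.timeStep h)) (i * h) u
        - D.b (t * D.timeStep h) (marginal hT ν' (t * D.timeStep h)) (i' * h) u'| := by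
  have hσ := hD.σ_pos
  set b := D.b (t * D.timeStep h) (marginal hT ν (t * D.timeStep h)) (i * h) u with hb
  set b' := D.b (t * D.timeStep h) (marginal hT ν' (t * D.timeStep h)) (i' * h) u' with hb'
  have h1 : |(D.upProb hT h ν (t, i) u : ℝ) - D.upProb hT h ν' (t, i') u'|
      ≤ |(h * b + D.σ ^ 2) / (2 * D.σ ^ 2) - (h * b' + D.σ ^ 2) / (2 * D.σ ^ 2)| :=
    Set.abs_projIcc_sub_projIcc zero_le_one
  have h2 : (h * b + D.σ ^ 2) / (2 * D.σ ^ 2) - (h * b' + D.σ ^ 2) / (2 * D.σ ^ 2)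
      = (h / (2 * D.σ ^ 2)) * (b - b') := by
    field_simp
    ring
  rw [h2, abs_mul, abs_of_pos (by positivity : 0 < h / (2 * D.σ ^ 2))] at h1
  refine (mul_le_mul_of_nonneg_left h1 (by positivity)).trans (le_of_eq ?_)
  rw [timeStep]
  field_simp

include hD hα hC hTM hm

/-- The Lipschitz estimate for the fixed point map. -/
theorem W1_Phi_le_mul (hT : 0 ≤ T) (hθ : 2 * (√T / D.σ) * C ≤ 1 / 2) {K : ℝ}
    (hK : K = 14 * C + (1 + D.σ ^ 2 / D.L + 2 * D.L)) {i₀ : ℤ} (hi₀ : D.IsGridIndex h i₀)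
    (ν ν' : ProbabilityMeasure (PathSpace T D.L)) :
    W1 (D.Phi hT h ν αhat hD.L_pos.le i₀) (D.Phi hT h ν' αhat hD.L_pos.le i₀)
      ≤ 2 * C ^ 2 * ((T + 4 * C * (√T / D.σ) + (1 + K) * T) * W1 ν ν')
        * Real.exp (2 * C ^ 2 * (T + (4 * C * T / D.L + 16 * C * (√T / D.σ) + (4 + K) * T))) := by
  have hC1 := hC.one_le
  have hC0 : 0 ≤ C := zero_le_one.trans hC1
  have hh := hm.h_pos
  have hL := hD.L_pos
  have hσ := hD.σ_pos
  have hΔ := hD.timeStep_pos hh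
  have hK0 : 0 ≤ K := by rw [hK]; positivity
  have hbound : ∀ ν : ProbabilityMeasure (PathSpace T D.L), ∀ j < D.numTime T h, ∀ i : ℤ, 0 ≤ i →
      i ≤ D.numSpace h → |D.diffValue hT h ν j i| ≤ K := fun ν j hj i h0 hN => by
    rw [hK]; exact abs_diffValue_le hD hα hC hTM hm hT ν hθ hj h0 hN
  set w := W1 ν ν' with hw
  have hw0 : 0 ≤ w := W1_nonneg _ _
  -- The gradients for `(ν, i)` and `(ν', i')` are compared through `(ν', i)`: the change of measure
  -- is paid by `δ`, the change of site by `e`.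
  obtain ⟨e, he0, he, hesum⟩ := exists_diffValue_fdiff_le hD hα hC hTM hm hT ν' hθ hK0 (hbound ν')
  obtain ⟨δ, hδ0, hδ, hδsum⟩ := exists_diffValue_sub_le hD hα hC hTM hm hT ν ν' hθ hK0 hbound
    (w := w) le_rfl (W1_comm ν' ν).le
  -- One factor `C` is the Lipschitz constant of `b`, the other that of `αhat`; as `C ≥ 1`, the
  -- direct dependence of `b` is covered by doubling.
  have hmain := W1_Phi_le hT hh.le ν ν' αhat hL.le hi₀
    (a := fun t => 2 * C ^ 2 * (D.timeStep h * (w + δ t)))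
    (κ := fun t => 2 * C ^ 2 * (D.timeStep h * (1 + e t)))
    (fun t => by have := hδ0 t; positivity) (fun t => by have := he0 t; positivity) ?_
  · refine hmain.trans (mul_le_mul ?_ (Real.exp_le_exp.2 ?_) (Real.exp_pos _).le ?_)
    · rw [← Finset.mul_sum, ← Finset.mul_sum, Finset.sum_add_distrib, Finset.sum_const,
        Finset.card_range, nsmul_eq_mul]
      refine mul_le_mul_of_nonneg_left ?_ (by positivity)
      have : D.timeStep h * (D.numTime T h * w) = T * w := by
        linear_combination w * hm.numTime_mul hD
      rw [mul_add, this]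
      linarith
    · rw [← Finset.mul_sum, ← Finset.mul_sum, Finset.sum_add_distrib, Finset.sum_const,
        Finset.card_range, nsmul_eq_mul]
      refine mul_le_mul_of_nonneg_left ?_ (by positivity)
      have : D.timeStep h * (D.numTime T h * 1) = T := by
        linear_combination hm.numTime_mul hD
      rw [mul_add, this]
      linarith
    · positivity
  · intro t ht i i' h0 hN h0' hN'
    have htm := hm.time_mem_of_le hD hTM ht.le
    have hx := hm.space_mem h0 hN
    have hx' := hm.space_mem h0' hN'
    have hmarg : W1 (marginal hT ν (t * D.timeStep h)) (marginal hT ν' (t * D.timeStep h)) ≤ w :=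
      W1_marginal_le hT hL.le ν ν' _
    set x : ℝ := |(i : ℝ) - i'| * h with hxdef
    have hx0 : 0 ≤ x := by positivity
    have hxx : |(i : ℝ) * h - i' * h| = x := by rw [← sub_mul, abs_mul, abs_of_pos hh]
    have hu := (hα _ htm (marginal hT ν (t * D.timeStep h)) _ hx (D.diffValue hT h ν t i)).1
    have hu' := (hα _ htm (marginal hT ν' (t * D.timeStep h)) _ hx' (D.diffValue hT h ν' t i')).1
    have h1 : |D.diffValue hT h ν t i - D.diffValue hT h ν' t i'| ≤ δ t + e t * x := by
      have h2 := abs_sub_le_of_fdiff_le (he t ht) h0 hN h0' hN'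
      have h3 := abs_sub_le (D.diffValue hT h ν t i) (D.diffValue hT h ν' t i)
        (D.diffValue hT h ν' t i')
      have h4 := hδ t ht i h0 hN
      rw [hxdef]
      linarith
    have h2 := hC.αhat_lip _ htm (marginal hT ν (t * D.timeStep h))
      (marginal hT ν' (t * D.timeStep h)) _ hx _ hx' (D.diffValue hT h ν t i)
      (D.diffValue hT h ν' t i')
    have h3 := hC.b_lip _ htm (marginal hT ν (t * D.timeStep h))
      (marginal hT ν' (t * D.timeStep h)) _ hx _ hx' _ hu _ hu'
    rw [hxx] at h2 h3
    have h4 := (two_mul_abs_upProb_sub_le hD hh hT ν ν' t i i'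
      (D.optControl hT h ν αhat (t, i)) (D.optControl hT h ν' αhat (t, i')))
    refine h4.trans ?_
    have h5 : C * (W1 (marginal hT ν (t * D.timeStep h)) (marginal hT ν' (t * D.timeStep h)) + x
        + |D.diffValue hT h ν t i - D.diffValue hT h ν' t i'|) ≤ C * (w + x + (δ t + e t * x)) :=
      mul_le_mul_of_nonneg_left (by linarith) hC0
    have h6 := h3.trans (mul_le_mul_of_nonneg_left
      (add_le_add (add_le_add hmarg (le_refl x)) (h2.trans h5)) hC0)
    refine (mul_le_mul_of_nonneg_left h6 hΔ.le).trans ?_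
    have h7 : C * (w + x + C * (w + x + (δ t + e t * x)))
        ≤ 2 * C ^ 2 * ((w + δ t) + (1 + e t) * x) := by
      have k1 : C * (w + x) ≤ C ^ 2 * (w + x) :=
        mul_le_mul_of_nonneg_right (by nlinarith) (by positivity)
      have k2 : 0 ≤ C ^ 2 * (δ t + e t * x) := by
        have := hδ0 t
        have := he0 t
        positivity
      linarith
    exact (mul_le_mul_of_nonneg_left h7 hΔ.le).trans_eq (by ring)

end Contraction

/-- For short horizons the fixed point map is a contraction with constant `1 / 2`. -/
theorem exists_horizon (hD : D.Regular) (C K : ℝ) :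
    ∃ τ : ℝ, 0 < τ ∧ τ ≤ D.M ∧ ∀ T, 0 < T → T ≤ τ →
      2 * (√T / D.σ) * C ≤ 1 / 2 ∧
      2 * C ^ 2 * (T + 4 * C * (√T / D.σ) + (1 + K) * T)
        * Real.exp (2 * C ^ 2 * (T + (4 * C * T / D.L + 16 * C * (√T / D.σ) + (4 + K) * T)))
        ≤ 1 / 2 := by
  have hM := hD.M_pos
  -- Both expressions are continuous in `T` on the whole line and vanish at `T = 0`.
  have c1 : Filter.Tendsto (fun T : ℝ => 2 * (√T / D.σ) * C) (nhds 0) (nhds 0) := by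
    have : Continuous fun T : ℝ => 2 * (√T / D.σ) * C := by fun_prop
    simpa using this.tendsto 0
  have c2 : Filter.Tendsto (fun T : ℝ => 2 * C ^ 2 * (T + 4 * C * (√T / D.σ) + (1 + K) * T)
      * Real.exp (2 * C ^ 2 * (T + (4 * C * T / D.L + 16 * C * (√T / D.σ) + (4 + K) * T))))
      (nhds 0) (nhds 0) := by
    have : Continuous fun T : ℝ => 2 * C ^ 2 * (T + 4 * C * (√T / D.σ) + (1 + K) * T)
      * Real.exp (2 * C ^ 2 * (T + (4 * C * T / D.L + 16 * C * (√T / D.σ) + (4 + K) * T))) := by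
      fun_prop
    simpa using this.tendsto 0
  have ev := (c1.eventually (ge_mem_nhds (by norm_num : (0 : ℝ) < 1 / 2))).and
    (c2.eventually (ge_mem_nhds (by norm_num : (0 : ℝ) < 1 / 2)))
  obtain ⟨ε, hε, hball⟩ := Metric.eventually_nhds_iff.1 ev
  refine ⟨min (ε / 2) D.M, by positivity, min_le_right _ _, fun T hT hTτ => hball ?_⟩
  rw [Real.dist_eq, sub_zero, abs_of_pos hT]
  linarith [min_le_left (ε / 2) D.M]

/-! ### The iteration -/

section Iteration

variable (hT : 0 ≤ T) (i₀ : ℤ) (ν₁ : ProbabilityMeasure (PathSpace T D.L)) {q : ℝ}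

theorem Phi_iterate (hL : 0 ≤ D.L) {k : ℕ} (hk : 1 ≤ k) :
    D.Phi hT h (D.iterate hT h αhat hL i₀ ν₁ k) αhat hL i₀
      = D.iterate hT h αhat hL i₀ ν₁ (k + 1) := by
  obtain ⟨m, rfl⟩ : ∃ m, k = m + 1 := ⟨k - 1, by omega⟩
  simp only [iterate, Nat.add_sub_cancel]
  rw [Function.iterate_succ_apply']

theorem stoppingIndices_nonempty (hL : 0 ≤ D.L) (hh : 0 < h) (hq0 : 0 < q) (hq1 : q < 1)
    (hΦ : ∀ ν ν' : ProbabilityMeasure (PathSpace T D.L),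
      W1 (D.Phi hT h ν αhat hL i₀) (D.Phi hT h ν' αhat hL i₀) ^ 2 ≤ q * (h ^ 2 + W1 ν ν' ^ 2)) :
    (D.stoppingIndices hT h αhat hL i₀ ν₁ q).Nonempty := by
  have hq' : 0 < 1 - q := sub_pos.2 hq1
  -- The squared residual, shifted so that `m = 0` is the initial measure `ν^1`.
  set a : ℕ → ℝ := fun m =>
    W1 (D.Phi hT h (D.iterate hT h αhat hL i₀ ν₁ (m + 1)) αhat hL i₀)
      (D.iterate hT h αhat hL i₀ ν₁ (m + 1)) ^ 2 with ha
  have hstep : ∀ m, a (m + 1) ≤ q * (h ^ 2 + a m) := by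
    intro m
    have := hΦ (D.Phi hT h (D.iterate hT h αhat hL i₀ ν₁ (m + 1)) αhat hL i₀)
      (D.iterate hT h αhat hL i₀ ν₁ (m + 1))
    simp only [ha]
    rwa [Phi_iterate hT i₀ ν₁ hL (Nat.le_add_left 1 m)] at this ⊢
  -- `q / (1 - q) * h²` is the fixed point of `x ↦ q (h² + x)`. The stopping threshold is twice this
  -- value, which leaves room for the decaying transient.
  have hgeo : ∀ m, a m ≤ q ^ m * a 0 + q / (1 - q) * h ^ 2 := by
    intro m
    induction m with
    | zero =>
      have : 0 ≤ q / (1 - q) * h ^ 2 := by positivity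
      simpa using this
    | succ m ih =>
      refine (hstep m).trans ((mul_le_mul_of_nonneg_left (add_le_add_right ih _) hq0.le).trans_eq ?_)
      field_simp
      ring
  have hlim : Filter.Tendsto (fun m => q ^ m * a 0) Filter.atTop (nhds 0) := by
    simpa using (tendsto_pow_atTop_nhds_zero_of_lt_one hq0.le hq1).mul_const (a 0)
  have hpos : 0 < q / (1 - q) * h ^ 2 := by positivity
  obtain ⟨m, hm⟩ := (hlim.eventually (gt_mem_nhds hpos)).exists
  refine ⟨m + 1, Nat.le_add_left 1 m, (hgeo m).trans ?_⟩
  have : 2 * q / (1 - q) * h ^ 2 = q / (1 - q) * h ^ 2 + q / (1 - q) * h ^ 2 := by ring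
  rw [this]
  linarith

theorem W1_selected_le (hL : 0 ≤ D.L) (hne : (D.stoppingIndices hT h αhat hL i₀ ν₁ q).Nonempty) :
    W1 (D.Phi hT h (D.selected hT h αhat hL i₀ ν₁ q) αhat hL i₀)
      (D.selected hT h αhat hL i₀ ν₁ q) ^ 2 ≤ 2 * q / (1 - q) * h ^ 2 :=
  (Nat.sInf_mem hne).2

end Iteration

end Data

end MFG

end

theorem proposition3p3 (D : MFG.Data) (hD : D.Regular)
    (αhat : ℝ → D.StateLaw → ℝ → ℝ → ℝ) (hα : D.IsUniqueArgmin αhat)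
    (hLip : D.ArgminLipschitz αhat) :
    ∃ That hhat q : ℝ, 0 < That ∧ That ≤ D.M ∧ 0 < hhat ∧ 0 < q ∧ q < 1 ∧
      (∀ (T : ℝ) (hT : 0 < T), T ≤ That →
        ∀ h : ℝ, D.AdmissibleMesh T h → h < min hhat That →
        ∀ i₀ : ℤ, D.IsGridIndex h i₀ →
        ∀ ν ν' : MeasureTheory.ProbabilityMeasure (MFG.PathSpace T D.L),
          MFG.W1 (D.Phi hT.le h ν αhat hD.L_pos.le i₀) (D.Phi hT.le h ν' αhat hD.L_pos.le i₀) ^ 2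
            ≤ q * (h ^ 2 + MFG.W1 ν ν' ^ 2)) ∧
      (∀ (T : ℝ) (hT : 0 < T), T ≤ That →
        ∀ (i₀ : ℝ → ℤ) (ν₁ : ℝ → MeasureTheory.ProbabilityMeasure (MFG.PathSpace T D.L)),
          (∀ h : ℝ, D.AdmissibleMesh T h → D.IsGridIndex h (i₀ h)) →
          (∀ h : ℝ, D.AdmissibleMesh T h → h < min hhat That →
            (D.stoppingIndices hT.le h αhat hD.L_pos.le (i₀ h) (ν₁ h) q).Nonempty) ∧
          Filter.Tendsto
            (fun h : ℝ =>
              MFG.W1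
                (D.Phi hT.le h (D.selected hT.le h αhat hD.L_pos.le (i₀ h) (ν₁ h) q) αhat
                  hD.L_pos.le (i₀ h))
                (D.selected hT.le h αhat hD.L_pos.le (i₀ h) (ν₁ h) q) ^ 2)
            (nhdsWithin 0 {h : ℝ | D.AdmissibleMesh T h}) (nhds 0)) := by
  obtain ⟨C, hC⟩ := MFG.Data.exists_boundedBy hD hα hLip
  obtain ⟨τ, hτ, hτM, hτT⟩ := MFG.Data.exists_horizon hD C
    (14 * C + (1 + D.σ ^ 2 / D.L + 2 * D.L))
  have contraction : ∀ (T : ℝ) (hT : 0 < T), T ≤ τ → ∀ h : ℝ, D.AdmissibleMesh T h →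
      ∀ i₀ : ℤ, D.IsGridIndex h i₀ →
      ∀ ν ν' : MeasureTheory.ProbabilityMeasure (MFG.PathSpace T D.L),
        MFG.W1 (D.Phi hT.le h ν αhat hD.L_pos.le i₀) (D.Phi hT.le h ν' αhat hD.L_pos.le i₀) ^ 2
          ≤ 1 / 2 * (h ^ 2 + MFG.W1 ν ν' ^ 2) := by
    intro T hT hTτ h hm i₀ hi₀ ν ν'
    obtain ⟨hθ, hsmall⟩ := hτT T hT hTτ
    have h1 := MFG.Data.W1_Phi_le_mul hD hα hC (hTτ.trans hτM) hm hT.le hθ rfl hi₀ ν ν'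
    have h2 := mul_le_mul_of_nonneg_right hsmall (MFG.W1_nonneg ν ν')
    have h3 : MFG.W1 (D.Phi hT.le h ν αhat hD.L_pos.le i₀) (D.Phi hT.le h ν' αhat hD.L_pos.le i₀)
        ≤ 1 / 2 * MFG.W1 ν ν' := h1.trans ((le_of_eq (by ring)).trans h2)
    -- Squaring the contraction gives the factor `1/4`, well within the claimed `1/2`.
    have h4 := pow_le_pow_left₀ (MFG.W1_nonneg _ _) h3 2
    nlinarith [sq_nonneg h, sq_nonneg (MFG.W1 ν ν')]
  have hq : 2 * (1 / 2 : ℝ) / (1 - 1 / 2) = 2 := by norm_num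
  -- The mesh threshold `1` is arbitrary, since the contraction is uniform over all admissible
  -- meshes.
  refine ⟨τ, 1, 1 / 2, hτ, hτM, one_pos, by norm_num, by norm_num,
    fun T hT hTτ h hm _ => contraction T hT hTτ h hm, fun T hT hTτ i₀ ν₁ hi₀ => ?_⟩
  have hne : ∀ h : ℝ, D.AdmissibleMesh T h →
      (D.stoppingIndices hT.le h αhat hD.L_pos.le (i₀ h) (ν₁ h) (1 / 2)).Nonempty := fun h hm =>
    MFG.Data.stoppingIndices_nonempty hT.le (i₀ h) (ν₁ h) hD.L_pos.le hm.h_pos (by norm_num)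
      (by norm_num) (contraction T hT hTτ h hm _ (hi₀ h hm))
  refine ⟨fun h hm _ => hne h hm, ?_⟩
  -- With `q = 1/2` the stopping threshold is `2 h²`, and it squeezes the residual to zero.
  refine tendsto_of_tendsto_of_tendsto_of_le_of_le' (g := fun _ => 0) (h := fun h => 2 * h ^ 2)
    tendsto_const_nhds ?_ (Filter.Eventually.of_forall fun h => sq_nonneg _) ?_
  · have : Continuous fun h : ℝ => 2 * h ^ 2 := by fun_prop
    simpa using (this.tendsto 0).mono_left nhdsWithin_le_nhds
  · refine eventually_nhdsWithin_of_forall fun h hm => ?_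
    have := MFG.Data.W1_selected_le hT.le (i₀ h) (ν₁ h) hD.L_pos.le (hne h hm)
    rwa [hq] at this
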